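/- Let $\Gamma=(E,V,i,j)$ be a compact connected metric graph without loops or multiple edges, i.e. $E$ is finite and every edge $e\in E$ is an interval $(0,l_e)$ with $0<l_e<\infty$, initial vertex $i(e)$ and terminal vertex $j(e)$. Let $X_\Gamma$ be the space obtained by gluing the closed intervals $[0,l_e]$ at the vertices, let $c_e>0$ ($e\in E$) be weights, and let $\mu_\Gamma$ be the measure on $X_\Gamma$ that has no atoms and equals $c_e$ times Lebesgue measure on each edge $e$; write $L^2=L^2(X_\Gamma,\mu_\Gamma)$ and $f_e$ for the restriction of $f$ to $e$. Let $W^{1,2}=W^{1,2}(X_\Gamma,\mu_\Gamma)$ be the space of continuous functions $f$ on $X_\Gamma$ having a distributional derivative $f_e'\in L^2(0,l_e)$ on each edge. Let $d:W^{1,2}\to L^2$, $(df)_e=c_e^{-1/2}f_e'$, viewed as a densely defined operator in $L^2$, and let $d^*$ be its adjoint. Let $\mathcal{L}_\Gamma$ be the Kirchhoff Laplacian, i.e. the generator of the Dirichlet form $\mathcal{E}_\Gamma(f,g)=\langle df,dg\rangle_{L^2}=\sum_{e}\int_0^{l_e}f_e'g_e'\,ds$ with domain $W^{1,2}$, and let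 $(e^{t\mathcal{L}_\Gamma})_{t\ge 0}$ be the strongly continuous semigroup on $L^2$ generated by it. Let $\mathcal{D}(\vec{\mathcal{L}}_\Gamma)=\{v\in\mathcal{D}(d^*): d^*v\in W^{1,2}\}$. A function $u\in C([0,\infty),L^2)\cap C^1((0,\infty),L^2)$ is called a solution of the vector Burgers problem $$u_t=-dd^*u-\tfrac12 d(u^2)\quad (t>0),\qquad u(0)=u_0\in L^2,$$ if $u(0)=u_0$ in $L^2$ and the equation holds in $(\mathcal{D}(\vec{\mathcal{L}}_\Gamma))^*$, that is, for all $t>0$ and all $v\in\mathcal{D}(\vec{\mathcal{L}}_\Gamma)$, $$\langle u_t(t),v\rangle_{L^2}=-\langle u(t),d(d^*v)\rangle_{L^2}-\tfrac12\int_{X_\Gamma}(d^*v)\,u(t)^2\,d\mu_\Gamma .$$ **Theorem.** The semigroup $(e^{t\mathcal{L}_\Gamma})_{t\ge0}$ exists. Let $u_0=dh_0$ with $h_0\in W^{1,2}$ and put $w_0=e^{-h_0/2}$. Then $w(t)=e^{t\mathcal{L}_\Gamma}w_0$, $t\ge0$, is the unique $w\in C([0,\infty),L^2)\cap C^1((0,\infty),L^2)$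 with $w(t)\in\mathcal{D}(\mathcal{L}_\Gamma)$ and $w_t(t)=\mathcal{L}_\Gamma w(t)$ for $t>0$ and $w(0)=w_0$; each $w(t)$ has a continuous, strictly positive representative on $X_\Gamma$ with $\log w(t)\in W^{1,2}$; and $$u(t):=-2\,d\log w(t),\qquad t\ge0,$$ is the unique solution of the vector Burgers problem with initial condition $u_0$. -/

import Mathlib

open MeasureTheory Set Filter Topology
open scoped ContDiff InnerProductSpace LinearPMap

/-- A weighted metric graph all of whose edges have finite length: every `e : E` is an interval
`(0, len e)` with an initial vertex `init e`, a terminal vertex `term e` and a weight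
`weight e = c_e > 0`. It is compact if `E` is finite. -/
structure MetricGraph (V E : Type*) where
  init : E → V
  term : E → V
  len : E → ℝ
  len_pos : ∀ e, 0 < len e
  weight : E → ℝ
  weight_pos : ∀ e, 0 < weight e

namespace MetricGraph

variable {V E : Type*} (Γ : MetricGraph V E)

/-- The edge `e` and the vertex `p` are incident. -/
def Incident (e : E) (p : V) : Prop := Γ.init e = p ∨ Γ.term e = p

/-- Two distinct vertices are neighbors if they are incident to the same edge. -/
def Neighbor (p q : V) : Prop := p ≠ q ∧ ∃ e, Γ.Incident e p ∧ Γ.Incident e q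

/-- Any two vertices are joined by a finite chain of neighbors. -/
def Connected : Prop := ∀ p q : V, Relation.ReflTransGen Γ.Neighbor p q

def NoLoops : Prop := ∀ e, Γ.init e ≠ Γ.term e

def NoMultipleEdges : Prop :=
  ∀ e e', e ≠ e' → ({Γ.init e, Γ.term e} : Set V) ≠ {Γ.init e', Γ.term e'}

/-- The point set `X_Γ`: the disjoint union of the vertex set and of all the open edges. -/
def Space : Type _ := V ⊕ (Σ e : E, Ioo (0 : ℝ) (Γ.len e))

variable {Γ} in
/-- The parametrization of the closed edge `e` by `[0, len e]`: it takes `0` to the initial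
vertex, `len e` to the terminal vertex, and `s ∈ (0, len e)` to the point `(e, s)`. It is extended
to the real line by a constant on either side. -/
noncomputable def edge (e : E) (s : ℝ) : Γ.Space :=
  if h₀ : s ≤ 0 then Sum.inl (Γ.init e)
  else if h₁ : s < Γ.len e then Sum.inr ⟨e, s, not_le.mp h₀, h₁⟩
  else Sum.inl (Γ.term e)

/-- The topology obtained by gluing the closed intervals `[0, len e]` at the vertices: a set is
open if and only if its preimage under the parametrization of each closed edge is open. -/
noncomputable instance : TopologicalSpace Γ.Space :=
  ⨆ e : E, TopologicalSpace.coinduced (edge e) (inferInstance : TopologicalSpace ℝ)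

noncomputable instance : MeasurableSpace Γ.Space := borel _

instance : BorelSpace Γ.Space := ⟨rfl⟩

variable {Γ} in
theorem continuous_edge (e : E) : Continuous (edge e : ℝ → Γ.Space) :=
  continuous_iff_coinduced_le.mpr (le_iSup
    (fun e : E => TopologicalSpace.coinduced (edge e : ℝ → Γ.Space) inferInstance) e)

variable [Fintype E]

/-- The measure `μ_Γ`, which has no atoms at the vertices and is `c_e` times Lebesgue measure on
each edge `e`. -/
noncomputable def μ : Measure Γ.Space :=
  ∑ e : E, ENNReal.ofReal (Γ.weight e) •
    Measure.map (edge e) (volume.restrict (Ioo 0 (Γ.len e)))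

/-- The Hilbert space `L²(X_Γ, μ_Γ)`. -/
noncomputable abbrev L2 := Lp ℝ 2 Γ.μ

instance : IsFiniteMeasure Γ.μ := by
  unfold μ
  refine ⟨?_⟩
  rw [Measure.finsetSum_apply]
  refine ENNReal.sum_lt_top.mpr fun e _ => ?_
  rw [Measure.smul_apply, Measure.map_apply (continuous_edge e).measurable MeasurableSet.univ]
  simp [ENNReal.mul_lt_top_iff]

variable {Γ}

theorem ae_iff_map {P : Γ.Space → Prop} : (∀ᵐ x ∂Γ.μ, P x) ↔
    ∀ e, ∀ᵐ x ∂(Measure.map (edge e) (volume.restrict (Ioo 0 (Γ.len e)))), P x := by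
  unfold μ
  simp only [ae_iff, Measure.finsetSum_apply, Measure.smul_apply, smul_eq_mul,
    Finset.sum_eq_zero_iff, Finset.mem_univ, true_imp_iff, mul_eq_zero, ENNReal.ofReal_eq_zero]
  exact forall_congr' fun e => or_iff_right (not_le.mpr (Γ.weight_pos e))

theorem ae_edge {P : Γ.Space → Prop} (h : ∀ᵐ x ∂Γ.μ, P x) (e : E) :
    ∀ᵐ s ∂(volume.restrict (Ioo 0 (Γ.len e))), P (edge e s) :=
  ae_of_ae_map (continuous_edge e).measurable.aemeasurable (ae_iff_map.mp h e)

theorem ae_of_ae_edge {P : Γ.Space → Prop} (hP : MeasurableSet {x | P x})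
    (h : ∀ e, ∀ᵐ s ∂(volume.restrict (Ioo 0 (Γ.len e))), P (edge e s)) : ∀ᵐ x ∂Γ.μ, P x :=
  ae_iff_map.mpr fun e =>
    (ae_map_iff (continuous_edge e).measurable.aemeasurable hP).mpr (h e)

theorem memLp_of_continuous {F : Γ.Space → ℝ} (hF : Continuous F) : MemLp F 2 Γ.μ := by
  have hb : ∀ e : E, ∃ C, ∀ s ∈ Icc 0 (Γ.len e), ‖F (edge e s)‖ ≤ C := fun e =>
    isCompact_Icc.exists_bound_of_continuousOn (hF.comp (continuous_edge e)).continuousOn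
  choose C hC using hb
  refine MemLp.of_bound hF.aestronglyMeasurable (∑ e, |C e|) ?_
  refine ae_of_ae_edge (measurableSet_le hF.norm.measurable measurable_const) fun e => ?_
  filter_upwards [ae_restrict_mem measurableSet_Ioo] with s hs
  refine (hC e s (Ioo_subset_Icc_self hs)).trans ((le_abs_self _).trans ?_)
  exact Finset.single_le_sum (f := fun e => |C e|) (fun _ _ => abs_nonneg _) (Finset.mem_univ e)

/-- The class in `L²(X_Γ, μ_Γ)` of a continuous function on `X_Γ`. -/
noncomputable def toL2 (F : Γ.Space → ℝ) (hF : Continuous F) : Γ.L2 :=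
  (memLp_of_continuous hF).toLp F

/-- On the interval `(0, l)`, the function `g` is the distributional derivative of `f`. -/
def IsWeakDeriv (l : ℝ) (f g : ℝ → ℝ) : Prop :=
  LocallyIntegrableOn f (Ioo 0 l) ∧ LocallyIntegrableOn g (Ioo 0 l) ∧
  ∀ φ : ℝ → ℝ, ContDiff ℝ ∞ φ → HasCompactSupport φ → tsupport φ ⊆ Ioo 0 l →
    ∫ s in Ioo 0 l, deriv φ s * f s = -∫ s in Ioo 0 l, φ s * g s

/-- The function `F` belongs to `W^{1,2}(X_Γ, μ_Γ)`, that is, it is continuous on `X_Γ` and on each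
edge `e` it has a square integrable distributional derivative `F_e'`; and `g = dF`, that is,
`g_e = c_e^{-1/2} F_e'` for each edge `e`. -/
def IsGradient (F : Γ.Space → ℝ) (g : Γ.L2) : Prop :=
  Continuous F ∧ ∀ e : E, IsWeakDeriv (Γ.len e) (fun s => F (edge e s))
    (fun s => √(Γ.weight e) * g (edge e s))

theorem integrable_test {l : ℝ} {g φ : ℝ → ℝ} (hg : LocallyIntegrableOn g (Ioo 0 l))
    (hφ : Continuous φ) (hc : HasCompactSupport φ) (hs : tsupport φ ⊆ Ioo 0 l) :
    IntegrableOn (fun s => φ s * g s) (Ioo 0 l) := by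
  have h1 : IntegrableOn g (tsupport φ) := hg.integrableOn_compact_subset hs hc
  have h2 : IntegrableOn (fun s => φ s * g s) (tsupport φ) :=
    h1.continuousOn_mul hφ.continuousOn hc
  have h3 : Integrable (fun s => φ s * g s) :=
    (integrableOn_iff_integrable_of_support_subset (fun s hs' => subset_tsupport φ
      (fun h0 => hs' (by simp [h0])))).mp h2
  exact h3.integrableOn

theorem IsWeakDeriv.add {l : ℝ} {f₁ f₂ g₁ g₂ : ℝ → ℝ} (h₁ : IsWeakDeriv l f₁ g₁)
    (h₂ : IsWeakDeriv l f₂ g₂) : IsWeakDeriv l (fun s => f₁ s + f₂ s) (fun s => g₁ s + g₂ s) := by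
  refine ⟨h₁.1.add h₂.1, h₁.2.1.add h₂.2.1, fun φ hφ hc hs => ?_⟩
  have hd : Continuous (deriv φ) := hφ.continuous_deriv (by simp)
  have hds : tsupport (deriv φ) ⊆ Ioo 0 l := (tsupport_deriv_subset (𝕜 := ℝ)).trans hs
  simp only [mul_add]
  rw [integral_add (integrable_test h₁.1 hd hc.deriv hds) (integrable_test h₂.1 hd hc.deriv hds),
    integral_add (integrable_test h₁.2.1 hφ.continuous hc hs)
      (integrable_test h₂.2.1 hφ.continuous hc hs), h₁.2.2 φ hφ hc hs, h₂.2.2 φ hφ hc hs]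
  ring

theorem IsWeakDeriv.const_mul {l : ℝ} {f g : ℝ → ℝ} (a : ℝ) (h : IsWeakDeriv l f g) :
    IsWeakDeriv l (fun s => a * f s) (fun s => a * g s) := by
  refine ⟨h.1.smul a, h.2.1.smul a, fun φ hφ hc hs => ?_⟩
  simp only [mul_left_comm _ a]
  rw [integral_const_mul, integral_const_mul, h.2.2 φ hφ hc hs]
  ring

theorem IsWeakDeriv.congr {l : ℝ} {f f' g g' : ℝ → ℝ} (h : IsWeakDeriv l f g)
    (hf : ∀ᵐ s ∂(volume.restrict (Ioo 0 l)), f s = f' s)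
    (hg : ∀ᵐ s ∂(volume.restrict (Ioo 0 l)), g s = g' s) : IsWeakDeriv l f' g' := by
  have key : ∀ {p q : ℝ → ℝ}, LocallyIntegrableOn p (Ioo 0 l) →
      (∀ᵐ s ∂(volume.restrict (Ioo 0 l)), p s = q s) → LocallyIntegrableOn q (Ioo 0 l) := by
    intro p q hp hpq
    rw [locallyIntegrableOn_iff (isOpen_Ioo.isLocallyClosed)] at hp ⊢
    intro k hk hkc
    exact (hp k hk hkc).congr_fun_ae (ae_restrict_of_ae_restrict_of_subset hk hpq)
  refine ⟨key h.1 hf, key h.2.1 hg, fun φ hφ hc hs => ?_⟩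
  have e1 := h.2.2 φ hφ hc hs
  rw [integral_congr_ae (g := fun s => deriv φ s * f' s)
      (hf.mono fun s hs => by simp only [hs]),
    integral_congr_ae (f := fun s => φ s * g s) (g := fun s => φ s * g' s)
      (hg.mono fun s hs => by simp only [hs])] at e1
  exact e1

theorem IsWeakDeriv.ae_eq_zero {l : ℝ} {f g : ℝ → ℝ} (h : IsWeakDeriv l f g)
    (hf : ∀ᵐ s ∂(volume.restrict (Ioo 0 l)), f s = 0) :
    ∀ᵐ s ∂(volume.restrict (Ioo 0 l)), g s = 0 := by
  rw [ae_restrict_iff' measurableSet_Ioo]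
  refine isOpen_Ioo.ae_eq_zero_of_integral_contDiff_smul_eq_zero h.2.1 fun φ hφ hc hs => ?_
  have h1 := h.2.2 φ hφ hc hs
  rw [integral_congr_ae (g := fun _ => (0 : ℝ))
    (hf.mono fun s hs => by simp only [hs, mul_zero])] at h1
  have h2 : ∫ s in Ioo 0 l, φ s * g s = 0 := by simpa using h1.symm
  rw [← h2, setIntegral_eq_integral_of_forall_compl_eq_zero]
  · rfl
  · intro s hs'
    rw [image_eq_zero_of_notMem_tsupport (fun h => hs' (hs h)), zero_mul]

theorem IsGradient.add {F₁ F₂ : Γ.Space → ℝ} {g₁ g₂ : Γ.L2} (h₁ : IsGradient F₁ g₁)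
    (h₂ : IsGradient F₂ g₂) : IsGradient (fun x => F₁ x + F₂ x) (g₁ + g₂) := by
  refine ⟨h₁.1.add h₂.1, fun e => ((h₁.2 e).add (h₂.2 e)).congr (ae_of_all _ fun _ => rfl) ?_⟩
  filter_upwards [ae_edge (Lp.coeFn_add g₁ g₂) e] with s hs
  rw [hs, Pi.add_apply]
  ring

theorem IsGradient.smul {F : Γ.Space → ℝ} {g : Γ.L2} (a : ℝ) (h : IsGradient F g) :
    IsGradient (fun x => a * F x) (a • g) := by
  refine ⟨continuous_const.mul h.1,
    fun e => ((h.2 e).const_mul a).congr (ae_of_all _ fun _ => rfl) ?_⟩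
  filter_upwards [ae_edge (Lp.coeFn_smul a g) e] with s hs
  rw [hs, Pi.smul_apply, smul_eq_mul]
  ring

variable (Γ)

/-- The graph of the gradient operator `d` in `L²(X_Γ, μ_Γ)`. -/
noncomputable def gradGraph : Submodule ℝ (Γ.L2 × Γ.L2) where
  carrier := {p | ∃ (F : Γ.Space → ℝ) (hF : IsGradient F p.2), toL2 F hF.1 = p.1}
  zero_mem' := by
    refine ⟨fun _ => 0, ⟨continuous_const, fun e => ?_⟩, ?_⟩
    · refine IsWeakDeriv.congr (f := fun _ => 0) (g := fun _ => 0) ⟨?_, ?_, ?_⟩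
        (ae_of_all _ fun _ => rfl) ?_
      · exact locallyIntegrableOn_const 0
      · exact locallyIntegrableOn_const 0
      · intro φ _ _ _
        simp
      · filter_upwards [ae_edge (Lp.coeFn_zero ℝ 2 Γ.μ) e] with s hs
        simp only [Prod.snd_zero, hs, Pi.zero_apply, mul_zero]
    · exact MemLp.toLp_zero _
  add_mem' := by
    rintro p q ⟨F, hF, hp⟩ ⟨G, hG, hq⟩
    refine ⟨fun x => F x + G x, hF.add hG, ?_⟩
    rw [Prod.fst_add, ← hp, ← hq]
    exact MemLp.toLp_add _ _
  smul_mem' := by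
    rintro a p ⟨F, hF, hp⟩
    refine ⟨fun x => a * F x, hF.smul a, ?_⟩
    rw [Prod.smul_fst, ← hp]
    exact MemLp.toLp_const_smul a _

theorem gradGraph_single_valued (p : Γ.L2 × Γ.L2) (hp : p ∈ Γ.gradGraph) (h : p.1 = 0) :
    p.2 = 0 := by
  obtain ⟨F, hF, hFp⟩ := hp
  have hF0 : ∀ᵐ x ∂Γ.μ, F x = 0 := by
    have h1 : ⇑(toL2 F hF.1) =ᵐ[Γ.μ] F := MemLp.coeFn_toLp _
    rw [hFp, h] at h1
    filter_upwards [h1, Lp.coeFn_zero ℝ 2 Γ.μ] with x hx hx0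
    rw [← hx, hx0, Pi.zero_apply]
  refine (Lp.eq_zero_iff_ae_eq_zero).mpr ?_
  refine ae_of_ae_edge
    (measurableSet_eq_fun (Lp.stronglyMeasurable p.2).measurable measurable_const) fun e => ?_
  filter_upwards [(hF.2 e).ae_eq_zero (ae_edge hF0 e)] with s hs
  exact (mul_eq_zero.mp hs).resolve_left (Real.sqrt_pos.mpr (Γ.weight_pos e)).ne'

/-- The gradient `d`, as an unbounded operator in `L²(X_Γ, μ_Γ)` whose domain `Γ.d.domain` is
`W^{1,2}(X_Γ, μ_Γ)`. -/
noncomputable def d : Γ.L2 →ₗ.[ℝ] Γ.L2 := Γ.gradGraph.toLinearPMap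

theorem mem_graph_d_iff (p : Γ.L2 × Γ.L2) : p ∈ Γ.d.graph ↔
    ∃ (F : Γ.Space → ℝ) (hF : IsGradient F p.2), toL2 F hF.1 = p.1 := by
  rw [d, Submodule.toLinearPMap_graph_eq _ Γ.gradGraph_single_valued]
  rfl

/-- The adjoint `d^*` of `d`, as an unbounded operator in `L²(X_Γ, μ_Γ)`. -/
noncomputable def dStar : Γ.L2 →ₗ.[ℝ] Γ.L2 := Γ.d†

/-- The energy form `E_Γ(f, g) = ⟨df, dg⟩ = ∑_e ∫_0^{l_e} f_e' g_e' ds` on `W^{1,2}(X_Γ, μ_Γ)`. -/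
noncomputable def energy (f g : Γ.d.domain) : ℝ := ⟪Γ.d f, Γ.d g⟫_ℝ

variable {Γ} in
/-- `f ∈ D(L_Γ)` and `L_Γ f = k`, where the Kirchhoff Laplacian `L_Γ` is the generator of the
Dirichlet form `(E_Γ, W^{1,2}(X_Γ, μ_Γ))`. -/
def IsKirchhoffLaplacian (f k : Γ.L2) : Prop :=
  ∃ hf : f ∈ Γ.d.domain, ∀ φ : Γ.d.domain, Γ.energy ⟨f, hf⟩ φ = -⟪k, (φ : Γ.L2)⟫_ℝ

/-- The domain `D(L⃗_Γ)` of the vector Laplacian `L⃗_Γ = -d d^*`: all `v ∈ D(d^*)` such that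
`d^* v ∈ W^{1,2}(X_Γ, μ_Γ)`. -/
noncomputable def VecDomain : Submodule ℝ Γ.dStar.domain := Γ.d.domain.comap Γ.dStar.toFun

variable {Γ} in
/-- `d^* v` as an element of `W^{1,2}(X_Γ, μ_Γ)`, for `v ∈ D(L⃗_Γ)`. -/
noncomputable def dStarVec (v : Γ.VecDomain) : Γ.d.domain := ⟨Γ.dStar v, v.2⟩

variable {Γ} in
/-- The distributional `d^* u ∈ (W^{1,2}(X_Γ, μ_Γ))^*` of `u ∈ L²(X_Γ, μ_Γ)`. -/
noncomputable def dStarDist (u : Γ.L2) (φ : Γ.d.domain) : ℝ := ⟪u, Γ.d φ⟫_ℝ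

variable {Γ} in
/-- The distributional `L⃗_Γ u ∈ (D(L⃗_Γ))^*` of `u ∈ L²(X_Γ, μ_Γ)`. -/
noncomputable def vecLaplacianDist (u : Γ.L2) (v : Γ.VecDomain) : ℝ := -dStarDist u (dStarVec v)

variable {Γ} in
/-- The distributional `df ∈ (D(L⃗_Γ))^*` of `f ∈ L¹(X_Γ, μ_Γ)`. -/
noncomputable def dDist (f : Γ.Space → ℝ) (v : Γ.VecDomain) : ℝ :=
  ∫ x, (dStarVec v : Γ.L2) x * f x ∂Γ.μ

variable {Γ} in
/-- `u ∈ C([0,∞), L²) ∩ C¹((0,∞), L²)` solves `u_t = L⃗_Γ u - ½ d(u²)` in `(D(L⃗_Γ))^*` for `t > 0`,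
with `u(0) = u₀` in `L²`. -/
structure IsBurgersSolution (u₀ : Γ.L2) (u : ℝ → Γ.L2) : Prop where
  continuousOn : ContinuousOn u (Ici 0)
  contDiffOn : ContDiffOn ℝ 1 u (Ioi 0)
  equation : ∀ t > 0, ∀ v : Γ.VecDomain, ⟪deriv u t, ((v : Γ.dStar.domain) : Γ.L2)⟫_ℝ =
    vecLaplacianDist (u t) v - 1 / 2 * dDist (fun x => u t x ^ 2) v
  initial : u 0 = u₀

variable {Γ} in
/-- `w` solves the heat equation `w_t = L_Γ w` for `t > 0`, with `w(0) = w₀`, as a Cauchy problem in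
`L²(X_Γ, μ_Γ)`. -/
structure IsHeatSolution (w₀ : Γ.L2) (w : ℝ → Γ.L2) : Prop where
  continuousOn : ContinuousOn w (Ici 0)
  contDiffOn : ContDiffOn ℝ 1 w (Ioi 0)
  equation : ∀ t > 0, IsKirchhoffLaplacian (w t) (deriv w t)
  initial : w 0 = w₀

/-- `(T t)_{t ≥ 0}` is the Kirchhoff heat semigroup `(e^{t L_Γ})_{t ≥ 0}`, that is, the strongly
continuous semigroup on `L²(X_Γ, μ_Γ)` with infinitesimal generator `L_Γ`. -/
structure IsHeatSemigroup (T : ℝ → Γ.L2 →L[ℝ] Γ.L2) : Prop where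
  zero : T 0 = 1
  add : ∀ s ≥ 0, ∀ t ≥ 0, T (s + t) = T s * T t
  tendsto : ∀ f, Tendsto (fun t => T t f) (𝓝[>] 0) (𝓝 f)
  generator : ∀ f k, IsKirchhoffLaplacian f k ↔
    Tendsto (fun t => t⁻¹ • (T t f - f)) (𝓝[>] 0) (𝓝 k)

end MetricGraph

open scoped ENNReal

/-! The Cole-Hopf computation: if `w_t = -d^* d w` and `u = -2 dw / w`, then `u_t = -2 d(w_t / w)`.
Pairing with `v`, where `d^* v = q`, gives `-2 ∫ q w_t / w`, and the heat equation tested with `q /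
w` turns this into the weak Burgers equation (`coleHopf_identity`). The analytic basis is the
one-dimensional Sobolev inequality `exists_sobolev`: the graph norm of `d` controls the supremum
norm. Hence `d` is closed, continuous representatives depend continuously on elements of `W^{1,2}`,
products and reciprocals stay in `W^{1,2}`, and `1 / w` is a smooth function of `w > 0` in the
Banach algebra `C(X)`.

Heat flow. Projecting `(y, 0)` orthogonally onto the closed graph of `d` yields the resolvent `R =
(1 + d^* d)⁻¹`. The semigroup is the strong limit of exponentials of the bounded operators `-∑ (1 -
R)^(k+1)`, and a smoothing bound independent of the approximation shows that it maps into the domain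
for `t > 0` (`IsResolvent.exists_semigroup`). Dissipativity gives uniqueness of heat solutions and
of the semigroup. Decay of the energy makes the flow from `W^{1,2}` continuous in the graph norm up
to `t = 0` (`exists_heatPath`). Positivity holds because `∫ e^{-cw}` decreases in time for every `c
≥ 0`; letting `c → ∞` yields the minimum principle (`IsHeatPath.le_rep`).

Uniqueness for Burgers. The difference `z` of two solutions lies only in `L²`, so it is measured in
a negative norm: with `N = (1 + d d^*)⁻¹`, which comes from projecting `(0, z)`, put `Q(z) = ⟨N z,
z⟩ = ‖N z‖² + ‖d^* N z‖²`. Testing with `N z`, the quadratic term is bounded through the supremum of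
`d^* N z`; the Sobolev inequality with a small gradient constant lets the dissipation absorb it, and
a Grönwall argument gives `Q(z) = 0`. -/

namespace MetricGraph

/-! ### Weak derivatives and absolute continuity on an interval -/

/-- A compact subset of the open interval `(0, l)` lies in a compact subinterval. -/
theorem exists_Icc_of_isCompact_subset_Ioo {l : ℝ} (hl : 0 < l) {K : Set ℝ} (hK : IsCompact K)
    (hs : K ⊆ Ioo 0 l) : ∃ a b, 0 < a ∧ a ≤ b ∧ b < l ∧ K ⊆ Icc a b := by
  have hK' : IsCompact (insert (l / 2) K) := hK.insert _
  have hs' : insert (l / 2) K ⊆ Ioo 0 l := insert_subset ⟨by linarith, by linarith⟩ hs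
  obtain ⟨a, ha, ha'⟩ := hK'.exists_isLeast ⟨_, mem_insert _ _⟩
  obtain ⟨b, hb, hb'⟩ := hK'.exists_isGreatest ⟨_, mem_insert _ _⟩
  exact ⟨a, b, (hs' ha).1, ha' hb, (hs' hb).2, fun x hx =>
    ⟨ha' (mem_insert_of_mem _ hx), hb' (mem_insert_of_mem _ hx)⟩⟩

theorem setIntegral_Ioo_eq_intervalIntegral {l : ℝ} (hl : 0 < l) (f : ℝ → ℝ) :
    ∫ s in Ioo 0 l, f s = ∫ s in (0 : ℝ)..l, f s := by
  rw [intervalIntegral.integral_of_le hl.le, integral_Ioc_eq_integral_Ioo]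

/-- A test function of integral zero is the derivative of a test function. -/
theorem exists_primitive_test {l : ℝ} (hl : 0 < l) {ψ : ℝ → ℝ} (hψ : ContDiff ℝ ∞ ψ)
    (hc : HasCompactSupport ψ) (hs : tsupport ψ ⊆ Ioo 0 l) (h0 : ∫ s in Ioo 0 l, ψ s = 0) :
    ∃ Ψ : ℝ → ℝ, ContDiff ℝ ∞ Ψ ∧ HasCompactSupport Ψ ∧ tsupport Ψ ⊆ Ioo 0 l ∧ deriv Ψ = ψ := by
  obtain ⟨a, b, ha, hab, hb, hK⟩ := exists_Icc_of_isCompact_subset_Ioo hl hc hs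
  have hz : ∀ s, s ∉ Icc a b → ψ s = 0 := fun s hs =>
    image_eq_zero_of_notMem_tsupport fun h => hs (hK h)
  have hint : ∀ p q, IntervalIntegrable ψ volume p q := fun p q =>
    hψ.continuous.intervalIntegrable p q
  have hd : deriv (fun s => ∫ x in (0 : ℝ)..s, ψ x) = ψ :=
    funext fun s => Continuous.deriv_integral ψ hψ.continuous 0 s
  have hsub : Function.support (fun s => ∫ x in (0 : ℝ)..s, ψ x) ⊆ Icc a b := by
    intro s hs'
    by_contra hn
    refine hs' ?_
    rcases lt_or_ge s a with h | h
    · refine (intervalIntegral.integral_congr (g := fun _ => (0 : ℝ)) fun x hx => hz x ?_).trans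
        (by simp)
      intro hx'
      have := hx.2
      have := hx'.1
      simp only [le_sup_iff] at *
      rcases le_total s 0 with h1 | h1 <;> simp_all <;> linarith
    -- To the right of `[a, b]` the primitive equals the integral of `ψ` over the whole interval;
    -- only here is `h0` needed.
    · have h2 : b < s := not_le.mp fun h2 => hn ⟨h, h2⟩
      have h3 : ∫ x in b..s, ψ x = 0 := by
        refine intervalIntegral.integral_zero_ae (ae_of_all _ fun x hx => hz x fun hx' => ?_)
        rw [uIoc_of_le h2.le] at hx
        exact absurd hx'.2 (not_le.mpr hx.1)
      have h4 : ∫ x in b..l, ψ x = 0 := by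
        refine intervalIntegral.integral_zero_ae (ae_of_all _ fun x hx => hz x fun hx' => ?_)
        rw [uIoc_of_le hb.le] at hx
        exact absurd hx'.2 (not_le.mpr hx.1)
      rw [setIntegral_Ioo_eq_intervalIntegral hl,
        ← intervalIntegral.integral_add_adjacent_intervals (hint 0 b) (hint b l), h4] at h0
      change ∫ x in (0 : ℝ)..s, ψ x = 0
      rw [← intervalIntegral.integral_add_adjacent_intervals (hint 0 b) (hint b s), h3]
      exact h0
  refine ⟨fun s => ∫ x in (0 : ℝ)..s, ψ x, ?_, ?_, ?_, hd⟩
  · rw [contDiff_infty_iff_deriv]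
    refine ⟨fun s => ?_, by rw [hd]; exact hψ⟩
    exact (intervalIntegral.integral_hasDerivAt_right (hint 0 s)
      hψ.continuous.stronglyMeasurable.stronglyMeasurableAtFilter
      hψ.continuous.continuousAt).differentiableAt
  · exact HasCompactSupport.of_support_subset_isCompact isCompact_Icc hsub
  · exact (closure_minimal hsub isClosed_Icc).trans (Icc_subset_Ioo ha hb)

/-- There is a test function on `(0, l)` of integral one. -/
theorem exists_test_integral_eq_one {l : ℝ} (hl : 0 < l) : ∃ η : ℝ → ℝ, ContDiff ℝ ∞ η ∧
    HasCompactSupport η ∧ tsupport η ⊆ Ioo 0 l ∧ ∫ s in Ioo 0 l, η s = 1 := by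
  let b : ContDiffBump (l / 2 : ℝ) := ⟨l / 8, l / 4, by linarith, by linarith⟩
  have hs : tsupport (b.normed volume) ⊆ Ioo 0 l := by
    rw [b.tsupport_normed_eq, Real.closedBall_eq_Icc]
    exact Icc_subset_Ioo (by change 0 < l / 2 - l / 4; linarith)
      (by change l / 2 + l / 4 < l; linarith)
  refine ⟨b.normed volume, b.contDiff_normed, b.hasCompactSupport_normed, hs, ?_⟩
  rw [setIntegral_eq_integral_of_forall_compl_eq_zero, b.integral_normed]
  exact fun s hs' => image_eq_zero_of_notMem_tsupport fun h => hs' (hs h)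

/-- A function with vanishing distributional derivative is constant. -/
theorem IsWeakDeriv.exists_ae_eq_const {l : ℝ} (hl : 0 < l) {f : ℝ → ℝ}
    (h : IsWeakDeriv l f fun _ => 0) : ∃ c, ∀ᵐ s ∂(volume.restrict (Ioo 0 l)), f s = c := by
  obtain ⟨η, hη, hηc, hηs, hη1⟩ := exists_test_integral_eq_one hl
  -- A constant `f` would equal its average against `η`, so this is the only candidate.
  refine ⟨∫ s in Ioo 0 l, η s * f s, ?_⟩
  set c := ∫ s in Ioo 0 l, η s * f s with hcdef
  have hloc : LocallyIntegrableOn (fun s => f s - c) (Ioo 0 l) :=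
    h.1.sub (locallyIntegrableOn_const c)
  have key : ∀ᵐ s, s ∈ Ioo 0 l → f s - c = 0 := by
    refine isOpen_Ioo.ae_eq_zero_of_integral_contDiff_smul_eq_zero hloc fun φ hφ hc hs => ?_
    have hφi : IntegrableOn φ (Ioo 0 l) := (hφ.continuous.integrable_of_hasCompactSupport hc).integrableOn
    have hηi : IntegrableOn η (Ioo 0 l) := (hη.continuous.integrable_of_hasCompactSupport hηc).integrableOn
    set I := ∫ s in Ioo 0 l, φ s with hI
    -- `φ - I η` has integral zero, so it is `Ψ'` for a test function `Ψ`; testing `f' = 0` with `Ψ`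
    -- gives `∫ φ f = I c`, that is `∫ φ (f - c) = 0`.
    obtain ⟨Ψ, h1, h2, h3, h4⟩ := exists_primitive_test hl (ψ := fun s => φ s - I * η s)
      (hφ.sub (contDiff_const.mul hη)) (hc.sub (hηc.mul_left (f := fun _ => I)))
      ((tsupport_sub φ _).trans (union_subset hs ((tsupport_mul_subset_right (f := fun _ => I)).trans hηs)))
      (by rw [integral_sub hφi (hηi.const_mul I), integral_const_mul, hη1, mul_one, sub_self])
    have h5 := h.2.2 Ψ h1 h2 h3
    simp only [h4, mul_zero, integral_zero, neg_zero] at h5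
    have e1 := integrable_test h.1 hφ.continuous hc hs
    have e2 := integrable_test h.1 hη.continuous hηc hηs
    have h6 : ∫ s in Ioo 0 l, φ s * f s = I * c := by
      have : ∫ s in Ioo 0 l, (φ s * f s - I * (η s * f s)) = 0 := by
        simpa only [sub_mul, mul_assoc] using h5
      rw [integral_sub e1 (e2.const_mul I), integral_const_mul] at this
      linarith
    rw [← setIntegral_eq_integral_of_forall_compl_eq_zero (s := Ioo 0 l)]
    · simp only [smul_eq_mul, mul_sub]
      rw [integral_sub e1 (hφi.mul_const c), h6, integral_mul_const, sub_self]
    · intro s hs'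
      rw [image_eq_zero_of_notMem_tsupport (fun h => hs' (hs h)), zero_smul]
  rw [ae_restrict_iff' measurableSet_Ioo]
  filter_upwards [key] with s hs hs'
  linarith [hs hs']

/-- `f` is absolutely continuous on `[0, l]` with a.e. derivative `g`. -/
def HasACDeriv (l : ℝ) (f g : ℝ → ℝ) : Prop :=
  AbsolutelyContinuousOnInterval f 0 l ∧
    ∀ᵐ s ∂(volume.restrict (Ioo 0 l)), HasDerivAt f (g s) s

theorem ae_restrict_Ioo_iff_uIcc {l : ℝ} (hl : 0 < l) {P : ℝ → Prop} :
    (∀ᵐ s ∂(volume.restrict (Ioo 0 l)), P s) ↔ ∀ᵐ s, s ∈ uIcc 0 l → P s := by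
  rw [restrict_Ioo_eq_restrict_Icc, ae_restrict_iff' measurableSet_Icc, uIcc_of_le hl.le]

theorem intervalIntegrable_iff_integrableOn_Ioo {l : ℝ} (hl : 0 < l) {g : ℝ → ℝ} :
    IntervalIntegrable g volume 0 l ↔ IntegrableOn g (Ioo 0 l) := by
  rw [intervalIntegrable_iff_integrableOn_Ioo_of_le hl.le]

theorem HasACDeriv.deriv_ae_eq {l : ℝ} {f g : ℝ → ℝ} (h : HasACDeriv l f g) :
    ∀ᵐ s ∂(volume.restrict (Ioo 0 l)), deriv f s = g s :=
  h.2.mono fun _ hs => hs.deriv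

theorem HasACDeriv.integrableOn {l : ℝ} (hl : 0 < l) {f g : ℝ → ℝ} (h : HasACDeriv l f g) :
    IntegrableOn g (Ioo 0 l) :=
  ((intervalIntegrable_iff_integrableOn_Ioo hl).mp h.1.intervalIntegrable_deriv).congr h.deriv_ae_eq

theorem HasACDeriv.integral_eq_sub {l : ℝ} (hl : 0 < l) {f g : ℝ → ℝ} (h : HasACDeriv l f g)
    {r s : ℝ} (hr : r ∈ Icc 0 l) (hs : s ∈ Icc 0 l) : ∫ x in r..s, g x = f s - f r := by
  have hsub : uIcc r s ⊆ uIcc 0 l := by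
    rw [uIcc_of_le hl.le]
    exact uIcc_subset_Icc hr hs
  rw [← (h.1.mono hsub).integral_deriv_eq_sub]
  refine intervalIntegral.integral_congr_ae ?_
  have := (ae_restrict_Ioo_iff_uIcc hl).mp h.deriv_ae_eq
  filter_upwards [this] with x hx hx'
  exact (hx (hsub (uIoc_subset_uIcc hx'))).symm

theorem HasACDeriv.mul {l : ℝ} {f₁ f₂ g₁ g₂ : ℝ → ℝ} (h₁ : HasACDeriv l f₁ g₁)
    (h₂ : HasACDeriv l f₂ g₂) :
    HasACDeriv l (fun s => f₁ s * f₂ s) (fun s => f₁ s * g₂ s + f₂ s * g₁ s) := by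
  refine ⟨h₁.1.mul h₂.1, ?_⟩
  filter_upwards [h₁.2, h₂.2] with s hs₁ hs₂
  convert! hs₁.mul hs₂ using 1
  ring

/-- The chain rule for a continuously differentiable function of an absolutely continuous one. -/
theorem HasACDeriv.comp {l : ℝ} (hl : 0 < l) {f g : ℝ → ℝ} (h : HasACDeriv l f g) {a b : ℝ}
    {φ φ' : ℝ → ℝ} (hab : ∀ s ∈ Icc 0 l, f s ∈ Icc a b) (hφ : ∀ x ∈ Icc a b, HasDerivAt φ (φ' x) x)
    (hφ' : ContinuousOn φ' (Icc a b)) :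
    HasACDeriv l (fun s => φ (f s)) (fun s => φ' (f s) * g s) := by
  refine ⟨?_, ?_⟩
  · obtain ⟨C, hC⟩ := isCompact_Icc.exists_bound_of_continuousOn hφ'
    -- By the mean value inequality `φ` is Lipschitz on `[a, b]`, so composing with it multiplies
    -- the sums in the definition of absolute continuity by at most `|C|`.
    have hlip : ∀ x ∈ Icc a b, ∀ y ∈ Icc a b, dist (φ x) (φ y) ≤ |C| * dist x y := by
      intro x hx y hy
      rw [dist_comm, dist_comm x, dist_eq_norm, dist_eq_norm]
      exact (convex_Icc a b).norm_image_sub_le_of_norm_hasDerivWithin_le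
        (fun z hz => (hφ z hz).hasDerivWithinAt) (fun z hz => (hC z hz).trans (le_abs_self C)) hx hy
    have h1 := h.1
    unfold AbsolutelyContinuousOnInterval at h1 ⊢
    have h2 := h1.const_mul |C|
    rw [mul_zero] at h2
    refine squeeze_zero' (Eventually.of_forall fun I => Finset.sum_nonneg fun _ _ => dist_nonneg)
      ?_ h2
    refine eventually_inf_principal.mpr (Eventually.of_forall fun I hI => ?_)
    rw [Finset.mul_sum]
    refine Finset.sum_le_sum fun i hi => ?_
    have h3 := hI.1 i hi
    rw [uIcc_of_le hl.le] at h3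
    exact hlip _ (hab _ h3.1) _ (hab _ h3.2)
  · filter_upwards [h.2, ae_restrict_mem measurableSet_Ioo] with s hs hs'
    exact (hφ _ (hab s (Ioo_subset_Icc_self hs'))).comp s hs

/-- An absolutely continuous function has its a.e. derivative as distributional derivative. -/
theorem HasACDeriv.isWeakDeriv {l : ℝ} (hl : 0 < l) {f g : ℝ → ℝ} (h : HasACDeriv l f g) :
    IsWeakDeriv l f g := by
  have hg : LocallyIntegrableOn g (Ioo 0 l) := (h.integrableOn hl).locallyIntegrableOn
  have hf : LocallyIntegrableOn f (Ioo 0 l) := by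
    have := h.1.continuousOn
    rw [uIcc_of_le hl.le] at this
    exact (this.mono Ioo_subset_Icc_self).locallyIntegrableOn measurableSet_Ioo
  refine ⟨hf, hg, fun φ hφ hc hs => ?_⟩
  have hφac : HasACDeriv l φ (deriv φ) :=
    ⟨(hφ.of_le (by simp)).contDiffOn.absolutelyContinuousOnInterval,
      ae_of_all _ fun s => (hφ.differentiable (by simp) s).hasDerivAt⟩
  have h0 : φ 0 = 0 := image_eq_zero_of_notMem_tsupport fun h => (hs h).1.false
  have h1 : φ l = 0 := image_eq_zero_of_notMem_tsupport fun h => (hs h).2.false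
  -- Integration by parts: integrate the derivative of `φ f`, whose boundary values vanish.
  have e := (hφac.mul h).integral_eq_sub hl ⟨le_rfl, hl.le⟩ ⟨hl.le, le_rfl⟩
  have e1 := integrable_test hf (hφ.continuous_deriv (by simp)) hc.deriv
    ((tsupport_deriv_subset (𝕜 := ℝ)).trans hs)
  simp only [h0, h1, zero_mul, sub_zero, ← setIntegral_Ioo_eq_intervalIntegral hl,
    mul_comm (f _)] at e
  rw [integral_add (integrable_test hg hφ.continuous hc hs) e1] at e
  linarith

theorem HasACDeriv.congr {l : ℝ} (hl : 0 < l) {f f' g : ℝ → ℝ} (h : HasACDeriv l f g)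
    (hf : EqOn f f' (Icc 0 l)) : HasACDeriv l f' g := by
  refine ⟨?_, ?_⟩
  · have h1 := h.1
    unfold AbsolutelyContinuousOnInterval at h1 ⊢
    refine h1.congr' (eventually_inf_principal.mpr (Eventually.of_forall fun I hI => ?_))
    refine Finset.sum_congr rfl fun i hi => ?_
    have h3 := hI.1 i hi
    rw [uIcc_of_le hl.le] at h3
    rw [hf h3.1, hf h3.2]
  · filter_upwards [h.2, ae_restrict_mem measurableSet_Ioo] with s hs hs'
    refine hs.congr_of_eventuallyEq ?_
    filter_upwards [isOpen_Ioo.mem_nhds hs'] with x hx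
    exact (hf (Ioo_subset_Icc_self hx)).symm

/-- Lebesgue differentiation. The free constant `c` allows an arbitrary initial value, so that a
given function can be identified with a primitive of its derivative. -/
theorem hasACDeriv_intervalIntegral {l : ℝ} (hl : 0 < l) {g : ℝ → ℝ}
    (hg : IntegrableOn g (Ioo 0 l)) (c : ℝ) :
    HasACDeriv l (fun s => (∫ x in (0 : ℝ)..s, g x) + c) g := by
  have hgi : IntervalIntegrable g volume 0 l := (intervalIntegrable_iff_integrableOn_Ioo hl).mpr hg
  refine ⟨(hgi.absolutelyContinuousOnInterval_intervalIntegral left_mem_uIcc).add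
    (LipschitzWith.const c).lipschitzOnWith.absolutelyContinuousOnInterval, ?_⟩
  rw [ae_restrict_Ioo_iff_uIcc hl]
  filter_upwards [hgi.ae_hasDerivAt_integral] with s hs hs'
  exact (hs hs' 0 left_mem_uIcc).add_const c

/-- A continuous function with an integrable distributional derivative is absolutely continuous. -/
theorem IsWeakDeriv.hasACDeriv {l : ℝ} (hl : 0 < l) {f g : ℝ → ℝ} (h : IsWeakDeriv l f g)
    (hf : ContinuousOn f (Icc 0 l)) (hg : IntegrableOn g (Ioo 0 l)) : HasACDeriv l f g := by
  have hH := hasACDeriv_intervalIntegral hl hg 0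
  have hHc := hH.1.continuousOn
  rw [uIcc_of_le hl.le] at hHc
  have hdiff := (h.add ((hH.isWeakDeriv hl).const_mul (-1))).congr
    (ae_of_all _ fun s => rfl) (ae_of_all _ fun s => (by ring : _ = (0 : ℝ)))
  obtain ⟨c, hc⟩ := hdiff.exists_ae_eq_const hl
  -- The difference of `f` and a primitive of `g` is a.e. constant; by continuity it is constant on
  -- the closed interval.
  have heq : EqOn (fun s => f s + -1 * ((∫ x in (0 : ℝ)..s, g x) + 0)) (fun _ => c) (Icc 0 l) := by
    refine Measure.eqOn_of_ae_eq (μ := volume) ?_ (hf.add (continuousOn_const.mul hHc))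
      continuousOn_const ?_
    · rw [← restrict_Ioo_eq_restrict_Icc]
      exact hc
    · rw [interior_Icc, closure_Ioo hl.ne]
  refine (hasACDeriv_intervalIntegral hl hg c).congr hl fun s hs => ?_
  have := heq hs
  simp only at this
  linarith

/-- The Cauchy-Schwarz inequality for the integral over an interval. -/
theorem sq_intervalIntegral_le {a b : ℝ} (hab : a ≤ b) {g : ℝ → ℝ}
    (hg : IntervalIntegrable g volume a b) (hg2 : IntervalIntegrable (fun s => g s ^ 2) volume a b) :
    (∫ s in a..b, g s) ^ 2 ≤ (b - a) * ∫ s in a..b, g s ^ 2 := by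
  rcases hab.eq_or_lt with rfl | hlt
  · simp
  have hpos : 0 < b - a := sub_pos.mpr hlt
  -- `m` is the mean of `g`; the inequality expands `∫ (g - m)² ≥ 0`.
  set m := (∫ s in a..b, g s) / (b - a) with hm
  have h1 : 0 ≤ ∫ s in a..b, (g s ^ 2 - 2 * m * g s + m ^ 2) :=
    intervalIntegral.integral_nonneg hab fun s _ => by nlinarith [sq_nonneg (g s - m)]
  rw [intervalIntegral.integral_add (hg2.sub (hg.const_mul _)) (by simp),
    intervalIntegral.integral_sub hg2 (hg.const_mul _), intervalIntegral.integral_const_mul,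
    intervalIntegral.integral_const, smul_eq_mul] at h1
  have h2 : ∫ s in a..b, g s = m * (b - a) := by rw [hm]; field_simp
  rw [h2] at h1 ⊢
  nlinarith

/-- An interpolation inequality on an interval: the values of an absolutely continuous function are
bounded by the `L²` norms of the function and, with a small constant, of its derivative. -/
theorem HasACDeriv.sq_le {l : ℝ} (hl : 0 < l) {f g : ℝ → ℝ} (h : HasACDeriv l f g)
    (hg2 : IntegrableOn (fun s => g s ^ 2) (Ioo 0 l)) {r : ℝ} (hr : 0 < r) (hrl : r ≤ l) {s : ℝ}
    (hs : s ∈ Icc 0 l) :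
    f s ^ 2 ≤ 2 / r * (∫ x in Ioo 0 l, f x ^ 2) + 2 * r * ∫ x in Ioo 0 l, g x ^ 2 := by
  -- A window of length `r` around `s` inside `[0, l]`, pushed to the left when `s` is close to `l`.
  obtain ⟨a, ha0, hal, has, hsa⟩ : ∃ a, 0 ≤ a ∧ a + r ≤ l ∧ a ≤ s ∧ s ≤ a + r := by
    rcases le_total (s + r) l with h1 | h1
    · exact ⟨s, hs.1, h1, le_rfl, by linarith⟩
    · exact ⟨l - r, by linarith, by linarith, by linarith, by linarith [hs.2]⟩
  have hfc : ContinuousOn f (Icc 0 l) := by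
    have := h.1.continuousOn
    rwa [uIcc_of_le hl.le] at this
  have hgi : IntervalIntegrable g volume 0 l :=
    (intervalIntegrable_iff_integrableOn_Ioo hl).mpr (h.integrableOn hl)
  have hg2i : IntervalIntegrable (fun s => g s ^ 2) volume 0 l :=
    (intervalIntegrable_iff_integrableOn_Ioo hl).mpr hg2
  have hf2i : IntervalIntegrable (fun s => f s ^ 2) volume 0 l := by
    refine (ContinuousOn.intervalIntegrable ?_)
    rw [uIcc_of_le hl.le]
    exact hfc.pow 2
  have hsub : ∀ {p q : ℝ}, p ∈ Icc 0 l → q ∈ Icc 0 l → uIcc p q ⊆ uIcc 0 l := by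
    intro p q hp hq
    rw [uIcc_of_le hl.le]
    exact uIcc_subset_Icc hp hq
  have mono : ∀ {p q : ℝ} {k : ℝ → ℝ}, p ∈ Icc 0 l → q ∈ Icc 0 l → p ≤ q →
      IntervalIntegrable (fun s => k s ^ 2) volume 0 l →
      ∫ x in p..q, k x ^ 2 ≤ ∫ x in Ioo 0 l, k x ^ 2 := by
    intro p q k hp hq hpq hk
    rw [setIntegral_Ioo_eq_intervalIntegral hl]
    exact intervalIntegral.integral_mono_interval hp.1 hpq hq.2
      (ae_of_all _ fun x => sq_nonneg _) hk
  set A := ∫ x in Ioo 0 l, f x ^ 2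
  set B := ∫ x in Ioo 0 l, g x ^ 2
  have hB : 0 ≤ B := integral_nonneg fun x => sq_nonneg _
  have osc : ∀ {p q : ℝ}, p ∈ Icc 0 l → q ∈ Icc 0 l → p ≤ q → q - p ≤ r →
      (f q - f p) ^ 2 ≤ r * B := by
    intro p q hp hq hpq hr'
    rw [← h.integral_eq_sub hl hp hq]
    refine (sq_intervalIntegral_le hpq (hgi.mono_set (hsub hp hq))
      (hg2i.mono_set (hsub hp hq))).trans ?_
    exact mul_le_mul hr' (mono hp hq hpq hg2i)
      (intervalIntegral.integral_nonneg hpq fun _ _ => sq_nonneg _) hr.le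
  -- On the window `f` oscillates by at most `√(r B)`, and `f(s)² ≤ 2 f(x)² + 2 (f(s) - f(x))²`;
  -- averaging this over the window gives the claim.
  have hpt : ∀ x ∈ Icc a (a + r), f s ^ 2 - 2 * r * B ≤ 2 * f x ^ 2 := by
    intro x hx
    have hx' : x ∈ Icc 0 l := ⟨ha0.trans hx.1, hx.2.trans hal⟩
    have : (f s - f x) ^ 2 ≤ r * B := by
      rcases le_total x s with h1 | h1
      · exact osc hx' hs h1 (by linarith [hx.1])
      · rw [← neg_sub, neg_sq]
        exact osc hs hx' h1 (by linarith [hx.2])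
    nlinarith [sq_nonneg (f s - 2 * f x)]
  have haI : a ∈ Icc 0 l := ⟨ha0, by linarith⟩
  have harI : a + r ∈ Icc 0 l := ⟨by linarith, hal⟩
  have h1 : ∫ _ in a..(a + r), (f s ^ 2 - 2 * r * B) ≤ ∫ x in a..(a + r), 2 * f x ^ 2 :=
    intervalIntegral.integral_mono_on (by linarith) (by simp)
      ((hf2i.mono_set (hsub haI harI)).const_mul 2) hpt
  rw [intervalIntegral.integral_const, intervalIntegral.integral_const_mul, smul_eq_mul,
    add_sub_cancel_left] at h1
  have h2 := mono haI harI (by linarith) hf2i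
  have h3 : r * (f s ^ 2 - 2 * r * B) ≤ 2 * A := by linarith
  have h4 : f s ^ 2 - 2 * r * B ≤ 2 / r * A := by
    rw [div_mul_eq_mul_div, le_div_iff₀ hr]
    linarith
  linarith

end MetricGraph

/-! ### Functions on the graph, the Sobolev inequality and closedness of the gradient -/

namespace MetricGraph

variable {V E : Type*} {Γ : MetricGraph V E}

theorem edge_of_nonpos (e : E) {s : ℝ} (hs : s ≤ 0) :
    (edge e s : Γ.Space) = Sum.inl (Γ.init e) := dif_pos hs

theorem edge_of_mem_Ioo (e : E) {s : ℝ} (hs : s ∈ Ioo 0 (Γ.len e)) :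
    (edge e s : Γ.Space) = Sum.inr ⟨e, s, hs⟩ :=
  (dif_neg (not_le.mpr hs.1)).trans (dif_pos hs.2)

theorem edge_of_len_le (e : E) {s : ℝ} (hs : Γ.len e ≤ s) :
    (edge e s : Γ.Space) = Sum.inl (Γ.term e) :=
  (dif_neg (not_le.mpr ((Γ.len_pos e).trans_le hs))).trans (dif_neg (not_lt.mpr hs))

theorem continuous_of_comp_edge {F : Γ.Space → ℝ} (h : ∀ e, Continuous fun s => F (edge e s)) :
    Continuous F :=
  continuous_iSup_dom.mpr fun e => continuous_coinduced_dom.mpr (h e)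

/-- Every point of the graph lies on an edge. -/
class Covered (Γ : MetricGraph V E) : Prop where
  exists_edge : ∀ x : Γ.Space, ∃ e, ∃ s ∈ Icc 0 (Γ.len e), edge e s = x

/-- A vertex other than the initial vertex of a chosen edge has a neighbor, hence an incident edge.
This is all that the proof needs from connectedness. An edge must exist, because an isolated vertex
is a connected graph. -/
theorem Connected.covered [Nonempty E] (h : Γ.Connected) : Γ.Covered := by
  refine ⟨?_⟩
  rintro (p | ⟨e, s, hs⟩)
  · have : ∃ e, Γ.Incident e p := by
      obtain ⟨e⟩ := ‹Nonempty E›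
      rcases (Relation.ReflTransGen.cases_head_iff.mp (h p (Γ.init e))) with h1 | ⟨q, hq, -⟩
      · exact ⟨e, Or.inl h1.symm⟩
      · exact ⟨_, hq.2.choose_spec.1⟩
    obtain ⟨e, he | he⟩ := this
    · refine ⟨e, 0, ⟨le_rfl, (Γ.len_pos e).le⟩, ?_⟩
      rw [edge_of_nonpos e le_rfl, he]
    · refine ⟨e, Γ.len e, ⟨(Γ.len_pos e).le, le_rfl⟩, ?_⟩
      rw [edge_of_len_le e le_rfl, he]
  · exact ⟨e, s, Ioo_subset_Icc_self hs, edge_of_mem_Ioo e hs⟩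

/-- A function on the real line vanishing outside `(0, len e)`, transplanted to the edge `e` and
extended by zero. -/
noncomputable def onEdge (e : E) (φ : ℝ → ℝ) : Γ.Space → ℝ := by
  classical
  exact Sum.elim (fun _ => 0) fun p => if p.1 = e then φ p.2 else 0

theorem onEdge_edge_self (e : E) {φ : ℝ → ℝ} (hφ : ∀ s, s ∉ Ioo 0 (Γ.len e) → φ s = 0) (s : ℝ) :
    onEdge e φ (edge e s : Γ.Space) = φ s := by
  by_cases hs : s ∈ Ioo 0 (Γ.len e)
  · rw [edge_of_mem_Ioo e hs]
    exact if_pos rfl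
  · rw [hφ s hs]
    rcases le_or_gt s 0 with h | h
    · rw [edge_of_nonpos e h]
      rfl
    · rw [edge_of_len_le e (not_lt.mp fun h' => hs ⟨h, h'⟩)]
      rfl

theorem onEdge_edge_of_ne {e e' : E} (he : e' ≠ e) (φ : ℝ → ℝ) (s : ℝ) :
    onEdge e φ (edge e' s : Γ.Space) = 0 := by
  rcases le_or_gt s 0 with h | h
  · rw [edge_of_nonpos e' h]
    rfl
  rcases lt_or_ge s (Γ.len e') with h' | h'
  · rw [edge_of_mem_Ioo e' ⟨h, h'⟩]
    exact if_neg he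
  · rw [edge_of_len_le e' h']
    rfl

theorem continuous_onEdge (e : E) {φ : ℝ → ℝ} (hφ : ∀ s, s ∉ Ioo 0 (Γ.len e) → φ s = 0)
    (hc : Continuous φ) : Continuous (onEdge e φ : Γ.Space → ℝ) := by
  refine continuous_of_comp_edge fun e' => ?_
  by_cases he : e' = e
  · subst he
    simpa only [onEdge_edge_self e' hφ] using hc
  · simp only [onEdge_edge_of_ne he]
    exact continuous_const

variable [Fintype E]

theorem integrable_edge {F : Γ.Space → ℝ} (hF : Integrable F Γ.μ) (e : E) :
    Integrable F (Measure.map (edge e) (volume.restrict (Ioo 0 (Γ.len e)))) := by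
  have h1 : Integrable F (ENNReal.ofReal (Γ.weight e) •
      Measure.map (edge e) (volume.restrict (Ioo 0 (Γ.len e)))) := by
    unfold μ at hF
    exact integrable_finsetSum_measure.mp hF e (Finset.mem_univ e)
  exact (integrable_smul_measure (ENNReal.ofReal_pos.mpr (Γ.weight_pos e)).ne'
    ENNReal.ofReal_ne_top).mp h1

theorem integrableOn_comp_edge {F : Γ.Space → ℝ} (hF : Integrable F Γ.μ) (e : E) :
    IntegrableOn (fun s => F (edge e s)) (Ioo 0 (Γ.len e)) :=
  (integrable_edge hF e).comp_measurable (continuous_edge e).measurable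

theorem integral_eq_sum {F : Γ.Space → ℝ} (hF : Integrable F Γ.μ) :
    ∫ x, F x ∂Γ.μ = ∑ e, Γ.weight e * ∫ s in Ioo 0 (Γ.len e), F (edge e s) := by
  have h1 : ∀ e ∈ Finset.univ, Integrable F (ENNReal.ofReal (Γ.weight e) •
      Measure.map (edge e) (volume.restrict (Ioo 0 (Γ.len e)))) := fun e _ =>
    (integrable_edge hF e).smul_measure ENNReal.ofReal_ne_top
  unfold μ
  rw [integral_finsetSum_measure h1]
  refine Finset.sum_congr rfl fun e _ => ?_
  rw [integral_smul_measure, ENNReal.toReal_ofReal (Γ.weight_pos e).le, smul_eq_mul,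
    integral_map (continuous_edge e).measurable.aemeasurable
      (integrable_edge hF e).aestronglyMeasurable]

theorem integrable_sq (g : Γ.L2) : Integrable (fun x => g x ^ 2) Γ.μ :=
  (Lp.memLp g).integrable_sq

theorem integrable_mul (f g : Γ.L2) : Integrable (fun x => f x * g x) Γ.μ :=
  (Lp.memLp f).integrable_mul (Lp.memLp g)

theorem inner_eq_integral (f g : Γ.L2) : ⟪f, g⟫_ℝ = ∫ x, f x * g x ∂Γ.μ := by
  rw [L2.inner_def]
  exact integral_congr_ae (ae_of_all _ fun x => by simp [mul_comm])

theorem norm_sq_eq_sum (g : Γ.L2) :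
    ‖g‖ ^ 2 = ∑ e, Γ.weight e * ∫ s in Ioo 0 (Γ.len e), g (edge e s) ^ 2 := by
  rw [← integral_eq_sum (integrable_sq g), ← real_inner_self_eq_norm_sq, inner_eq_integral]
  simp only [sq]

theorem weight_mul_integral_le (g : Γ.L2) (e : E) :
    Γ.weight e * ∫ s in Ioo 0 (Γ.len e), g (edge e s) ^ 2 ≤ ‖g‖ ^ 2 := by
  rw [norm_sq_eq_sum]
  exact Finset.single_le_sum
    (f := fun e => Γ.weight e * ∫ s in Ioo 0 (Γ.len e), g (edge e s) ^ 2)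
    (fun e _ => mul_nonneg (Γ.weight_pos e).le (integral_nonneg fun _ => sq_nonneg _))
    (Finset.mem_univ e)

theorem integrable_L2 (g : Γ.L2) : Integrable g Γ.μ :=
  (Lp.memLp g).integrable (by norm_num)

/-- On a finite measure space `L² ⊆ L¹`, so a continuous function with a weak derivative in `L²` is
absolutely continuous on each edge. Product and chain rules can then be read off pointwise a.e.
derivatives. -/
theorem isGradient_iff {F : Γ.Space → ℝ} {g : Γ.L2} : IsGradient F g ↔ Continuous F ∧ ∀ e : E,
    HasACDeriv (Γ.len e) (fun s => F (edge e s)) (fun s => √(Γ.weight e) * g (edge e s)) := by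
  refine and_congr_right fun hF => forall_congr' fun e => ⟨fun h => ?_, fun h => ?_⟩
  · exact h.hasACDeriv (Γ.len_pos e) (hF.comp (continuous_edge e)).continuousOn
      ((integrableOn_comp_edge (integrable_L2 g) e).const_mul _)
  · exact h.isWeakDeriv (Γ.len_pos e)

theorem HasACDeriv.congr_deriv {l : ℝ} {f g g' : ℝ → ℝ} (h : HasACDeriv l f g)
    (hg : ∀ᵐ s ∂(volume.restrict (Ioo 0 l)), g s = g' s) : HasACDeriv l f g' := by
  refine ⟨h.1, ?_⟩
  filter_upwards [h.2, hg] with s hs hs'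
  rwa [← hs']

theorem intervalIntegral_edge_congr {f g : Γ.Space → ℝ} (h : f =ᵐ[Γ.μ] g) (e : E) {s : ℝ}
    (hs : s ∈ Icc 0 (Γ.len e)) :
    ∫ x in (0 : ℝ)..s, f (edge e x) = ∫ x in (0 : ℝ)..s, g (edge e x) := by
  refine intervalIntegral.integral_congr_ae ?_
  have := (ae_restrict_Ioo_iff_uIcc (Γ.len_pos e)).mp (ae_edge h e)
  filter_upwards [this] with x hx hx'
  refine hx ?_
  rw [uIcc_of_le (Γ.len_pos e).le]
  rw [uIoc_of_le hs.1] at hx'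
  exact ⟨hx'.1.le, hx'.2.trans hs.2⟩

theorem intervalIntegrable_edge {F : Γ.Space → ℝ} (hF : Integrable F Γ.μ) (e : E) {s : ℝ}
    (hs : s ∈ Icc 0 (Γ.len e)) :
    IntervalIntegrable (fun x => F (edge e x)) volume 0 s := by
  refine ((intervalIntegrable_iff_integrableOn_Ioo (Γ.len_pos e)).mpr
    (integrableOn_comp_edge hF e)).mono_set ?_
  rw [uIcc_of_le hs.1, uIcc_of_le (Γ.len_pos e).le]
  exact Icc_subset_Icc_right hs.2

/-- Integration along an edge, as a continuous linear functional on `L²`. -/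
noncomputable def edgeIntegral (e : E) (s : ℝ) (hs : s ∈ Icc 0 (Γ.len e)) : Γ.L2 →L[ℝ] ℝ :=
  LinearMap.mkContinuous
    { toFun := fun g => ∫ x in (0 : ℝ)..s, g (edge e x)
      map_add' := fun f g => by
        rw [intervalIntegral_edge_congr (Lp.coeFn_add f g) e hs]
        exact intervalIntegral.integral_add (intervalIntegrable_edge (integrable_L2 f) e hs)
          (intervalIntegrable_edge (integrable_L2 g) e hs)
      map_smul' := fun a g => by
        rw [intervalIntegral_edge_congr (Lp.coeFn_smul a g) e hs]
        exact intervalIntegral.integral_const_mul a _ }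
    -- Cauchy-Schwarz on the edge contributes `len e`; passing from Lebesgue measure to `μ`
    -- contributes `1 / weight e`.
    (√(Γ.len e / Γ.weight e)) fun g => by
      have hc := Γ.weight_pos e
      have hl := Γ.len_pos e
      refine abs_le_of_sq_le_sq ?_ (by positivity)
      rw [mul_pow, Real.sq_sqrt (by positivity)]
      refine (sq_intervalIntegral_le hs.1 (intervalIntegrable_edge (integrable_L2 g) e hs)
        (intervalIntegrable_edge (integrable_sq g) e hs)).trans ?_
      have h1 : ∫ x in (0 : ℝ)..s, g (edge e x) ^ 2 ≤ ∫ x in Ioo 0 (Γ.len e), g (edge e x) ^ 2 := by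
        rw [setIntegral_Ioo_eq_intervalIntegral hl]
        exact intervalIntegral.integral_mono_interval le_rfl hs.1 hs.2
          (ae_of_all _ fun x => sq_nonneg _)
          ((intervalIntegrable_iff_integrableOn_Ioo hl).mpr
            (integrableOn_comp_edge (integrable_sq g) e))
      have h2 := weight_mul_integral_le g e
      rw [div_mul_eq_mul_div, le_div_iff₀ hc]
      have h3 : 0 ≤ ∫ x in (0 : ℝ)..s, g (edge e x) ^ 2 :=
        intervalIntegral.integral_nonneg hs.1 fun _ _ => sq_nonneg _
      rw [sub_zero]
      calc s * (∫ x in (0 : ℝ)..s, g (edge e x) ^ 2) * Γ.weight e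
          ≤ Γ.len e * (∫ x in Ioo 0 (Γ.len e), g (edge e x) ^ 2) * Γ.weight e := by
            gcongr
            exact hs.2
        _ ≤ Γ.len e * ‖g‖ ^ 2 := by
            rw [mul_assoc, mul_comm _ (Γ.weight e)]
            gcongr

theorem edgeIntegral_apply (e : E) (s : ℝ) (hs : s ∈ Icc 0 (Γ.len e)) (g : Γ.L2) :
    edgeIntegral e s hs g = ∫ x in (0 : ℝ)..s, g (edge e x) := rfl

/-- `g = dF` if and only if `F` is obtained on each edge by integrating `g`. -/
theorem isGradient_iff_edgeIntegral {F : Γ.Space → ℝ} {g : Γ.L2} : IsGradient F g ↔ Continuous F ∧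
    ∀ (e : E) (s : ℝ) (hs : s ∈ Icc 0 (Γ.len e)),
      F (edge e s) = F (edge e 0) + √(Γ.weight e) * edgeIntegral e s hs g := by
  rw [isGradient_iff]
  refine and_congr_right fun hF => forall_congr' fun e => ⟨fun h s hs => ?_, fun h => ?_⟩
  · have := h.integral_eq_sub (Γ.len_pos e) ⟨le_rfl, (Γ.len_pos e).le⟩ hs
    rw [intervalIntegral.integral_const_mul] at this
    rw [edgeIntegral_apply, this]
    ring
  · refine (hasACDeriv_intervalIntegral (Γ.len_pos e)
      ((integrableOn_comp_edge (integrable_L2 g) e).const_mul (√(Γ.weight e)))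
      (F (edge e 0))).congr (Γ.len_pos e) fun s hs => ?_
    rw [h s hs, edgeIntegral_apply, add_comm]
    simp only [intervalIntegral.integral_const_mul]

instance [Γ.Covered] : CompactSpace Γ.Space := by
  have : (univ : Set Γ.Space) = ⋃ e : E, edge e '' Icc 0 (Γ.len e) := by
    refine (eq_univ_of_forall fun x => ?_).symm
    obtain ⟨e, s, hs, h⟩ := Covered.exists_edge x
    exact mem_iUnion.mpr ⟨e, s, hs, h⟩
  refine ⟨?_⟩
  rw [this]
  exact isCompact_iUnion fun e => isCompact_Icc.image (continuous_edge e)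

theorem coeFn_toL2 {F : Γ.Space → ℝ} (hF : Continuous F) : toL2 F hF =ᵐ[Γ.μ] F :=
  MemLp.coeFn_toLp _

/-- The Sobolev inequality on a metric graph, with a small constant in front of the gradient. -/
theorem exists_sobolev [Γ.Covered] {ε : ℝ} (hε : 0 < ε) : ∃ C > 0, ∀ (F : Γ.Space → ℝ) (g : Γ.L2)
    (h : IsGradient F g), ∀ x, F x ^ 2 ≤ C * ‖toL2 F h.1‖ ^ 2 + ε * ‖g‖ ^ 2 := by
  -- The window length for `HasACDeriv.sq_le`: it must fit in the edge, and `2 r ≤ ε` makes the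
  -- gradient coefficient small.
  have hr : ∀ e, 0 < min (Γ.len e) (ε / 2) := fun e => lt_min (Γ.len_pos e) (by positivity)
  have hpos : ∀ e, 0 < 2 / min (Γ.len e) (ε / 2) / Γ.weight e := fun e =>
    div_pos (div_pos two_pos (hr e)) (Γ.weight_pos e)
  -- The sum dominates the constant of every single edge; the summand `1` keeps it positive even for
  -- an empty sum.
  refine ⟨1 + ∑ e, 2 / min (Γ.len e) (ε / 2) / Γ.weight e,
    add_pos_of_pos_of_nonneg one_pos (Finset.sum_nonneg fun e _ => (hpos e).le),
    fun F g h x => ?_⟩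
  obtain ⟨e, s, hs, rfl⟩ := Covered.exists_edge x
  have hc := Γ.weight_pos e
  set r := min (Γ.len e) (ε / 2) with hrdef
  have hsq : ∀ s, (√(Γ.weight e) * g (edge e s)) ^ 2 = Γ.weight e * g (edge e s) ^ 2 := fun s => by
    rw [mul_pow, Real.sq_sqrt hc.le]
  have h1 := ((isGradient_iff.mp h).2 e).sq_le (Γ.len_pos e)
    (by simp only [hsq]; exact (integrableOn_comp_edge (integrable_sq g) e).const_mul _)
    (hr e) (min_le_left _ _) hs
  simp only [hsq, integral_const_mul] at h1
  have h2 := weight_mul_integral_le g e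
  have h3 := weight_mul_integral_le (toL2 F h.1) e
  have h4 : ∫ s in Ioo 0 (Γ.len e), toL2 F h.1 (edge e s) ^ 2
      = ∫ s in Ioo 0 (Γ.len e), F (edge e s) ^ 2 :=
    integral_congr_ae ((ae_edge (coeFn_toL2 h.1) e).mono fun s hs => by simp only [hs])
  rw [h4] at h3
  have h5 : 2 / r / Γ.weight e ≤ ∑ e, 2 / min (Γ.len e) (ε / 2) / Γ.weight e :=
    Finset.single_le_sum (f := fun e => 2 / min (Γ.len e) (ε / 2) / Γ.weight e)
      (fun e _ => (hpos e).le) (Finset.mem_univ e)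
  have h6 : 2 / r * (∫ x in Ioo 0 (Γ.len e), F (edge e x) ^ 2)
      = 2 / r / Γ.weight e * (Γ.weight e * ∫ x in Ioo 0 (Γ.len e), F (edge e x) ^ 2) := by
    field_simp
  rw [h6] at h1
  refine h1.trans (add_le_add ?_ ?_)
  · exact mul_le_mul (by linarith) h3
      (mul_nonneg hc.le (integral_nonneg fun _ => sq_nonneg _))
      (add_nonneg zero_le_one (Finset.sum_nonneg fun e _ => (hpos e).le))
  · refine mul_le_mul (by linarith [min_le_right (Γ.len e) (ε / 2)]) h2
      (mul_nonneg hc.le (integral_nonneg fun _ => sq_nonneg _)) hε.le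

theorem IsGradient.sub {F₁ F₂ : Γ.Space → ℝ} {g₁ g₂ : Γ.L2} (h₁ : IsGradient F₁ g₁)
    (h₂ : IsGradient F₂ g₂) : IsGradient (fun x => F₁ x - F₂ x) (g₁ - g₂) := by
  have := h₁.add (h₂.smul (-1))
  simpa [sub_eq_add_neg] using this

theorem toL2_sub {F₁ F₂ : Γ.Space → ℝ} (h₁ : Continuous F₁) (h₂ : Continuous F₂) :
    toL2 (fun x => F₁ x - F₂ x) (h₁.sub h₂) = toL2 F₁ h₁ - toL2 F₂ h₂ :=
  MemLp.toLp_sub _ _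

theorem toL2_eq_toLp [CompactSpace Γ.Space] (F : C(Γ.Space, ℝ)) :
    toL2 F F.continuous = ContinuousMap.toLp 2 Γ.μ ℝ F := rfl

/-- The gradient is a closed operator. -/
theorem isClosed_gradGraph [Γ.Covered] : IsClosed (Γ.gradGraph : Set (Γ.L2 × Γ.L2)) := by
  refine IsSeqClosed.isClosed fun p q hp hq => ?_
  choose F hF hFp using hp
  obtain ⟨C, hC, hsob⟩ := exists_sobolev (Γ := Γ) one_pos
  have hq1 : Tendsto (fun n => (p n).1) atTop (𝓝 q.1) := (continuous_fst.tendsto q).comp hq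
  have hq2 : Tendsto (fun n => (p n).2) atTop (𝓝 q.2) := (continuous_snd.tendsto q).comp hq
  let G : ℕ → C(Γ.Space, ℝ) := fun n => ⟨F n, (hF n).1⟩
  -- The Sobolev inequality for differences: convergence in the graph norm forces uniform
  -- convergence of the continuous representatives.
  have hbound : ∀ m n, dist (G m) (G n) ≤
      √(C * ‖(p m).1 - (p n).1‖ ^ 2 + 1 * ‖(p m).2 - (p n).2‖ ^ 2) := by
    intro m n
    refine (ContinuousMap.dist_le (Real.sqrt_nonneg _)).mpr fun x => ?_
    refine Real.le_sqrt_of_sq_le ?_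
    have := hsob _ _ ((hF m).sub (hF n)) x
    rw [toL2_sub (hF m).1 (hF n).1, hFp, hFp] at this
    rwa [Real.dist_eq, sq_abs]
  have hcauchy : CauchySeq G := by
    rw [Metric.cauchySeq_iff']
    intro ε hε
    obtain ⟨δ, hδ, hδ'⟩ : ∃ δ > 0, C * δ ^ 2 + 1 * δ ^ 2 < ε ^ 2 := by
      have : Tendsto (fun δ : ℝ => C * δ ^ 2 + 1 * δ ^ 2) (𝓝[>] 0) (𝓝 (C * 0 ^ 2 + 1 * 0 ^ 2)) :=
        (Continuous.tendsto (by fun_prop) 0).mono_left nhdsWithin_le_nhds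
      have h2 := (this.eventually (gt_mem_nhds (by simp; positivity : _ < ε ^ 2))).and
        self_mem_nhdsWithin
      obtain ⟨δ, h3, h4⟩ := h2.exists
      exact ⟨δ, h4, h3⟩
    obtain ⟨N, hN⟩ := Metric.cauchySeq_iff'.mp hq.cauchySeq δ hδ
    refine ⟨N, fun n hn => (hbound n N).trans_lt ?_⟩
    rw [Real.sqrt_lt' hε]
    have h1 := hN n hn
    rw [Prod.dist_eq, max_lt_iff, dist_eq_norm, dist_eq_norm] at h1
    refine lt_of_le_of_lt ?_ hδ'
    gcongr
    · exact h1.1.le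
    · exact h1.2.le
  obtain ⟨G₀, hG₀⟩ := cauchySeq_tendsto_of_complete hcauchy
  have hpt : ∀ x, Tendsto (fun n => F n x) atTop (𝓝 (G₀ x)) := fun x =>
    ((ContinuousEvalConst.continuous_eval_const (F := C(Γ.Space, ℝ)) x).tendsto G₀).comp hG₀
  -- In integrated form `dF = g` involves only point values of `F` and continuous functionals of
  -- `g`, so it survives the limit.
  refine ⟨G₀, isGradient_iff_edgeIntegral.mpr ⟨G₀.continuous, fun e s hs => ?_⟩, ?_⟩
  · refine tendsto_nhds_unique (hpt _) ?_
    simp only [fun n => (isGradient_iff_edgeIntegral.mp (hF n)).2 e s hs]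
    exact (hpt _).add ((((edgeIntegral e s hs).continuous.tendsto _).comp hq2).const_mul _)
  · rw [toL2_eq_toLp]
    refine tendsto_nhds_unique (((ContinuousMap.toLp 2 Γ.μ ℝ).continuous.tendsto G₀).comp hG₀) ?_
    refine hq1.congr fun n => ?_
    rw [← hFp n]
    rfl

end MetricGraph

/-! ### Products, density of `W^{1,2}`, continuous representatives -/

namespace MetricGraph

variable {V E : Type*} [Fintype E] {Γ : MetricGraph V E}

theorem isGradient_const (c : ℝ) : IsGradient (Γ := Γ) (fun _ => c) 0 := by
  rw [isGradient_iff_edgeIntegral]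
  exact ⟨continuous_const, fun e s hs => by simp⟩

section Multiplication

variable [CompactSpace Γ.Space]

/-- Multiplication of square integrable functions by continuous functions. -/
noncomputable def mulL : C(Γ.Space, ℝ) →L[ℝ] Γ.L2 →L[ℝ] Γ.L2 :=
  ((ContinuousLinearMap.mul ℝ ℝ).holderL Γ.μ ∞ 2 2).comp (ContinuousMap.toLp ∞ Γ.μ ℝ)

theorem coeFn_mulL (a : C(Γ.Space, ℝ)) (g : Γ.L2) : mulL a g =ᵐ[Γ.μ] fun x => a x * g x := by
  have h1 := (ContinuousLinearMap.mul ℝ ℝ).coeFn_holder (r := 2) (ContinuousMap.toLp ∞ Γ.μ ℝ a) g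
  have h2 := ContinuousMap.coeFn_toLp (p := ∞) Γ.μ (𝕜 := ℝ) a
  filter_upwards [h1, h2] with x hx hx'
  rw [← hx']
  exact hx

theorem mulL_mul (a b : C(Γ.Space, ℝ)) (g : Γ.L2) : mulL (a * b) g = mulL a (mulL b g) := by
  refine Lp.ext ?_
  filter_upwards [coeFn_mulL (a * b) g, coeFn_mulL a (mulL b g), coeFn_mulL b g] with x h1 h2 h3
  rw [h1, h2, h3, ContinuousMap.mul_apply, mul_assoc]

theorem inner_mulL_left (a : C(Γ.Space, ℝ)) (f g : Γ.L2) :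
    ⟪mulL a f, g⟫_ℝ = ∫ x, a x * f x * g x ∂Γ.μ := by
  rw [inner_eq_integral]
  exact integral_congr_ae ((coeFn_mulL a f).mono fun x hx => by simp only [hx])

theorem inner_mulL_comm (a : C(Γ.Space, ℝ)) (f g : Γ.L2) :
    ⟪mulL a f, g⟫_ℝ = ⟪f, mulL a g⟫_ℝ := by
  rw [inner_mulL_left, real_inner_comm, inner_mulL_left]
  exact integral_congr_ae (ae_of_all _ fun x => by ring)

theorem inner_mulL_self_nonneg {a : C(Γ.Space, ℝ)} (ha : ∀ x, 0 ≤ a x) (f : Γ.L2) :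
    0 ≤ ⟪mulL a f, f⟫_ℝ := by
  rw [inner_mulL_left]
  exact integral_nonneg fun x => (mul_nonneg (ha x) (mul_self_nonneg (f x))).trans_eq (mul_assoc _ _ _).symm

/-- The pointwise bound is on squares because that is how `exists_sobolev` delivers it. -/
theorem norm_mulL_le {a : C(Γ.Space, ℝ)} {C : ℝ} (hC : 0 ≤ C) (ha : ∀ x, a x ^ 2 ≤ C ^ 2)
    (f : Γ.L2) : ‖mulL a f‖ ≤ C * ‖f‖ := by
  refine Lp.norm_le_mul_norm_of_ae_le_mul ?_
  filter_upwards [coeFn_mulL a f] with x hx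
  rw [hx, norm_mul]
  exact mul_le_mul_of_nonneg_right (abs_le_of_sq_le_sq (ha x) hC) (norm_nonneg _)

/-- The class in `L²` of a continuous function, as a continuous linear map. -/
noncomputable def toL2L : C(Γ.Space, ℝ) →L[ℝ] Γ.L2 := ContinuousMap.toLp 2 Γ.μ ℝ

theorem toL2L_apply (F : C(Γ.Space, ℝ)) : toL2L F = toL2 F F.continuous := rfl

theorem coeFn_toL2L (F : C(Γ.Space, ℝ)) : toL2L F =ᵐ[Γ.μ] F := coeFn_toL2 F.continuous

theorem inner_toL2L_mulL (φ : C(Γ.Space, ℝ)) (f g : Γ.L2) :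
    ⟪mulL φ f, g⟫_ℝ = ∫ x, toL2L φ x * (f x * g x) ∂Γ.μ := by
  rw [inner_mulL_left]
  exact integral_congr_ae ((coeFn_toL2L φ).mono fun x hx => by simp only [hx, mul_assoc])

theorem inner_toL2L (a b : C(Γ.Space, ℝ)) : ⟪toL2L a, toL2L b⟫_ℝ = ∫ x, a x * b x ∂Γ.μ := by
  rw [inner_eq_integral]
  refine integral_congr_ae ?_
  filter_upwards [coeFn_toL2L a, coeFn_toL2L b] with x h1 h2
  rw [h1, h2]

/-- The product rule for the gradient. -/
theorem IsGradient.mul {a b : C(Γ.Space, ℝ)} {f g : Γ.L2} (ha : IsGradient a f)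
    (hb : IsGradient b g) : IsGradient (a * b : C(Γ.Space, ℝ)) (mulL a g + mulL b f) := by
  rw [isGradient_iff] at *
  refine ⟨(a * b).continuous, fun e => ((ha.2 e).mul (hb.2 e)).congr_deriv ?_⟩
  filter_upwards [ae_edge (Lp.coeFn_add (mulL a g) (mulL b f)) e, ae_edge (coeFn_mulL a g) e,
    ae_edge (coeFn_mulL b f) e] with s h1 h2 h3
  rw [h1, Pi.add_apply, h2, h3]
  ring

/-- The chain rule for the gradient. -/
theorem IsGradient.comp {F : C(Γ.Space, ℝ)} {g : Γ.L2} (h : IsGradient F g) {a b : ℝ}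
    {φ φ' : ℝ → ℝ} (hab : ∀ x, F x ∈ Icc a b) (hφ : ∀ x ∈ Icc a b, HasDerivAt φ (φ' x) x)
    (hφ' : ContinuousOn φ' (Icc a b)) {G G' : C(Γ.Space, ℝ)} (hG : ∀ x, G x = φ (F x))
    (hG' : ∀ x, G' x = φ' (F x)) : IsGradient G (mulL G' g) := by
  rw [isGradient_iff] at *
  refine ⟨G.continuous, fun e => ?_⟩
  have := (h.2 e).comp (Γ.len_pos e) (fun s _ => hab (edge e s)) hφ hφ'
  simp only [hG]
  refine this.congr_deriv ?_
  filter_upwards [ae_edge (coeFn_mulL G' g) e] with s hs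
  rw [hs, hG']
  ring

end Multiplication

section Density

/-- Test functions on one edge vanish near its ends, so extension by zero respects the gluing. They
supply enough elements of `W^{1,2}` for density. -/
theorem isGradient_onEdge (e : E) {φ : ℝ → ℝ} (hφ : ContDiff ℝ ∞ φ)
    (hs : tsupport φ ⊆ Ioo 0 (Γ.len e))
    (hd : Continuous (onEdge e fun s => (√(Γ.weight e))⁻¹ * deriv φ s : Γ.Space → ℝ)) :
    IsGradient (onEdge e φ : Γ.Space → ℝ) (toL2 _ hd) := by
  have h1 : ∀ s, s ∉ Ioo 0 (Γ.len e) → φ s = 0 := fun s h =>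
    image_eq_zero_of_notMem_tsupport fun h' => h (hs h')
  have h2 : ∀ s, s ∉ Ioo 0 (Γ.len e) → deriv φ s = 0 := fun s h =>
    image_eq_zero_of_notMem_tsupport fun h' => h (hs (tsupport_deriv_subset (𝕜 := ℝ) h'))
  have hc := Γ.weight_pos e
  rw [isGradient_iff]
  refine ⟨continuous_onEdge e h1 hφ.continuous, fun e' => ?_⟩
  by_cases he : e' = e
  · subst he
    have h3 : HasACDeriv (Γ.len e') φ (deriv φ) :=
      ⟨(hφ.of_le (by simp)).contDiffOn.absolutelyContinuousOnInterval,
        ae_of_all _ fun s => (hφ.differentiable (by simp) s).hasDerivAt⟩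
    simp only [onEdge_edge_self e' h1]
    refine h3.congr_deriv ?_
    filter_upwards [ae_edge (coeFn_toL2 hd) e'] with s hs
    rw [hs, onEdge_edge_self e' (fun s h => by rw [h2 s h, mul_zero])]
    have := (Real.sqrt_pos.mpr hc).ne'
    field_simp
  · simp only [onEdge_edge_of_ne he]
    have h3 : HasACDeriv (Γ.len e') (fun _ => (0 : ℝ)) fun _ => 0 :=
      ⟨(LipschitzWith.const (0 : ℝ)).lipschitzOnWith.absolutelyContinuousOnInterval,
        ae_of_all _ fun s => hasDerivAt_const s 0⟩
    refine h3.congr_deriv ?_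
    filter_upwards [ae_edge (coeFn_toL2 hd) e'] with s hs
    rw [hs, onEdge_edge_of_ne he, mul_zero]

theorem mem_domain_d_of_isGradient {F : Γ.Space → ℝ} {g : Γ.L2} (h : IsGradient F g) :
    toL2 F h.1 ∈ Γ.d.domain :=
  LinearPMap.mem_domain_of_mem_graph ((Γ.mem_graph_d_iff (toL2 F h.1, g)).mpr ⟨F, h, rfl⟩)

/-- The gradient is densely defined. -/
theorem dense_domain_d : Dense (Γ.d.domain : Set Γ.L2) := by
  rw [Submodule.dense_iff_topologicalClosure_eq_top, Submodule.topologicalClosure_eq_top_iff,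
    Submodule.eq_bot_iff]
  intro f hf
  rw [Submodule.mem_orthogonal] at hf
  refine (Lp.eq_zero_iff_ae_eq_zero).mpr ?_
  refine ae_of_ae_edge
    (measurableSet_eq_fun (Lp.stronglyMeasurable f).measurable measurable_const) fun e => ?_
  rw [ae_restrict_iff' measurableSet_Ioo]
  refine isOpen_Ioo.ae_eq_zero_of_integral_contDiff_smul_eq_zero
    (integrableOn_comp_edge (integrable_L2 f) e).locallyIntegrableOn fun φ hφ hc hs => ?_
  have h1 : ∀ s, s ∉ Ioo 0 (Γ.len e) → φ s = 0 := fun s h =>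
    image_eq_zero_of_notMem_tsupport fun h' => h (hs h')
  have h2 : ∀ s, s ∉ Ioo 0 (Γ.len e) → (√(Γ.weight e))⁻¹ * deriv φ s = 0 := fun s h => by
    rw [image_eq_zero_of_notMem_tsupport fun h' => h (hs (tsupport_deriv_subset (𝕜 := ℝ) h')),
      mul_zero]
  have hF := isGradient_onEdge e hφ hs
    (continuous_onEdge e h2 (continuous_const.mul (hφ.continuous_deriv (by simp))))
  have h3 := hf _ (mem_domain_d_of_isGradient hF)
  rw [inner_eq_integral, integral_congr_ae (g := fun x => onEdge e φ x * f x)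
    ((coeFn_toL2 hF.1).mono fun x hx => by simp only [hx]), integral_eq_sum,
    Finset.sum_eq_single e] at h3
  · have h4 := (mul_eq_zero.mp h3).resolve_left (Γ.weight_pos e).ne'
    simp only [onEdge_edge_self e h1] at h4
    rw [← h4, setIntegral_eq_integral_of_forall_compl_eq_zero]
    · rfl
    · intro s hs
      rw [h1 s hs, zero_mul]
  · intro e' _ he
    simp only [onEdge_edge_of_ne he, zero_mul, integral_zero, mul_zero]
  · intro h
    exact absurd (Finset.mem_univ e) h
  · exact (integrable_mul (toL2 _ hF.1) f).congr
      ((coeFn_toL2 hF.1).mono fun x hx => by simp only [hx])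

end Density

section Representative

variable [Γ.Covered]

/-- A continuous function is determined by its class in `L²` if it has a gradient. -/
theorem IsGradient.eq_of_toL2_eq {F₁ F₂ : Γ.Space → ℝ} {g₁ g₂ : Γ.L2} (h₁ : IsGradient F₁ g₁)
    (h₂ : IsGradient F₂ g₂) (h : toL2 F₁ h₁.1 = toL2 F₂ h₂.1) : F₁ = F₂ ∧ g₁ = g₂ := by
  have h3 := h₁.sub h₂
  have h4 : toL2 _ h3.1 = 0 := by rw [toL2_sub h₁.1 h₂.1, h, sub_self]
  have h5 : g₁ - g₂ = 0 := Γ.gradGraph_single_valued (0, g₁ - g₂) ⟨_, h3, h4⟩ rfl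
  obtain ⟨C, hC, hsob⟩ := exists_sobolev (Γ := Γ) one_pos
  refine ⟨funext fun x => ?_, sub_eq_zero.mp h5⟩
  have h6 := hsob _ _ h3 x
  rw [h4, h5, norm_zero] at h6
  nlinarith [sq_nonneg (F₁ x - F₂ x)]

theorem exists_rep (p : Γ.gradGraph) : ∃ F : C(Γ.Space, ℝ), IsGradient F p.1.2 ∧ toL2L F = p.1.1 := by
  obtain ⟨F, hF, h⟩ := p.2
  exact ⟨⟨F, hF.1⟩, hF, h⟩

/-- The continuous representative of an element of `W^{1,2}`. -/
noncomputable def rep : Γ.gradGraph →L[ℝ] C(Γ.Space, ℝ) := by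
  refine LinearMap.mkContinuousOfExistsBound
    { toFun := fun p => (exists_rep p).choose
      map_add' := fun p q => ?_
      map_smul' := fun a p => ?_ } ?_
  · have h1 := (exists_rep p).choose_spec
    have h2 := (exists_rep q).choose_spec
    have h3 := (exists_rep (p + q)).choose_spec
    refine DFunLike.coe_injective (h3.1.eq_of_toL2_eq (h1.1.add h2.1) ?_).1
    exact h3.2.trans ((congrArg₂ (· + ·) h1.2.symm h2.2.symm).trans (map_add toL2L _ _).symm)
  · have h1 := (exists_rep p).choose_spec
    have h3 := (exists_rep (a • p)).choose_spec
    refine DFunLike.coe_injective (h3.1.eq_of_toL2_eq (h1.1.smul a) ?_).1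
    exact h3.2.trans ((congrArg (a • ·) h1.2.symm).trans (map_smul toL2L _ _).symm)
  · obtain ⟨C, hC, hsob⟩ := exists_sobolev (Γ := Γ) one_pos
    -- The norm on the graph is the maximum of the two component norms, so the Sobolev inequality
    -- with gradient constant `1` gives `C + 1`.
    refine ⟨√(C + 1), fun p => ?_⟩
    have h1 := (exists_rep p).choose_spec
    refine (ContinuousMap.norm_le _ (by positivity)).mpr fun x => ?_
    refine abs_le_of_sq_le_sq ((hsob _ _ h1.1 x).trans ?_) (by positivity)
    rw [mul_pow, Real.sq_sqrt (by positivity), ← toL2L_apply, h1.2, add_mul]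
    have h2 : ‖p.1.1‖ ≤ ‖p‖ := norm_fst_le p.1
    have h3 : ‖p.1.2‖ ≤ ‖p‖ := norm_snd_le p.1
    gcongr

theorem isGradient_rep (p : Γ.gradGraph) : IsGradient (rep p) p.1.2 :=
  (exists_rep p).choose_spec.1

theorem toL2L_rep (p : Γ.gradGraph) : toL2L (rep p) = p.1.1 := (exists_rep p).choose_spec.2

theorem rep_eq {F : C(Γ.Space, ℝ)} {p : Γ.gradGraph} (h : IsGradient F p.1.2)
    (hF : toL2L F = p.1.1) : rep p = F :=
  DFunLike.coe_injective ((isGradient_rep p).eq_of_toL2_eq h ((toL2L_rep p).trans hF.symm)).1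

end Representative

end MetricGraph

/-! ### Semigroups generated by bounded operators -/

section BoundedGenerator

variable {H : Type*} [NormedAddCommGroup H] [InnerProductSpace ℝ H]

/-- The semigroup `e^{-tB}` generated by a bounded operator `-B`. -/
noncomputable def expSemigroup (B : H →L[ℝ] H) (t : ℝ) : H →L[ℝ] H := NormedSpace.exp (t • -B)

theorem expSemigroup_zero (B : H →L[ℝ] H) : expSemigroup B 0 = 1 := by
  rw [expSemigroup, zero_smul, NormedSpace.exp_zero]

theorem Commute.expSemigroup_right {B C : H →L[ℝ] H} (h : Commute C B) (t : ℝ) :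
    Commute C (expSemigroup B t) :=
  (h.neg_right.smul_right t).exp_right

variable [CompleteSpace H]

theorem expSemigroup_add (B : H →L[ℝ] H) (s t : ℝ) :
    expSemigroup B (s + t) = expSemigroup B s * expSemigroup B t := by
  let _ := NormedAlgebra.restrictScalars ℚ ℝ (H →L[ℝ] H)
  rw [expSemigroup, add_smul]
  exact NormedSpace.exp_add_of_commute (((Commute.refl (-B)).smul_left s).smul_right t)

theorem hasDerivAt_expSemigroup (B : H →L[ℝ] H) (f : H) (t : ℝ) :
    HasDerivAt (fun t => expSemigroup B t f) (-B (expSemigroup B t f)) t := by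
  have h := (hasDerivAt_exp_smul_const' (-B) t).clm_apply (hasDerivAt_const t f)
  simpa [expSemigroup] using h

variable {B : H →L[ℝ] H}

/-- The squared norm of an orbit `w` has derivative `-2 ⟨B w, w⟩ ≤ 0`. -/
theorem norm_expSemigroup_apply_le (hB : ∀ x, 0 ≤ ⟪B x, x⟫_ℝ) (f : H) {t : ℝ} (ht : 0 ≤ t) :
    ‖expSemigroup B t f‖ ≤ ‖f‖ := by
  have hd : ∀ t, HasDerivAt (fun t => ‖expSemigroup B t f‖ ^ 2)
      (2 * ⟪expSemigroup B t f, -B (expSemigroup B t f)⟫_ℝ) t :=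
    fun t => (hasDerivAt_expSemigroup B f t).norm_sq
  have h : Antitone fun t => ‖expSemigroup B t f‖ ^ 2 :=
    antitone_of_deriv_nonpos (fun t => (hd t).differentiableAt) fun t => by
      rw [(hd t).deriv, inner_neg_right, real_inner_comm]
      linarith [hB (expSemigroup B t f)]
  have h1 := h ht
  simp only [expSemigroup_zero, one_apply_eq_self] at h1
  exact (pow_le_pow_iff_left₀ (norm_nonneg _) (norm_nonneg _) two_ne_zero).mp h1

/-- The smoothing property of a self-adjoint semigroup, with a constant that does not depend on the
norm of the generator. -/
theorem norm_generator_expSemigroup_le (hB : ∀ x, 0 ≤ ⟪B x, x⟫_ℝ)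
    (hs : ∀ x y, ⟪B x, y⟫_ℝ = ⟪x, B y⟫_ℝ) (f : H) {t : ℝ} (ht : 0 < t) :
    ‖expSemigroup B t (B f)‖ ≤ ‖f‖ / t := by
  set w := fun t => expSemigroup B t f with hw
  have hw' : ∀ t, HasDerivAt w (-B (w t)) t := hasDerivAt_expSemigroup B f
  have hBw : ∀ t, HasDerivAt (fun t => B (w t)) (-B (B (w t))) t := fun t => by
    simpa using (hasDerivAt_const t B).clm_apply (hw' t)
  -- A Lyapunov function: the coefficients are chosen so that everything in the derivative cancels
  -- except `-4 t² ⟨B B w, B w⟩ ≤ 0`. At time `t` it dominates `t² ‖B w‖²`, at time `0` it is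
  -- `‖f‖²`.
  have hd : ∀ t, HasDerivAt
      (fun t => ‖w t‖ ^ 2 + 2 * t * ⟪B (w t), w t⟫_ℝ + 2 * t ^ 2 * ‖B (w t)‖ ^ 2)
      (-4 * t ^ 2 * ⟪B (B (w t)), B (w t)⟫_ℝ) t := by
    intro t
    have h1 := (hw' t).norm_sq
    have h2 := ((hasDerivAt_id t).const_mul 2).mul ((hBw t).inner ℝ (hw' t))
    have h3 := ((hasDerivAt_pow 2 t).const_mul 2).mul (hBw t).norm_sq
    convert! (h1.add h2).add h3 using 1
    simp only [inner_neg_right, inner_neg_left, hs (B (w t)) (w t), real_inner_self_eq_norm_sq,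
      real_inner_comm (B (w t)) (w t), real_inner_comm (B (w t)) (B (B (w t))), id]
    push_cast
    ring
  have h : Antitone fun t =>
      ‖w t‖ ^ 2 + 2 * t * ⟪B (w t), w t⟫_ℝ + 2 * t ^ 2 * ‖B (w t)‖ ^ 2 :=
    antitone_of_deriv_nonpos (fun t => (hd t).differentiableAt) fun t => by
      rw [(hd t).deriv]
      nlinarith [mul_nonneg (sq_nonneg t) (hB (B (w t)))]
  have h1 := h ht.le
  have h2 : expSemigroup B t (B f) = B (w t) :=
    (DFunLike.congr_fun ((Commute.refl B).expSemigroup_right t) f).symm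
  have h3 : w 0 = f := by simp [hw, expSemigroup_zero]
  simp only [h3, mul_zero, zero_mul, ne_eq, OfNat.ofNat_ne_zero, not_false_eq_true, zero_pow,
    add_zero] at h1
  have h4 : t ^ 2 * ‖B (w t)‖ ^ 2 ≤ ‖f‖ ^ 2 := by
    nlinarith [sq_nonneg ‖w t‖, mul_nonneg ht.le (hB (w t)), mul_nonneg (sq_nonneg t)
      (sq_nonneg ‖B (w t)‖)]
  rw [h2, le_div_iff₀ ht, mul_comm]
  refine (pow_le_pow_iff_left₀ (by positivity) (norm_nonneg _) two_ne_zero).mp ?_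
  rwa [mul_pow]

/-- Duhamel: interpolate by `s ↦ e^{-sB} e^{-(t-s)B'} f`. As the operators commute, its derivative
is a product of contractions applied to `-(B f - B' f)`. -/
theorem norm_expSemigroup_sub_le {B' : H →L[ℝ] H} (hB : ∀ x, 0 ≤ ⟪B x, x⟫_ℝ)
    (hB' : ∀ x, 0 ≤ ⟪B' x, x⟫_ℝ) (hc : Commute B B') (f : H) {t : ℝ} (ht : 0 ≤ t) :
    ‖expSemigroup B t f - expSemigroup B' t f‖ ≤ ‖B f - B' f‖ * t := by
  have hd : ∀ s ∈ Icc 0 t, HasDerivWithinAt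
      (fun s => expSemigroup B s (expSemigroup B' (t - s) f))
      (-(expSemigroup B s (expSemigroup B' (t - s) (B f - B' f)))) (Icc 0 t) s := by
    intro s _
    have h1 : HasDerivAt (fun s => expSemigroup B s) (expSemigroup B s * -B) s :=
      hasDerivAt_exp_smul_const (-B) s
    have h2 : HasDerivAt (fun s => expSemigroup B' (t - s) f)
        (B' (expSemigroup B' (t - s) f)) s := by
      have := (hasDerivAt_expSemigroup B' f (t - s)).scomp s ((hasDerivAt_id s).const_sub t)
      simpa [Function.comp_def] using this
    have h3 : ∀ g, expSemigroup B' (t - s) (B g) = B (expSemigroup B' (t - s) g) := fun g =>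
      (DFunLike.congr_fun (hc.expSemigroup_right (t - s)) g).symm
    have h4 : ∀ g, expSemigroup B' (t - s) (B' g) = B' (expSemigroup B' (t - s) g) := fun g =>
      (DFunLike.congr_fun ((Commute.refl B').expSemigroup_right (t - s)) g).symm
    refine ((h1.clm_apply h2).congr_deriv ?_).hasDerivWithinAt
    rw [map_sub, map_sub, h3, h4, mul_apply_eq_comp, neg_apply, map_neg]
    abel
  have h := norm_image_sub_le_of_norm_deriv_le_segment' hd (C := ‖B f - B' f‖) (fun s hs => by
    rw [norm_neg]
    exact (norm_expSemigroup_apply_le hB _ hs.1).trans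
      (norm_expSemigroup_apply_le hB' _ (sub_nonneg.mpr hs.2.le))) t ⟨ht, le_rfl⟩
  simpa [expSemigroup_zero] using h

theorem norm_expSemigroup_apply_sub_le (hB : ∀ x, 0 ≤ ⟪B x, x⟫_ℝ) (f : H) {t : ℝ} (ht : 0 ≤ t) :
    ‖expSemigroup B t f - f‖ ≤ ‖B f‖ * t := by
  have h := norm_expSemigroup_sub_le (B' := 0) hB (by simp) (Commute.zero_right B) f ht
  simpa [expSemigroup, NormedSpace.exp_zero] using h

/-- The mean value inequality for `s ↦ e^{-sB} f + s B f`, whose derivative is `-(e^{-sB} B f - B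
f)`. -/
theorem norm_expSemigroup_taylor_le {f : H} {t c : ℝ} (ht : 0 ≤ t)
    (hc : ∀ s, 0 ≤ s → s ≤ t → ‖expSemigroup B s (B f) - B f‖ ≤ c) :
    ‖expSemigroup B t f - f + t • B f‖ ≤ c * t := by
  have hd : ∀ s ∈ Icc 0 t, HasDerivWithinAt (fun s => expSemigroup B s f + s • B f)
      (-(expSemigroup B s (B f) - B f)) (Icc 0 t) s := by
    intro s _
    have h1 := (hasDerivAt_expSemigroup B f s).add ((hasDerivAt_id s).smul_const (B f))
    refine (h1.congr_deriv ?_).hasDerivWithinAt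
    have h2 : expSemigroup B s (B f) = B (expSemigroup B s f) :=
      (DFunLike.congr_fun ((Commute.refl B).expSemigroup_right s) f).symm
    rw [h2, one_smul]
    abel
  have h := norm_image_sub_le_of_norm_deriv_le_segment' hd (C := c)
    (fun s hs => by rw [norm_neg]; exact hc s hs.1 hs.2.le) t ⟨ht, le_rfl⟩
  simp only [expSemigroup_zero, one_apply_eq_self, zero_smul, add_zero, sub_zero] at h
  rwa [sub_add_eq_add_sub]

end BoundedGenerator

/-! ### From the resolvent of a nonnegative self-adjoint operator to its semigroup -/

/-- `R` is the resolvent `(1 + A)⁻¹` of a nonnegative self-adjoint operator `A` in a Hilbert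
space. -/
structure IsResolvent {H : Type*} [NormedAddCommGroup H] [InnerProductSpace ℝ H]
    (R : H →L[ℝ] H) : Prop where
  symm : ∀ x y, ⟪R x, y⟫_ℝ = ⟪x, R y⟫_ℝ
  sq_le : ∀ x, ‖R x‖ ^ 2 ≤ ⟪R x, x⟫_ℝ
  inj : ∀ x, R x = 0 → x = 0

/-- `T` is the semigroup `e^{-tA}` on a Hilbert space, where `A ≥ 0` is the self-adjoint operator
with resolvent `R = (1 + A)⁻¹`. -/
structure IsResolventSemigroup {H : Type*} [NormedAddCommGroup H] [InnerProductSpace ℝ H]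
    (R : H →L[ℝ] H) (T : ℝ → H →L[ℝ] H) : Prop where
  zero : T 0 = 1
  add : ∀ s ≥ 0, ∀ t ≥ 0, T (s + t) = T s * T t
  norm_le : ∀ t ≥ 0, ∀ f, ‖T t f‖ ≤ ‖f‖
  comm : ∀ t ≥ 0, ∀ f, T t (R f) = R (T t f)
  tendsto_deriv : ∀ f, Tendsto (fun t => t⁻¹ • (T t (R f) - R f)) (𝓝[>] 0) (𝓝 (R f - f))
  exists_eq : ∀ t > 0, ∀ f, ∃ g, T t f = R g

namespace IsResolvent

variable {H : Type*} [NormedAddCommGroup H] [InnerProductSpace ℝ H] {R : H →L[ℝ] H}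

/-- The gap `⟨R x, x⟩ - ‖R x‖²` is unchanged when `R` is replaced by `1 - R`, so `1 - R` is a
positive contraction too. -/
theorem norm_one_sub_sq_le (hR : IsResolvent R) (x : H) : ‖(1 - R) x‖ ^ 2 ≤ ⟪(1 - R) x, x⟫_ℝ := by
  have h := hR.sq_le x
  simp only [sub_apply, one_apply_eq_self]
  rw [norm_sub_sq_real, inner_sub_left, real_inner_self_eq_norm_sq, real_inner_comm]
  linarith

theorem symm_pow (hR : IsResolvent R) (n : ℕ) (x y : H) : ⟪((1 - R : H →L[ℝ] H) ^ n) x, y⟫_ℝ = ⟪x, ((1 - R : H →L[ℝ] H) ^ n) y⟫_ℝ := by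
  induction n generalizing x y with
  | zero => simp
  | succ n ih =>
    rw [pow_succ, mul_apply_eq_comp, ih, ← pow_succ, pow_succ',
      mul_apply_eq_comp]
    simp [inner_sub_left, inner_sub_right, hR.symm]

/-- By symmetry an even power gives a squared norm and an odd power gives the form of `1 - R` at a
half power. -/
theorem inner_pow_nonneg (hR : IsResolvent R) (n : ℕ) (x : H) : 0 ≤ ⟪((1 - R : H →L[ℝ] H) ^ n) x, x⟫_ℝ := by
  obtain ⟨m, rfl | rfl⟩ := n.even_or_odd'
  · rw [two_mul, pow_add, mul_apply_eq_comp, hR.symm_pow, real_inner_self_eq_norm_sq]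
    positivity
  · rw [show 2 * m + 1 = m + 1 + m by ring, pow_add, mul_apply_eq_comp, pow_succ,
      mul_apply_eq_comp, hR.symm_pow]
    exact (sq_nonneg _).trans (hR.norm_one_sub_sq_le _)

theorem antitone_norm_pow (hR : IsResolvent R) (x : H) : Antitone fun n => ‖((1 - R : H →L[ℝ] H) ^ n) x‖ := by
  refine antitone_nat_of_succ_le fun n => ?_
  rw [pow_succ', mul_apply_eq_comp]
  have h1 := (hR.norm_one_sub_sq_le (((1 - R : H →L[ℝ] H) ^ n) x)).trans (real_inner_le_norm _ _)
  rcases (norm_nonneg ((1 - R) (((1 - R : H →L[ℝ] H) ^ n) x))).eq_or_lt with h | h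
  · rw [← h]
    exact norm_nonneg _
  · nlinarith

/-- As `R = 1 - (1 - R)`, the vector is a difference of consecutive iterates. Its squared norm is at
most the drop of `‖(1 - R)^n x‖²`, which tends to zero along a decreasing nonnegative sequence. -/
theorem tendsto_pow_range (hR : IsResolvent R) (x : H) : Tendsto (fun n => ((1 - R : H →L[ℝ] H) ^ n) (R x)) atTop (𝓝 0) := by
  have hlim : ∃ l, Tendsto (fun n => ‖((1 - R : H →L[ℝ] H) ^ n) x‖ ^ 2) atTop (𝓝 l) := by
    have h := tendsto_atTop_ciInf (hR.antitone_norm_pow x) ⟨0, by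
      rintro _ ⟨n, rfl⟩
      exact norm_nonneg _⟩
    exact ⟨_, h.pow 2⟩
  obtain ⟨l, hl⟩ := hlim
  have h1 := hl.sub (hl.comp (tendsto_add_atTop_nat 1))
  rw [sub_self] at h1
  have h2 : ∀ n, ‖((1 - R : H →L[ℝ] H) ^ n) (R x)‖ ^ 2 ≤
      ‖((1 - R : H →L[ℝ] H) ^ n) x‖ ^ 2 - ‖((1 - R : H →L[ℝ] H) ^ (n + 1)) x‖ ^ 2 := by
    intro n
    have h3 : ((1 - R : H →L[ℝ] H) ^ n) (R x) = ((1 - R : H →L[ℝ] H) ^ n) x - ((1 - R : H →L[ℝ] H) ^ (n + 1)) x := by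
      rw [pow_succ, mul_apply_eq_comp, ← map_sub]
      simp
    have h4 := hR.norm_one_sub_sq_le (((1 - R : H →L[ℝ] H) ^ n) x)
    rw [← mul_apply_eq_comp, ← pow_succ'] at h4
    rw [h3, norm_sub_sq_real, real_inner_comm]
    linarith
  have h5 := squeeze_zero (fun n => sq_nonneg _) h2 h1
  rw [tendsto_zero_iff_norm_tendsto_zero]
  have h6 := (Real.continuous_sqrt.tendsto 0).comp h5
  simpa [Function.comp_def, Real.sqrt_sq] using h6

variable [CompleteSpace H]

/-- If `x` is orthogonal to the range, then `0 = ⟨R R x, x⟩ = ‖R x‖²`, and `R` is injective. -/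
theorem denseRange (hR : IsResolvent R) : DenseRange R := by
  have h : (LinearMap.range (R : H →ₗ[ℝ] H)).topologicalClosure = ⊤ := by
    rw [Submodule.topologicalClosure_eq_top_iff, Submodule.eq_bot_iff]
    intro x hx
    rw [Submodule.mem_orthogonal] at hx
    refine hR.inj x ?_
    have := hx (R (R x)) ⟨R x, rfl⟩
    rwa [hR.symm, real_inner_self_eq_norm_sq, sq_eq_zero_iff, norm_eq_zero] at this
  have h2 := Submodule.dense_iff_topologicalClosure_eq_top.mpr h
  rwa [LinearMap.coe_range] at h2

theorem exists_norm_sub_lt (hR : IsResolvent R) (f : H) {ε : ℝ} (hε : 0 < ε) : ∃ y, ‖f - R y‖ < ε := by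
  obtain ⟨y, hy⟩ := hR.denseRange.exists_dist_lt f hε
  exact ⟨y, by rwa [← dist_eq_norm]⟩

theorem tendsto_pow (hR : IsResolvent R) (x : H) : Tendsto (fun n => ((1 - R : H →L[ℝ] H) ^ n) x) atTop (𝓝 0) := by
  rw [NormedAddCommGroup.tendsto_atTop]
  intro ε hε
  obtain ⟨y, hy⟩ := hR.exists_norm_sub_lt x (half_pos hε)
  obtain ⟨N, hN⟩ := NormedAddCommGroup.tendsto_atTop.mp (hR.tendsto_pow_range y) (ε / 2) (half_pos hε)
  refine ⟨N, fun n hn => ?_⟩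
  have h1 := hN n hn
  have h2 := hR.antitone_norm_pow (x - R y) (Nat.zero_le n)
  simp only [pow_zero, one_apply_eq_self, map_sub] at h2
  rw [sub_zero] at h1 ⊢
  have h3 := norm_sub_norm_le (((1 - R : H →L[ℝ] H) ^ n) x) (((1 - R : H →L[ℝ] H) ^ n) (R y))
  linarith

end IsResolvent

namespace IsResolvent

variable {H : Type*} [NormedAddCommGroup H] [InnerProductSpace ℝ H] {R : H →L[ℝ] H}

/-- Bounded approximations of the operator `A = R⁻¹ - 1`, the partial sums of
`A = ∑ₖ (1 - R) ^ (k + 1)`. -/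
noncomputable def approx (R : H →L[ℝ] H) (n : ℕ) : H →L[ℝ] H :=
  ∑ k ∈ Finset.range n, (1 - R) ^ (k + 1)

theorem commute_pow_right (k : ℕ) : Commute R ((1 - R) ^ k) :=
  ((Commute.one_right R).sub_right (Commute.refl R)).pow_right k

theorem commute_approx (n : ℕ) : Commute R (approx R n) :=
  Commute.sum_right _ _ _ fun k _ => commute_pow_right (k + 1)

theorem commute_approx_approx (m n : ℕ) : Commute (approx R m) (approx R n) :=
  Commute.sum_left _ _ _ fun _ _ => Commute.sum_right _ _ _ fun _ _ =>
    (Commute.refl (1 - R)).pow_pow _ _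

theorem approx_nonneg (hR : IsResolvent R) (n : ℕ) (x : H) : 0 ≤ ⟪approx R n x, x⟫_ℝ := by
  rw [approx, sum_apply, sum_inner]
  exact Finset.sum_nonneg fun k _ => hR.inner_pow_nonneg _ x

theorem approx_symm (hR : IsResolvent R) (n : ℕ) (x y : H) :
    ⟪approx R n x, y⟫_ℝ = ⟪x, approx R n y⟫_ℝ := by
  rw [approx, sum_apply, sum_apply, sum_inner, inner_sum]
  exact Finset.sum_congr rfl fun k _ => hR.symm_pow _ x y

/-- The sum telescopes after multiplication by `R = 1 - (1 - R)`; hence `approx R n` converges to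
`A` on its domain, where `A (R x) = x - R x`. -/
theorem approx_apply_range (n : ℕ) (x : H) :
    approx R n (R x) = x - R x - ((1 - R : H →L[ℝ] H) ^ n) (x - R x) := by
  induction n with
  | zero => simp [approx]
  | succ n ih =>
    have h1 : approx R (n + 1) (R x) = approx R n (R x) + ((1 - R : H →L[ℝ] H) ^ (n + 1)) (R x) := by
      rw [approx, Finset.sum_range_succ]
      rfl
    have h2 : ((1 - R : H →L[ℝ] H) ^ n) (x - R x) = ((1 - R : H →L[ℝ] H) ^ (n + 1)) x := by
      rw [pow_succ, mul_apply_eq_comp]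
      simp
    rw [h1, ih, h2, map_sub]
    abel

variable [CompleteSpace H]

theorem tendsto_approx (hR : IsResolvent R) (x : H) :
    Tendsto (fun n => approx R n (R x)) atTop (𝓝 (x - R x)) := by
  simp only [approx_apply_range]
  simpa using (tendsto_const_nhds (x := x - R x)).sub (hR.tendsto_pow (x - R x))

/-- On the range of `R` the Duhamel bound `norm_expSemigroup_sub_le` gives a Cauchy sequence;
contractivity and density extend this to every `f`. -/
theorem exists_tendsto_expSemigroup (hR : IsResolvent R) {t : ℝ} (ht : 0 ≤ t) (f : H) :
    ∃ g, Tendsto (fun n => expSemigroup (approx R n) t f) atTop (𝓝 g) := by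
  refine cauchySeq_tendsto_of_complete (Metric.cauchySeq_iff'.mpr fun ε hε => ?_)
  obtain ⟨y, hy⟩ := hR.exists_norm_sub_lt f (ε := ε / 4) (by positivity)
  obtain ⟨N, hN⟩ := Metric.cauchySeq_iff'.mp (hR.tendsto_approx y).cauchySeq
    (ε / (2 * (t + 1))) (by positivity)
  refine ⟨N, fun n hn => ?_⟩
  have h1 := hN n hn
  rw [dist_eq_norm] at h1 ⊢
  have h2 := norm_expSemigroup_sub_le (hR.approx_nonneg n) (hR.approx_nonneg N)
    (commute_approx_approx n N) (R y) ht
  have h3 := norm_expSemigroup_apply_le (hR.approx_nonneg n) (f - R y) ht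
  have h4 := norm_expSemigroup_apply_le (hR.approx_nonneg N) (f - R y) ht
  have h5 : ‖approx R n (R y) - approx R N (R y)‖ * t ≤ ε / 2 := by
    calc _ ≤ ε / (2 * (t + 1)) * (t + 1) := by gcongr; linarith
      _ = ε / 2 := by field_simp
  have h6 : expSemigroup (approx R n) t f - expSemigroup (approx R N) t f =
      (expSemigroup (approx R n) t (R y) - expSemigroup (approx R N) t (R y)) +
      expSemigroup (approx R n) t (f - R y) - expSemigroup (approx R N) t (f - R y) := by
    simp only [map_sub]
    abel
  rw [h6]
  refine (norm_sub_le _ _).trans_lt ?_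
  have := norm_add_le (expSemigroup (approx R n) t (R y) - expSemigroup (approx R N) t (R y))
    (expSemigroup (approx R n) t (f - R y))
  linarith

/-- The first order Taylor estimate, uniform in the approximation. -/
theorem norm_taylor_le (hR : IsResolvent R) {t : ℝ} (ht : 0 ≤ t) (f g : H) (n : ℕ) :
    ‖expSemigroup (approx R n) t f - f + t • approx R n f‖ ≤
      (t * ‖approx R n g‖ + 2 * ‖approx R n f - g‖) * t := by
  refine norm_expSemigroup_taylor_le ht fun s hs hst => ?_
  have h1 := norm_expSemigroup_apply_sub_le (hR.approx_nonneg n) g hs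
  have h2 := norm_expSemigroup_apply_le (hR.approx_nonneg n) (approx R n f - g) hs
  -- `g` stands in for `approx R n f`, whose image under the generator need not stay bounded in `n`;
  -- for `g` in the range of `R` it does.
  have h3 : expSemigroup (approx R n) s (approx R n f) - approx R n f =
      (expSemigroup (approx R n) s g - g) + expSemigroup (approx R n) s (approx R n f - g)
        - (approx R n f - g) := by
    rw [map_sub]
    abel
  rw [h3]
  refine (norm_sub_le _ _).trans ?_
  have h4 := norm_add_le (expSemigroup (approx R n) s g - g)
    (expSemigroup (approx R n) s (approx R n f - g))
  have h5 : ‖approx R n g‖ * s ≤ t * ‖approx R n g‖ := by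
    rw [mul_comm]
    gcongr
  linarith

/-- A nonnegative self-adjoint operator generates a contraction semigroup, which maps into the
domain of the generator. -/
theorem exists_semigroup (hR : IsResolvent R) : ∃ T, IsResolventSemigroup R T := by
  have hex : ∀ t : ℝ, ∃ S : H →L[ℝ] H, 0 ≤ t → ∀ f,
      Tendsto (fun n => expSemigroup (approx R n) t f) atTop (𝓝 (S f)) := by
    intro t
    by_cases ht : 0 ≤ t
    · choose S hS using hR.exists_tendsto_expSemigroup ht
      exact ⟨continuousLinearMapOfTendsto (fun n => expSemigroup (approx R n) t)
        (tendsto_pi_nhds.mpr hS), fun _ => hS⟩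
    -- The value at negative times is arbitrary: the semigroup properties concern only `t ≥ 0`.
    · exact ⟨1, fun h => absurd h ht⟩
  choose T hT using hex
  have hnorm : ∀ t ≥ 0, ∀ f, ‖T t f‖ ≤ ‖f‖ := fun t ht f =>
    le_of_tendsto (hT t ht f).norm
      (Eventually.of_forall fun n => norm_expSemigroup_apply_le (hR.approx_nonneg n) f ht)
  have hcomm : ∀ t ≥ 0, ∀ f, T t (R f) = R (T t f) := fun t ht f => by
    refine tendsto_nhds_unique (hT t ht (R f)) ?_
    refine ((R.continuous.tendsto _).comp (hT t ht f)).congr fun n => ?_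
    exact DFunLike.congr_fun ((commute_approx n).expSemigroup_right t) f
  refine ⟨T, ?_, ?_, hnorm, hcomm, ?_, ?_⟩
  · ext f
    refine tendsto_nhds_unique (hT 0 le_rfl f) ?_
    simp only [expSemigroup_zero]
    exact tendsto_const_nhds
  · intro s hs t ht
    ext f
    refine tendsto_nhds_unique (hT (s + t) (add_nonneg hs ht) f) ?_
    simp only [expSemigroup_add, mul_apply_eq_comp]
    have h1 : Tendsto (fun n => expSemigroup (approx R n) s
        (expSemigroup (approx R n) t f - T t f)) atTop (𝓝 0) := by
      refine squeeze_zero_norm (fun n => norm_expSemigroup_apply_le (hR.approx_nonneg n) _ hs) ?_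
      have := ((hT t ht f).sub_const (T t f)).norm
      rwa [sub_self, norm_zero] at this
    have h2 := h1.add (hT s hs (T t f))
    rw [zero_add] at h2
    refine h2.congr fun n => ?_
    rw [map_sub, sub_add_cancel]
  · intro f
    set k := f - R f with hk
    have hest : ∀ z, ∀ t ≥ 0, ‖T t (R f) - R f + t • k‖ ≤
        (t * ‖z - R z‖ + 2 * ‖k - R z‖) * t := fun z t ht => by
      have h1 := hR.tendsto_approx f
      have h2 := hR.tendsto_approx z
      refine le_of_tendsto_of_tendsto (((hT t ht (R f)).sub_const (R f)).add (h1.const_smul t)).norm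
        (((h2.norm.const_mul t).add ((h1.sub_const (R z)).norm.const_mul 2)).mul_const t)
        (Eventually.of_forall fun n => hR.norm_taylor_le ht (R f) (R z) n)
    rw [← neg_sub, ← hk, Metric.tendsto_nhds]
    intro ε hε
    -- `k = A R f` may lie outside the domain, so it is approximated by `R z`; the error is absorbed
    -- by `ε`, and the term with `z - R z = A R z` is small for small `t`.
    obtain ⟨z, hz⟩ := hR.exists_norm_sub_lt k (ε := ε / 4) (by positivity)
    have hδ : 0 < ε / (2 * (‖z - R z‖ + 1)) := by positivity
    filter_upwards [Ioo_mem_nhdsGT hδ] with t ht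
    have ht0 : 0 < t := ht.1
    have h1 : t⁻¹ • (T t (R f) - R f) - -k = t⁻¹ • (T t (R f) - R f + t • k) := by
      rw [smul_add, smul_smul, inv_mul_cancel₀ ht0.ne', one_smul, sub_neg_eq_add]
    rw [dist_eq_norm, h1, norm_smul, norm_inv, Real.norm_of_nonneg ht0.le, inv_mul_lt_iff₀ ht0]
    refine (hest z t ht0.le).trans_lt ?_
    rw [mul_comm]
    refine mul_lt_mul_of_pos_left ?_ ht0
    have h2 : t * ‖z - R z‖ ≤ ε / 2 := by
      calc t * ‖z - R z‖ ≤ ε / (2 * (‖z - R z‖ + 1)) * (‖z - R z‖ + 1) := by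
            gcongr
            · exact ht.2.le
            · linarith
        _ = ε / 2 := by field_simp
    linarith
  · intro t ht f
    -- The limit of the uniform smoothing estimate: `‖T t A R y‖ ≤ ‖R y‖ / t`.
    have hsm : ∀ y, ‖T t (y - R y)‖ ≤ ‖R y‖ / t := fun y => by
      have h1 : Tendsto (fun n => expSemigroup (approx R n) t (approx R n (R y) - (y - R y)))
          atTop (𝓝 0) := by
        refine squeeze_zero_norm
          (fun n => norm_expSemigroup_apply_le (hR.approx_nonneg n) _ ht.le) ?_
        have := ((hR.tendsto_approx y).sub_const (y - R y)).norm
        rwa [sub_self, norm_zero] at this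
      have h2 := (h1.add (hT t ht.le (y - R y))).norm
      rw [zero_add] at h2
      refine le_of_tendsto h2 (Eventually.of_forall fun n => ?_)
      rw [map_sub, sub_add_cancel]
      exact norm_generator_expSemigroup_le (hR.approx_nonneg n) (hR.approx_symm n) (R y) ht
    have hex : ∀ n : ℕ, ∃ y, ‖f - R y‖ < 1 / ((n : ℝ) + 1) := fun n =>
      hR.exists_norm_sub_lt f (by positivity)
    choose y hy using hex
    have hy' : Tendsto (fun n => R (y n)) atTop (𝓝 f) := by
      rw [tendsto_iff_norm_sub_tendsto_zero]
      refine squeeze_zero (fun n => norm_nonneg _) (fun n => ?_)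
        tendsto_one_div_add_atTop_nhds_zero_nat
      rw [norm_sub_rev]
      exact (hy n).le
    -- By smoothing, `T t A` extends from the domain to `f = lim R (y n)`. The limit `g` plays the
    -- role of `A T t f`, whence `T t f = R (g + T t f)`.
    have hc : CauchySeq fun n => T t (y n - R (y n)) := by
      refine Metric.cauchySeq_iff'.mpr fun ε hε => ?_
      obtain ⟨N, hN⟩ := Metric.cauchySeq_iff'.mp hy'.cauchySeq (ε * t) (by positivity)
      refine ⟨N, fun n hn => ?_⟩
      have h1 := hN n hn
      have h2 := hsm (y n - y N)
      rw [dist_eq_norm] at h1 ⊢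
      rw [← map_sub, sub_sub_sub_comm, ← map_sub]
      refine h2.trans_lt ?_
      rwa [map_sub, div_lt_iff₀ ht]
    obtain ⟨g, hg⟩ := cauchySeq_tendsto_of_complete hc
    refine ⟨g + T t f, ?_⟩
    have h1 : Tendsto (fun n => R (T t (y n - R (y n)))) atTop (𝓝 (R g)) :=
      (R.continuous.tendsto g).comp hg
    have h2 : Tendsto (fun n => T t (R (y n)) - R (T t (R (y n)))) atTop
        (𝓝 (T t f - R (T t f))) := by
      have := ((T t).continuous.tendsto f).comp hy'
      exact this.sub ((R.continuous.tendsto _).comp this)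
    have h3 : R g = T t f - R (T t f) := by
      refine tendsto_nhds_unique h1 (h2.congr fun n => ?_)
      rw [map_sub, map_sub, ← hcomm t ht.le, ← hcomm t ht.le]
    rw [map_add, h3, sub_add_cancel]

end IsResolvent

/-! ### Regularity of orbits of strongly continuous semigroups -/

section Semigroup

variable {H : Type*} [NormedAddCommGroup H] [NormedSpace ℝ H] {S : ℝ → H →L[ℝ] H}

/-- Orbits of a locally bounded strongly continuous semigroup are continuous. -/
theorem continuousOn_semigroup (hzero : S 0 = 1)
    (hadd : ∀ s ≥ 0, ∀ t ≥ 0, S (s + t) = S s * S t)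
    (hlim : ∀ f, Tendsto (fun t => S t f) (𝓝[>] 0) (𝓝 f)) {D : Set ℝ} (hD : D ⊆ Ici 0)
    {C : ℝ} (hC : ∀ t ∈ D, ∀ f, ‖S t f‖ ≤ C * ‖f‖)
    (f : H) : ContinuousOn (fun t => S t f) D := by
  -- Only the smaller of the two times enters through its operator bound, so one estimate yields
  -- continuity from both sides.
  have hle : ∀ s ∈ D, ∀ t ≥ s, ‖S t f - S s f‖ ≤ |C| * ‖S (t - s) f - f‖ := fun s hs t ht => by
    have h1 : S t f = S s (S (t - s) f) := by
      rw [← mul_apply_eq_comp, ← hadd s (hD hs) (t - s) (sub_nonneg.mpr ht), add_sub_cancel]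
    rw [h1, ← map_sub]
    exact (hC s hs _).trans (mul_le_mul_of_nonneg_right (le_abs_self C) (norm_nonneg _))
  rw [Metric.continuousOn_iff]
  intro t ht ε hε
  obtain ⟨δ, hδ, h⟩ := Metric.mem_nhdsWithin_iff.mp
    (Metric.tendsto_nhds.mp (hlim f) (ε / (|C| + 1)) (by positivity))
  have h' : ∀ r, 0 ≤ r → r < δ → |C| * ‖S r f - f‖ < ε := fun r hr hrδ => by
    rcases hr.eq_or_lt with rfl | hr
    · simpa [hzero] using hε
    · have h2 : ‖S r f - f‖ < ε / (|C| + 1) := by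
        rw [← dist_eq_norm]
        exact h ⟨by rwa [Metric.mem_ball, Real.dist_eq, sub_zero, abs_of_pos hr], hr⟩
      rw [lt_div_iff₀ (by positivity)] at h2
      nlinarith [norm_nonneg (S r f - f)]
  refine ⟨δ, hδ, fun s hs hst => ?_⟩
  rw [Real.dist_eq] at hst
  rcases le_total s t with h1 | h1
  · rw [dist_comm, dist_eq_norm]
    exact (hle s hs t h1).trans_lt
      (h' _ (sub_nonneg.mpr h1) ((le_abs_self _).trans_lt (by rwa [abs_sub_comm])))
  · rw [dist_eq_norm]
    exact (hle t ht s h1).trans_lt (h' _ (sub_nonneg.mpr h1) ((le_abs_self _).trans_lt hst))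

/-- Orbits of a semigroup that are differentiable from the right at `0` are so everywhere. -/
theorem hasDerivWithinAt_semigroup (hadd : ∀ s ≥ 0, ∀ t ≥ 0, S (s + t) = S s * S t) {f k : H}
    (hlim : Tendsto (fun t => t⁻¹ • (S t f - f)) (𝓝[>] 0) (𝓝 k)) {s : ℝ} (hs : 0 ≤ s) :
    HasDerivWithinAt (fun t => S t f) (S s k) (Ioi s) s := by
  rw [hasDerivWithinAt_iff_tendsto_slope' (self_notMem_Ioi)]
  have h1 : Tendsto (fun r => r - s) (𝓝[>] s) (𝓝[>] 0) := by
    refine tendsto_nhdsWithin_of_tendsto_nhds_of_eventually_within _ ?_ ?_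
    · have : Tendsto (fun r => r - s) (𝓝 s) (𝓝 (s - s)) := tendsto_id.sub_const s
      rw [sub_self] at this
      exact this.mono_left nhdsWithin_le_nhds
    · filter_upwards [self_mem_nhdsWithin] with r hr
      exact sub_pos.mpr (mem_Ioi.mp hr)
  refine ((((S s).continuous.tendsto _).comp hlim).comp h1).congr' ?_
  filter_upwards [self_mem_nhdsWithin] with r hr
  have h2 : S r f = S s (S (r - s) f) := by
    rw [← mul_apply_eq_comp, ← hadd s hs (r - s) (sub_nonneg.mpr (le_of_lt hr)), add_sub_cancel]
  rw [slope_def_module, h2, ← map_sub, ← map_smul]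
  rfl

/-- A strongly continuous semigroup is bounded on a neighborhood of `0`. -/
theorem exists_bound_semigroup [CompleteSpace H] (hzero : S 0 = 1)
    (hlim : ∀ f, Tendsto (fun t => S t f) (𝓝[>] 0) (𝓝 f)) :
    ∃ δ > 0, ∃ C, ∀ t ∈ Icc 0 δ, ‖S t‖ ≤ C := by
  by_contra! hcon
  have h1 : ∀ n : ℕ, ∃ t ∈ Icc 0 (1 / ((n : ℝ) + 1)), (n : ℝ) < ‖S t‖ := fun n =>
    hcon _ (by positivity) n
  choose t ht htn using h1
  have ht0 : Tendsto t atTop (𝓝[≥] 0) := by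
    refine tendsto_nhdsWithin_of_tendsto_nhds_of_eventually_within _ ?_
      (Eventually.of_forall fun n => (ht n).1)
    exact squeeze_zero (fun n => (ht n).1) (fun n => (ht n).2)
      tendsto_one_div_add_atTop_nhds_zero_nat
  have hlim' : ∀ f, Tendsto (fun t => S t f) (𝓝[≥] 0) (𝓝 f) := fun f => by
    rw [← Ioi_insert, nhdsWithin_insert, tendsto_sup]
    refine ⟨?_, hlim f⟩
    rw [tendsto_pure_left]
    intro U hU
    rw [hzero]
    exact mem_of_mem_nhds hU
  -- Along `t n → 0` every orbit converges, hence is bounded, whereas the operator norms exceed `n`.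
  obtain ⟨C, hC⟩ := banach_steinhaus (g := fun n => S (t n)) fun f => by
    obtain ⟨C, hC⟩ := ((hlim' f).comp ht0).norm.bddAbove_range
    exact ⟨C, fun n => hC ⟨n, rfl⟩⟩
  obtain ⟨n, hn⟩ := exists_nat_gt C
  exact absurd (hC n) (not_le.mpr (hn.trans (htn n)))

end Semigroup

namespace IsResolventSemigroup

variable {H : Type*} [NormedAddCommGroup H] [InnerProductSpace ℝ H]
  {R : H →L[ℝ] H} {T : ℝ → H →L[ℝ] H}

theorem apply_add (hT : IsResolventSemigroup R T) {s t : ℝ} (hs : 0 ≤ s) (ht : 0 ≤ t) (f : H) :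
    T (s + t) f = T s (T t f) := by
  rw [hT.add s hs t ht, mul_apply_eq_comp]

variable [CompleteSpace H]

theorem tendsto_zero (hT : IsResolventSemigroup R T) (hR : IsResolvent R) (f : H) :
    Tendsto (fun t => T t f) (𝓝[>] 0) (𝓝 f) := by
  have h1 : ∀ y, Tendsto (fun t => T t (R y)) (𝓝[>] 0) (𝓝 (R y)) := fun y => by
    have h2 : Tendsto (fun t : ℝ => t) (𝓝[>] 0) (𝓝 0) := nhdsWithin_le_nhds
    have h3 := (h2.smul (hT.tendsto_deriv y)).add_const (R y)
    rw [zero_smul, zero_add] at h3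
    refine h3.congr' ?_
    filter_upwards [self_mem_nhdsWithin] with t ht
    rw [smul_smul, mul_inv_cancel₀ (ne_of_gt ht), one_smul, sub_add_cancel]
  rw [Metric.tendsto_nhds]
  intro ε hε
  obtain ⟨y, hy⟩ := hR.exists_norm_sub_lt f (ε := ε / 3) (by positivity)
  filter_upwards [Metric.tendsto_nhds.mp (h1 y) (ε / 3) (by positivity), self_mem_nhdsWithin]
    with t h2 h3
  have h4 := hT.norm_le t (le_of_lt h3) (f - R y)
  rw [dist_eq_norm] at h2 ⊢
  have h5 : T t f - f = T t (f - R y) + (T t (R y) - R y) - (f - R y) := by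
    rw [map_sub]
    abel
  rw [h5]
  refine (norm_sub_le _ _).trans_lt ?_
  have := norm_add_le (T t (f - R y)) (T t (R y) - R y)
  linarith

theorem continuousOn (hT : IsResolventSemigroup R T) (hR : IsResolvent R) (f : H) :
    ContinuousOn (fun t => T t f) (Ici 0) :=
  continuousOn_semigroup hT.zero hT.add (hT.tendsto_zero hR) (fun _ ht => ht)
    (fun t ht f => (hT.norm_le t ht f).trans_eq (one_mul _).symm) f

/-- Orbits in the domain of the generator are differentiable. -/
theorem hasDerivAt_range (hT : IsResolventSemigroup R T) (hR : IsResolvent R) (y : H) {t : ℝ}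
    (ht : 0 < t) : HasDerivAt (fun t => T t (R y)) (T t (R y - y)) t := by
  have hc := hT.continuousOn hR (R y)
  have hc' := hT.continuousOn hR (R y - y)
  have hright : ∀ s ≥ 0, HasDerivWithinAt (fun t => T t (R y)) (T s (R y - y)) (Ioi s) s :=
    fun s hs => hasDerivWithinAt_semigroup hT.add (hT.tendsto_deriv y) hs
  -- The right derivative is continuous, so the orbit is its integral; differentiating the integral
  -- gives a two-sided derivative.
  have hint : ∀ r ≥ 0, T r (R y) = (∫ s in (0 : ℝ)..r, T s (R y - y)) + T 0 (R y) := by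
    intro r hr
    have hsub : uIcc 0 r ⊆ Ici 0 := by
      rw [uIcc_of_le hr]
      exact Icc_subset_Ici_self
    rw [intervalIntegral.integral_eq_sub_of_hasDeriv_right (hc.mono hsub)
      (fun s hs => hright s (by rw [min_eq_left hr] at hs; exact hs.1.le))
      (hc'.mono hsub).intervalIntegrable, sub_add_cancel]
  have hnhds : Ici (0 : ℝ) ∈ 𝓝 t := Ici_mem_nhds ht
  have hd : HasDerivAt (fun r => (∫ s in (0 : ℝ)..r, T s (R y - y)) + T 0 (R y))
      (T t (R y - y)) t := by
    refine (intervalIntegral.integral_hasDerivAt_right ?_ ?_ (hc'.continuousAt hnhds)).add_const _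
    · refine (hc'.mono ?_).intervalIntegrable
      rw [uIcc_of_le ht.le]
      exact Icc_subset_Ici_self
    · exact (hc'.mono Ioi_subset_Ici_self).stronglyMeasurableAtFilter isOpen_Ioi t ht
  refine hd.congr_of_eventuallyEq ?_
  filter_upwards [hnhds] with r hr using hint r hr

/-- For positive times, an orbit is the image under `R` of a continuously differentiable curve. -/
theorem exists_eq_comp (hT : IsResolventSemigroup R T) (hR : IsResolvent R) (f : H) {ε : ℝ}
    (hε : 0 < ε) : ∃ z z' : ℝ → H, (∀ t > ε, HasDerivAt z (z' t) t) ∧ ContinuousOn z' (Ioi ε) ∧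
      (∀ t > ε, T t f = R (z t)) := by
  -- Smoothing is used twice: the first half step puts the orbit in the range of `R`, the second
  -- makes the preimage under `R` differentiable.
  obtain ⟨y, hy⟩ := hT.exists_eq (ε / 2) (half_pos hε) f
  obtain ⟨x, hx⟩ := hT.exists_eq (ε / 2) (half_pos hε) y
  refine ⟨fun t => T (t - ε) (R x), fun t => T (t - ε) (R x - x), fun t ht => ?_, ?_, ?_⟩
  · exact (hT.hasDerivAt_range hR x (sub_pos.mpr ht)).comp_sub_const t ε
  · exact (hT.continuousOn hR (R x - x)).comp (continuous_sub_right ε).continuousOn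
      fun t ht => mem_Ici.mpr (sub_nonneg.mpr (le_of_lt (mem_Ioi.mp ht)))
  · intro t ht
    have h1 : T t f = T (t - ε) (T (ε / 2) (T (ε / 2) f)) := by
      rw [← hT.apply_add (sub_nonneg.mpr (le_of_lt ht)) (by positivity),
        ← hT.apply_add (by linarith) (by positivity), add_assoc, add_halves, sub_add_cancel]
    rw [h1, hy, hT.comm _ (by positivity), hx, hT.comm _ (sub_nonneg.mpr ht.le)]

end IsResolventSemigroup

/-! ### Resolvents of the scalar and vector Laplacians by projection onto the graph of `d` -/

section GraphProjection

variable {H : Type*} [NormedAddCommGroup H] [InnerProductSpace ℝ H] [CompleteSpace H]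

/-- The orthogonal projection of `H × H` onto a closed subspace. -/
theorem exists_graphProjection (G : Submodule ℝ (H × H)) (hG : IsClosed (G : Set (H × H))) :
    ∃ P : H × H →L[ℝ] H × H, (∀ p, P p ∈ G) ∧
      ∀ p, ∀ q ∈ G, ⟪p.1 - (P p).1, q.1⟫_ℝ + ⟪p.2 - (P p).2, q.2⟫_ℝ = 0 := by
  -- The product norm on `H × H` is the maximum norm; orthogonality needs the Hilbert sum.
  let e := WithLp.prodContinuousLinearEquiv 2 ℝ H H
  let G' : Submodule ℝ (WithLp 2 (H × H)) := G.comap (e : WithLp 2 (H × H) →ₗ[ℝ] H × H)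
  have hG' : IsClosed (G' : Set (WithLp 2 (H × H))) := hG.preimage e.continuous
  have : CompleteSpace G' := hG'.completeSpace_coe
  refine ⟨(e : WithLp 2 (H × H) →L[ℝ] H × H).comp
    (G'.starProjection.comp (e.symm : H × H →L[ℝ] WithLp 2 (H × H))), fun p => ?_, fun p q hq => ?_⟩
  · exact G'.starProjection_apply_mem (e.symm p)
  · have h1 := Submodule.sub_starProjection_mem_orthogonal (K := G') (e.symm p)
    rw [Submodule.mem_orthogonal'] at h1
    exact (WithLp.prod_inner_apply _ _).symm.trans (h1 (e.symm q) hq)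

end GraphProjection

namespace MetricGraph

variable {V E : Type*} [Fintype E] {Γ : MetricGraph V E}

theorem dense_gradGraph {y : Γ.L2} (h : ∀ p ∈ Γ.gradGraph, ⟪y, p.1⟫_ℝ = 0) : y = 0 := by
  have h1 := dense_domain_d (Γ := Γ)
  rw [Submodule.dense_iff_topologicalClosure_eq_top, Submodule.topologicalClosure_eq_top_iff,
    Submodule.eq_bot_iff] at h1
  refine h1 y ((Submodule.mem_orthogonal' _ _).mpr fun u hu => ?_)
  exact h (u, Γ.d ⟨u, hu⟩) ((Γ.mem_graph_d_iff _).mp (Γ.d.mem_graph ⟨u, hu⟩))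

theorem mem_gradGraph_d (φ : Γ.d.domain) : ((φ : Γ.L2), Γ.d φ) ∈ Γ.gradGraph :=
  (Γ.mem_graph_d_iff _).mp (Γ.d.mem_graph φ)

theorem exists_of_mem_gradGraph {p : Γ.L2 × Γ.L2} (hp : p ∈ Γ.gradGraph) :
    ∃ φ : Γ.d.domain, (φ : Γ.L2) = p.1 ∧ Γ.d φ = p.2 :=
  (LinearPMap.mem_graph_iff _).mp ((Γ.mem_graph_d_iff p).mpr hp)

theorem isKirchhoffLaplacian_iff {f k : Γ.L2} : IsKirchhoffLaplacian f k ↔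
    ∃ g, (f, g) ∈ Γ.gradGraph ∧ ∀ p ∈ Γ.gradGraph, ⟪g, p.2⟫_ℝ = -⟪k, p.1⟫_ℝ := by
  constructor
  · rintro ⟨hf, h⟩
    refine ⟨Γ.d ⟨f, hf⟩, mem_gradGraph_d ⟨f, hf⟩, fun p hp => ?_⟩
    obtain ⟨φ, h1, h2⟩ := exists_of_mem_gradGraph hp
    rw [← h1, ← h2]
    exact h φ
  · rintro ⟨g, hg, h⟩
    obtain ⟨φ, rfl, rfl⟩ := exists_of_mem_gradGraph hg
    exact ⟨φ.2, fun ψ => h _ (mem_gradGraph_d ψ)⟩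

theorem mem_vecDomain_spec (v : Γ.VecDomain) :
    ∀ p ∈ Γ.gradGraph, ⟪((v : Γ.dStar.domain) : Γ.L2), p.2⟫_ℝ = ⟪(dStarVec v : Γ.L2), p.1⟫_ℝ := by
  intro p hp
  obtain ⟨φ, h1, h2⟩ := exists_of_mem_gradGraph hp
  rw [← h1, ← h2]
  exact (LinearPMap.adjoint_isFormalAdjoint dense_domain_d v.1 φ).symm

/-- The converse of `mem_vecDomain_spec`: the adjoint relation tested on the graph of `d` already
puts `v` in `D(d^*)`, since `d` is densely defined. -/
theorem exists_vecDomain {v f g : Γ.L2} (hf : (f, g) ∈ Γ.gradGraph)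
    (h : ∀ p ∈ Γ.gradGraph, ⟪v, p.2⟫_ℝ = ⟪f, p.1⟫_ℝ) :
    ∃ v' : Γ.VecDomain, ((v' : Γ.dStar.domain) : Γ.L2) = v ∧ (dStarVec v' : Γ.L2) = f ∧
      Γ.d (dStarVec v') = g := by
  have h1 : ∀ φ : Γ.d.domain, ⟪f, (φ : Γ.L2)⟫_ℝ = ⟪v, Γ.d φ⟫_ℝ := fun φ =>
    (h _ (mem_gradGraph_d φ)).symm
  have hv : v ∈ Γ.dStar.domain := LinearPMap.mem_adjoint_domain_of_exists v ⟨f, h1⟩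
  have hd : Γ.dStar ⟨v, hv⟩ = f := LinearPMap.adjoint_apply_eq dense_domain_d ⟨v, hv⟩ h1
  obtain ⟨φ, h2, h3⟩ := exists_of_mem_gradGraph hf
  have hmem : (⟨v, hv⟩ : Γ.dStar.domain) ∈ Γ.VecDomain := by
    change Γ.dStar ⟨v, hv⟩ ∈ Γ.d.domain
    have h2' : (φ : Γ.L2) = f := h2
    rw [hd, ← h2']
    exact φ.2
  have h4 : dStarVec (⟨⟨v, hv⟩, hmem⟩ : Γ.VecDomain) = φ := Subtype.ext (hd.trans h2.symm)
  exact ⟨⟨⟨v, hv⟩, hmem⟩, rfl, hd, by rw [h4, h3]⟩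

/-- The resolvent `(1 - L_Γ)⁻¹` of the Kirchhoff Laplacian, together with its gradient. -/
theorem exists_resolvent [Γ.Covered] : ∃ R D : Γ.L2 →L[ℝ] Γ.L2, IsResolvent R ∧
    (∀ y, (R y, D y) ∈ Γ.gradGraph) ∧
    (∀ y, ∀ p ∈ Γ.gradGraph, ⟪y - R y, p.1⟫_ℝ = ⟪D y, p.2⟫_ℝ) ∧
    ∀ f k, IsKirchhoffLaplacian f k ↔ f = R (f - k) := by
  -- The projection of `(y, 0)` is `(R y, D y)` with `D y = d R y`; orthogonality of the remainder
  -- to the graph says `y - R y = d^* D y`.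
  obtain ⟨P, hP, hP'⟩ := exists_graphProjection Γ.gradGraph isClosed_gradGraph
  let R : Γ.L2 →L[ℝ] Γ.L2 :=
    (ContinuousLinearMap.fst ℝ _ _).comp (P.comp (ContinuousLinearMap.inl ℝ _ _))
  let D : Γ.L2 →L[ℝ] Γ.L2 :=
    (ContinuousLinearMap.snd ℝ _ _).comp (P.comp (ContinuousLinearMap.inl ℝ _ _))
  have hmem : ∀ y, (R y, D y) ∈ Γ.gradGraph := fun y => hP (y, 0)
  have heq : ∀ y, ∀ p ∈ Γ.gradGraph, ⟪y - R y, p.1⟫_ℝ = ⟪D y, p.2⟫_ℝ := fun y p hp => by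
    have h : ⟪y - R y, p.1⟫_ℝ + ⟪0 - D y, p.2⟫_ℝ = 0 := hP' (y, 0) p hp
    rw [zero_sub, inner_neg_left] at h
    linarith
  have hin : ∀ x y, ⟪x, R y⟫_ℝ = ⟪R x, R y⟫_ℝ + ⟪D x, D y⟫_ℝ := fun x y => by
    have h := heq x _ (hmem y)
    rw [inner_sub_left] at h
    linarith
  refine ⟨R, D, ⟨fun x y => ?_, fun x => ?_, fun x hx => ?_⟩, hmem, heq, fun f k => ?_⟩
  · rw [hin x y, real_inner_comm, hin y x, real_inner_comm (R x), real_inner_comm (D x)]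
  · rw [real_inner_comm, hin, real_inner_self_eq_norm_sq, real_inner_self_eq_norm_sq]
    linarith [sq_nonneg ‖D x‖]
  · have h1 : D x = 0 := Γ.gradGraph_single_valued _ (hmem x) hx
    refine dense_gradGraph fun p hp => ?_
    have := heq x p hp
    rwa [hx, h1, sub_zero, inner_zero_left] at this
  · rw [isKirchhoffLaplacian_iff]
    constructor
    · rintro ⟨g, hg, h⟩
      have h1 := Γ.gradGraph.sub_mem hg (hmem (f - k))
      have h2 := heq (f - k) _ h1
      have h3 := h _ h1
      simp only [Prod.mk_sub_mk] at h2 h3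
      -- `f - R (f - k)` solves the homogeneous equation for `1 + d^* d`; testing with itself shows
      -- that it vanishes.
      have h4 : ⟪f - R (f - k), f - R (f - k)⟫_ℝ + ⟪g - D (f - k), g - D (f - k)⟫_ℝ = 0 := by
        have e1 : f - R (f - k) = (f - k - R (f - k)) + k := by abel
        have e2 : ⟪f - R (f - k), f - R (f - k)⟫_ℝ =
            ⟪f - k - R (f - k), f - R (f - k)⟫_ℝ + ⟪k, f - R (f - k)⟫_ℝ := by
          rw [← inner_add_left, ← e1]
        rw [e2, h2, inner_sub_left g, h3]
        ring
      rw [real_inner_self_eq_norm_sq, real_inner_self_eq_norm_sq] at h4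
      have h5 : ‖f - R (f - k)‖ ^ 2 = 0 := by
        nlinarith [sq_nonneg ‖f - R (f - k)‖, sq_nonneg ‖g - D (f - k)‖]
      exact sub_eq_zero.mp (norm_eq_zero.mp (pow_eq_zero_iff two_ne_zero |>.mp h5))
    · intro h
      refine ⟨D (f - k), ?_, fun p hp => ?_⟩
      · have := hmem (f - k)
        rwa [← h] at this
      · have := heq (f - k) p hp
        rw [← h, sub_sub_cancel_left, inner_neg_left] at this
        exact this.symm

/-- The resolvent `(1 + d d^*)⁻¹` of the vector Laplacian. -/
theorem exists_vecResolvent [Γ.Covered] : ∃ N F : Γ.L2 →L[ℝ] Γ.L2,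
    (∀ z, (F z, z - N z) ∈ Γ.gradGraph) ∧
    (∀ z, ∀ p ∈ Γ.gradGraph, ⟪N z, p.2⟫_ℝ = ⟪F z, p.1⟫_ℝ) ∧
    ∀ x y, ⟪N x, y⟫_ℝ = ⟪N x, N y⟫_ℝ + ⟪F x, F y⟫_ℝ := by
  -- The projection of `(0, z)` is `(F z, D z)`. With `N z = z - D z`, orthogonality reads `F z =
  -- d^* N z`, so `d d^* N z = z - N z`.
  obtain ⟨P, hP, hP'⟩ := exists_graphProjection Γ.gradGraph isClosed_gradGraph
  let F : Γ.L2 →L[ℝ] Γ.L2 :=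
    (ContinuousLinearMap.fst ℝ _ _).comp (P.comp (ContinuousLinearMap.inr ℝ _ _))
  let D : Γ.L2 →L[ℝ] Γ.L2 :=
    (ContinuousLinearMap.snd ℝ _ _).comp (P.comp (ContinuousLinearMap.inr ℝ _ _))
  have hmem : ∀ z, (F z, D z) ∈ Γ.gradGraph := fun z => hP (0, z)
  have heq : ∀ z, ∀ p ∈ Γ.gradGraph, ⟪z - D z, p.2⟫_ℝ = ⟪F z, p.1⟫_ℝ := fun z p hp => by
    have h : ⟪0 - F z, p.1⟫_ℝ + ⟪z - D z, p.2⟫_ℝ = 0 := hP' (0, z) p hp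
    rw [zero_sub, inner_neg_left] at h
    linarith
  refine ⟨1 - D, F, fun z => ?_, heq, fun x y => ?_⟩
  · simpa using hmem z
  · change ⟪x - D x, y⟫_ℝ = ⟪x - D x, y - D y⟫_ℝ + _
    rw [← heq x _ (hmem y), ← inner_add_right, sub_add_cancel]

end MetricGraph

/-! ### The heat equation in `L²`: existence and uniqueness -/

theorem contDiffOn_one_Ioi_of_hasDerivAt {F : Type*} [NormedAddCommGroup F] [NormedSpace ℝ F]
    {u : ℝ → F} (h : ∀ ε > 0, ∃ v : ℝ → F, (∀ t > ε, HasDerivAt u (v t) t) ∧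
      ContinuousOn v (Ioi ε)) : ContDiffOn ℝ 1 u (Ioi 0) := by
  have h1 : ∀ t > 0, ∃ v : ℝ → F, (∀ s > t / 2, HasDerivAt u (v s) s) ∧
      ContinuousOn v (Ioi (t / 2)) := fun t ht => h (t / 2) (half_pos ht)
  rw [show (1 : WithTop ℕ∞) = 0 + 1 by simp, contDiffOn_succ_iff_deriv_of_isOpen isOpen_Ioi]
  refine ⟨fun t ht => ?_, by simp, ?_⟩
  · obtain ⟨v, hv, -⟩ := h1 t ht
    exact (hv t (half_lt_self ht)).differentiableAt.differentiableWithinAt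
  · rw [contDiffOn_zero]
    intro t ht
    obtain ⟨v, hv, hc⟩ := h1 t ht
    have hn : Ioi (t / 2) ∈ 𝓝 t := Ioi_mem_nhds (half_lt_self ht)
    refine ((hc.continuousAt hn).congr ?_).continuousWithinAt
    filter_upwards [hn] with s hs
    exact (hv s hs).deriv.symm

theorem hasDerivAt_of_contDiffOn_Ioi {F : Type*} [NormedAddCommGroup F] [NormedSpace ℝ F]
    {u : ℝ → F} (h : ContDiffOn ℝ 1 u (Ioi 0)) {t : ℝ} (ht : 0 < t) :
    HasDerivAt u (deriv u t) t :=
  ((h.contDiffAt (Ioi_mem_nhds ht)).differentiableAt (by simp)).hasDerivAt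

namespace MetricGraph

variable {V E : Type*} [Fintype E] {Γ : MetricGraph V E}

/-- Dissipativity, the source of both heat uniqueness results: the pairing equals `-‖df‖²`. -/
theorem IsKirchhoffLaplacian.inner_nonpos {f k : Γ.L2} (h : IsKirchhoffLaplacian f k) :
    ⟪k, f⟫_ℝ ≤ 0 := by
  obtain ⟨g, hg, h⟩ := isKirchhoffLaplacian_iff.mp h
  have h1 := h _ hg
  rw [real_inner_self_eq_norm_sq] at h1
  nlinarith [sq_nonneg ‖g‖]

theorem IsKirchhoffLaplacian.sub {f₁ f₂ k₁ k₂ : Γ.L2} (h₁ : IsKirchhoffLaplacian f₁ k₁)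
    (h₂ : IsKirchhoffLaplacian f₂ k₂) : IsKirchhoffLaplacian (f₁ - f₂) (k₁ - k₂) := by
  obtain ⟨g₁, hg₁, h₁⟩ := isKirchhoffLaplacian_iff.mp h₁
  obtain ⟨g₂, hg₂, h₂⟩ := isKirchhoffLaplacian_iff.mp h₂
  refine isKirchhoffLaplacian_iff.mpr ⟨g₁ - g₂, ?_, fun p hp => ?_⟩
  · have h := Γ.gradGraph.sub_mem hg₁ hg₂
    rwa [Prod.mk_sub_mk] at h
  · rw [inner_sub_left, inner_sub_left, h₁ p hp, h₂ p hp, neg_sub_neg, neg_sub]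

/-- Solutions of the heat equation are unique. -/
theorem IsHeatSolution.eq {w₀ : Γ.L2} {w w' : ℝ → Γ.L2} (h : IsHeatSolution w₀ w)
    (h' : IsHeatSolution w₀ w') {t : ℝ} (ht : 0 ≤ t) : w t = w' t := by
  have hd : ∀ s > 0, HasDerivAt (fun s => ‖w s - w' s‖ ^ 2)
      (2 * ⟪w s - w' s, deriv w s - deriv w' s⟫_ℝ) s := fun s hs =>
    ((hasDerivAt_of_contDiffOn_Ioi h.contDiffOn hs).sub
      (hasDerivAt_of_contDiffOn_Ioi h'.contDiffOn hs)).norm_sq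
  have hanti : AntitoneOn (fun s => ‖w s - w' s‖ ^ 2) (Ici 0) := by
    refine antitoneOn_of_hasDerivWithinAt_nonpos (convex_Ici 0)
      ((h.continuousOn.sub h'.continuousOn).norm.pow 2)
      (f' := fun s => 2 * ⟪w s - w' s, deriv w s - deriv w' s⟫_ℝ)
      (fun s hs => (hd s (by simpa using hs)).hasDerivWithinAt) fun s hs => ?_
    have hs' : 0 < s := by simpa using hs
    rw [real_inner_comm]
    linarith [((h.equation s hs').sub (h'.equation s hs')).inner_nonpos]
  have h1 := hanti (mem_Ici.mpr le_rfl) (mem_Ici.mpr ht) ht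
  simp only [h.initial, h'.initial, sub_self, norm_zero] at h1
  have h2 : ‖w t - w' t‖ ^ 2 = 0 := le_antisymm (by simpa using h1) (sq_nonneg _)
  exact sub_eq_zero.mp (norm_eq_zero.mp (pow_eq_zero_iff two_ne_zero |>.mp h2))

variable {R : Γ.L2 →L[ℝ] Γ.L2} {T : ℝ → Γ.L2 →L[ℝ] Γ.L2}

theorem isHeatSemigroup_of_resolvent (hR : IsResolvent R) (hT : IsResolventSemigroup R T)
    (hL : ∀ f k, IsKirchhoffLaplacian f k ↔ f = R (f - k)) : Γ.IsHeatSemigroup T := by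
  refine ⟨hT.zero, hT.add, hT.tendsto_zero hR, fun f k => ?_⟩
  rw [hL]
  constructor
  · intro h
    have h1 := hT.tendsto_deriv (f - k)
    rw [← h, sub_sub_cancel] at h1
    exact h1
  · intro h
    -- Applying `R` moves the difference quotient into the domain, where its limit is known;
    -- comparing limits gives `R k = R f - f`.
    have h1 := (R.continuous.tendsto k).comp h
    have h2 := hT.tendsto_deriv f
    have h3 : R k = R f - f := by
      refine tendsto_nhds_unique h1 (h2.congr' ?_)
      filter_upwards [self_mem_nhdsWithin] with t ht
      rw [hT.comm t (le_of_lt ht), ← map_sub, ← map_smul]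
      rfl
    rw [map_sub, h3, sub_sub_cancel]

theorem isHeatSolution_of_resolvent (hR : IsResolvent R) (hT : IsResolventSemigroup R T)
    (hL : ∀ f k, IsKirchhoffLaplacian f k ↔ f = R (f - k)) (f : Γ.L2) :
    IsHeatSolution f fun t => T t f := by
  refine ⟨hT.continuousOn hR f, ?_, fun t ht => ?_, by rw [hT.zero]; rfl⟩
  · refine contDiffOn_one_Ioi_of_hasDerivAt fun ε hε => ?_
    obtain ⟨z, z', hz, hz', h⟩ := hT.exists_eq_comp hR f hε
    refine ⟨fun t => R (z' t), fun t ht => ?_, R.continuous.comp_continuousOn hz'⟩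
    refine (R.hasFDerivAt.comp_hasDerivAt t (hz t ht)).congr_of_eventuallyEq ?_
    filter_upwards [Ioi_mem_nhds ht] with s hs using h s hs
  · obtain ⟨y, hy⟩ := hT.exists_eq (t / 2) (half_pos ht) f
    have h1 : ∀ s ≥ t / 2, T s f = T (s - t / 2) (R y) := fun s hs => by
      rw [← hy, ← hT.apply_add (sub_nonneg.mpr hs) (half_pos ht).le, sub_add_cancel]
    have h2 : HasDerivAt (fun s => T s f) (T (t - t / 2) (R y - y)) t := by
      refine ((hT.hasDerivAt_range hR y (by linarith)).comp_sub_const t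
        (t / 2)).congr_of_eventuallyEq ?_
      filter_upwards [Ioi_mem_nhds (half_lt_self ht)] with s hs using h1 s (le_of_lt hs)
    rw [hL, h2.deriv, h1 t (half_lt_self ht).le, ← map_sub, sub_sub_cancel,
      ← hT.comm _ (by linarith)]

/-- The heat semigroup is unique. -/
theorem IsHeatSemigroup.eq_of_resolvent (hR : IsResolvent R) (hT : IsResolventSemigroup R T)
    (hL : ∀ f k, IsKirchhoffLaplacian f k ↔ f = R (f - k)) {S : ℝ → Γ.L2 →L[ℝ] Γ.L2}
    (hS : Γ.IsHeatSemigroup S) {t : ℝ} (ht : 0 ≤ t) : S t = T t := by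
  obtain ⟨δ, hδ, C, hC⟩ := exists_bound_semigroup hS.zero hS.tendsto
  have hTS := isHeatSemigroup_of_resolvent hR hT hL
  -- Any semigroup with this generator preserves the domain, commutes with the generator there and
  -- is right differentiable on it.
  have key : ∀ {S' : ℝ → Γ.L2 →L[ℝ] Γ.L2} (_ : Γ.IsHeatSemigroup S') (y : Γ.L2) {s : ℝ}
      (_ : 0 ≤ s), HasDerivWithinAt (fun t => S' t (R y)) (S' s (R y - y)) (Ioi s) s ∧
        IsKirchhoffLaplacian (S' s (R y)) (S' s (R y - y)) := by
    intro S' hS' y s hs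
    have h1 : Tendsto (fun t => t⁻¹ • (S' t (R y) - R y)) (𝓝[>] 0) (𝓝 (R y - y)) :=
      (hS'.generator _ _).mp ((hL _ _).mpr (by rw [sub_sub_cancel]))
    refine ⟨hasDerivWithinAt_semigroup hS'.add h1 hs, (hS'.generator _ _).mpr ?_⟩
    refine (((S' s).continuous.tendsto _).comp h1).congr' ?_
    filter_upwards [self_mem_nhdsWithin] with r hr
    have h2 : S' r (S' s (R y)) = S' s (S' r (R y)) := by
      change (S' r * S' s) (R y) = (S' s * S' r) (R y)
      rw [← hS'.add r (le_of_lt hr) s hs,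
        ← hS'.add s hs r (le_of_lt hr), add_comm]
    rw [h2, ← map_sub, ← map_smul]
    rfl
  have hsmall : ∀ s ∈ Icc 0 δ, S s = T s := by
    intro s hs
    have hrange : ∀ y, S s (R y) = T s (R y) := by
      intro y
      have hc : ContinuousOn (fun s => ‖S s (R y) - T s (R y)‖ ^ 2) (Icc 0 δ) := by
        refine ContinuousOn.pow (ContinuousOn.norm (ContinuousOn.sub ?_ ?_)) 2
        · exact continuousOn_semigroup hS.zero hS.add hS.tendsto Icc_subset_Ici_self
            (fun t ht f => (S t).le_of_opNorm_le (hC t ht) f) (R y)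
        · exact (hT.continuousOn hR (R y)).mono Icc_subset_Ici_self
      -- `‖S s (R y) - T s (R y)‖²` starts at zero and has nonpositive right derivative by
      -- dissipativity.
      have h1 := image_le_of_deriv_right_le_deriv_boundary hc
        (f' := fun s => 2 * ⟪S s (R y) - T s (R y), S s (R y - y) - T s (R y - y)⟫_ℝ)
        (B := fun _ => 0) (B' := fun _ => 0)
        (fun r hr => by
          have h2 := ((key hS y hr.1).1.sub (key hTS y hr.1).1).norm_sq
          exact h2.Ici_of_Ioi)
        (by simp [hS.zero, hT.zero]) continuousOn_const
        (fun r _ => hasDerivWithinAt_const r _ 0) (fun r hr => by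
          have h2 := ((key hS y hr.1).2.sub (key hTS y hr.1).2).inner_nonpos
          rw [real_inner_comm]
          linarith) hs
      have h2 : ‖S s (R y) - T s (R y)‖ ^ 2 = 0 := le_antisymm h1 (sq_nonneg _)
      exact sub_eq_zero.mp (norm_eq_zero.mp (pow_eq_zero_iff two_ne_zero |>.mp h2))
    refine DFunLike.coe_injective ?_
    exact hR.denseRange.equalizer (S s).continuous (T s).continuous (funext hrange)
  -- `S` is known to be bounded only on `[0, δ]`, so longer times are reached as `n` steps of length
  -- `t / n ≤ δ`.
  obtain ⟨n, hn⟩ := exists_nat_gt (t / δ)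
  have hpow : ∀ (k : ℕ) {s : ℝ}, s ∈ Icc 0 δ → S (k * s) = T (k * s) := by
    intro k s hs
    induction k with
    | zero => rw [Nat.cast_zero, zero_mul, hS.zero, hT.zero]
    | succ k ih =>
      have h1 : (0 : ℝ) ≤ k * s := mul_nonneg k.cast_nonneg hs.1
      rw [Nat.cast_succ, add_mul, one_mul, hS.add _ h1 _ hs.1, hT.add _ h1 _ hs.1, ih,
        hsmall s hs]
  have hn0 : (0 : ℝ) < n := (div_nonneg ht hδ.le).trans_lt hn
  have h1 := hpow n (s := t / n) ⟨by positivity, by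
    rw [div_le_iff₀ hn0]
    rw [div_lt_iff₀ hδ] at hn
    linarith⟩
  rwa [mul_div_cancel₀ _ hn0.ne'] at h1

end MetricGraph

/-! ### The heat flow as a curve in `W^{1,2}` -/

namespace MetricGraph

variable {V E : Type*} [Fintype E] {Γ : MetricGraph V E}

/-- An open set containing a point of a closed edge meets the open edge in a nonempty open set. The
minimum principle needs this to pass from integrals to every point. -/
instance [Γ.Covered] : Γ.μ.IsOpenPosMeasure := by
  refine ⟨fun U hU hne hzero => ?_⟩
  obtain ⟨x, hx⟩ := hne
  obtain ⟨e, s, hs, rfl⟩ := Covered.exists_edge x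
  have h1 : ∀ᵐ x ∂Γ.μ, x ∉ U := measure_eq_zero_iff_ae_notMem.mp hzero
  have h2 := ae_edge h1 e
  have hopen : IsOpen (edge (Γ := Γ) e ⁻¹' U ∩ Ioo 0 (Γ.len e)) :=
    (hU.preimage (continuous_edge e)).inter isOpen_Ioo
  have hne : (edge (Γ := Γ) e ⁻¹' U ∩ Ioo 0 (Γ.len e)).Nonempty := by
    rw [← closure_Ioo (Γ.len_pos e).ne] at hs
    exact mem_closure_iff.mp hs _ (hU.preimage (continuous_edge e)) hx
  refine (hopen.measure_pos volume hne).ne' ?_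
  rw [ae_restrict_iff' measurableSet_Ioo] at h2
  refine measure_mono_null (fun r hr => ?_) (ae_iff.mp h2)
  simpa using ⟨hr.2.1, hr.2.2, hr.1⟩

/-- A curve `t ↦ (w t, d (w t))` in `W^{1,2}` such that `w` solves the heat equation. -/
structure IsHeatPath (p : ℝ → Γ.gradGraph) : Prop where
  continuousOn : ContinuousOn p (Ici 0)
  contDiffOn : ContDiffOn ℝ 1 p (Ioi 0)
  equation : ∀ t > 0, ∀ q ∈ Γ.gradGraph, ⟪(p t).1.2, q.2⟫_ℝ = -⟪(deriv p t).1.1, q.1⟫_ℝ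

section Existence

variable {R D : Γ.L2 →L[ℝ] Γ.L2} {T : ℝ → Γ.L2 →L[ℝ] Γ.L2}

theorem gradGraph_eq {f g g' : Γ.L2} (h : (f, g) ∈ Γ.gradGraph) (h' : (f, g') ∈ Γ.gradGraph) :
    g = g' := by
  have h1 := Γ.gradGraph.sub_mem h h'
  rw [Prod.mk_sub_mk] at h1
  exact sub_eq_zero.mp (Γ.gradGraph_single_valued _ h1 (sub_self f))

/-- The domain of the Kirchhoff Laplacian is dense in `W^{1,2}`. -/
theorem exists_resolvent_near (hmem : ∀ y, (R y, D y) ∈ Γ.gradGraph)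
    (heq : ∀ y, ∀ p ∈ Γ.gradGraph, ⟪y - R y, p.1⟫_ℝ = ⟪D y, p.2⟫_ℝ) {q : Γ.L2 × Γ.L2}
    (hq : q ∈ Γ.gradGraph) (hclosed : IsClosed (Γ.gradGraph : Set (Γ.L2 × Γ.L2))) {ε : ℝ}
    (hε : 0 < ε) : ∃ y, ‖q.1 - R y‖ < ε ∧ ‖q.2 - D y‖ < ε := by
  let S : Submodule ℝ (Γ.L2 × Γ.L2) := LinearMap.range (R.prod D : Γ.L2 →ₗ[ℝ] Γ.L2 × Γ.L2)
  have hS : ∀ y, (R y, D y) ∈ S.topologicalClosure := fun y =>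
    S.le_topologicalClosure ⟨y, rfl⟩
  have hle : S.topologicalClosure ≤ Γ.gradGraph :=
    Submodule.topologicalClosure_minimal _ (by rintro _ ⟨y, rfl⟩; exact hmem y) hclosed
  obtain ⟨P, hP, hP'⟩ := exists_graphProjection S.topologicalClosure
    S.isClosed_topologicalClosure
  have h1 : q - P q ∈ Γ.gradGraph := Γ.gradGraph.sub_mem hq (hle (hP q))
  have h2 : (q - P q).1 = 0 := by
    -- Within the graph, the graph inner product with `(R y, D y)` is the `L²` product of the first
    -- component with `y`.
    refine ext_inner_right ℝ fun y => ?_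
    have h3 : ⟪(q - P q).1, R y⟫_ℝ + ⟪(q - P q).2, D y⟫_ℝ = 0 := hP' q _ (hS y)
    have h4 := heq y _ h1
    rw [inner_sub_left, real_inner_comm, real_inner_comm _ (R y), real_inner_comm _ (D y)] at h4
    rw [inner_zero_left]
    linarith
  have h3 : q - P q = 0 := Prod.ext h2 (Γ.gradGraph_single_valued _ h1 h2)
  have h4 : q ∈ closure (S : Set (Γ.L2 × Γ.L2)) := by
    rw [sub_eq_zero.mp h3]
    exact hP q
  obtain ⟨_, ⟨y, rfl⟩, hy⟩ := Metric.mem_closure_iff.mp h4 ε hε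
  rw [dist_eq_norm, Prod.norm_def, max_lt_iff] at hy
  exact ⟨y, hy⟩

theorem norm_sq_resolvent_eq (hmem : ∀ y, (R y, D y) ∈ Γ.gradGraph)
    (heq : ∀ y, ∀ p ∈ Γ.gradGraph, ⟪y - R y, p.1⟫_ℝ = ⟪D y, p.2⟫_ℝ) (y : Γ.L2) :
    ‖D y‖ ^ 2 = ⟪y - R y, R y⟫_ℝ := by
  rw [heq y _ (hmem y), real_inner_self_eq_norm_sq]

/-- The heat semigroup decreases the energy, on the domain of the Laplacian. -/
theorem norm_grad_resolvent_le (hR : IsResolvent R) (hT : IsResolventSemigroup R T)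
    (hL : ∀ f k, IsKirchhoffLaplacian f k ↔ f = R (f - k))
    (hmem : ∀ y, (R y, D y) ∈ Γ.gradGraph)
    (heq : ∀ y, ∀ p ∈ Γ.gradGraph, ⟪y - R y, p.1⟫_ℝ = ⟪D y, p.2⟫_ℝ) (y : Γ.L2) {t : ℝ}
    (ht : 0 ≤ t) : ‖D (T t y)‖ ≤ ‖D y‖ := by
  have hsol := isHeatSolution_of_resolvent hR hT hL y
  set v := fun t => T t y
  -- The energy of `R v`, written with bounded operators only so that it can be differentiated; `(R
  -- v)' = -(v - R v)` gives the derivative `-2 ‖v - R v‖²`.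
  have hanti : AntitoneOn (fun s => ⟪v s - R (v s), R (v s)⟫_ℝ) (Ici 0) := by
    refine antitoneOn_of_hasDerivWithinAt_nonpos (convex_Ici 0) ?_
      (f' := fun s => -2 * ‖v s - R (v s)‖ ^ 2) (fun s hs => ?_) fun s _ => ?_
    · have hc := hsol.continuousOn
      have hc' := R.continuous.comp_continuousOn hc
      exact (hc.sub hc').inner hc'
    · have hs' : 0 < s := by simpa using hs
      have h1 := hasDerivAt_of_contDiffOn_Ioi hsol.contDiffOn hs'
      have h2 : HasDerivAt (fun s => R (v s)) (R (deriv v s)) s :=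
        R.hasFDerivAt.comp_hasDerivAt s h1
      have h3 := ((h1.sub h2).inner ℝ h2)
      refine (h3.congr_deriv ?_).hasDerivWithinAt
      have h4 := (hL _ _).mp (hsol.equation s hs')
      have h5 : R (deriv v s) = -(v s - R (v s)) := by
        rw [map_sub] at h4
        rw [eq_sub_iff_add_eq] at h4
        rw [neg_sub, ← h4]
        abel
      have h6 : ⟪deriv v s - R (deriv v s), R (v s)⟫_ℝ = ⟪v s - R (v s), R (deriv v s)⟫_ℝ := by
        rw [← hR.symm, map_sub, inner_sub_left, inner_sub_left, hR.symm (R (deriv v s)),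
          real_inner_comm (v s), real_inner_comm (R (v s))]
      simp only [Pi.sub_apply]
      rw [h6, h5, inner_neg_right, real_inner_self_eq_norm_sq]
      ring
    · nlinarith [sq_nonneg ‖v s - R (v s)‖]
  have h1 := hanti (mem_Ici.mpr le_rfl) (mem_Ici.mpr ht) ht
  simp only [← norm_sq_resolvent_eq hmem heq] at h1
  have h2 : v 0 = y := hsol.initial
  rw [h2] at h1
  exact (pow_le_pow_iff_left₀ (norm_nonneg _) (norm_nonneg _) two_ne_zero).mp h1

/-- The heat semigroup acts on `W^{1,2}` and decreases the energy. -/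
theorem exists_grad_semigroup [Γ.Covered] (hR : IsResolvent R) (hT : IsResolventSemigroup R T)
    (hL : ∀ f k, IsKirchhoffLaplacian f k ↔ f = R (f - k))
    (hmem : ∀ y, (R y, D y) ∈ Γ.gradGraph)
    (heq : ∀ y, ∀ p ∈ Γ.gradGraph, ⟪y - R y, p.1⟫_ℝ = ⟪D y, p.2⟫_ℝ) {q : Γ.L2 × Γ.L2}
    (hq : q ∈ Γ.gradGraph) {t : ℝ} (ht : 0 ≤ t) :
    ∃ g, (T t q.1, g) ∈ Γ.gradGraph ∧ ‖g‖ ≤ ‖q.2‖ := by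
  have hex : ∀ n : ℕ, ∃ y, ‖q.1 - R y‖ < 1 / ((n : ℝ) + 1) ∧ ‖q.2 - D y‖ < 1 / ((n : ℝ) + 1) :=
    fun n => exists_resolvent_near hmem heq hq isClosed_gradGraph (by positivity)
  choose y hy1 hy2 using hex
  have htend : ∀ {a : ℕ → Γ.L2} {b : Γ.L2}, (∀ n, ‖b - a n‖ < 1 / ((n : ℝ) + 1)) →
      Tendsto a atTop (𝓝 b) := fun {a b} h => by
    rw [tendsto_iff_norm_sub_tendsto_zero]
    refine squeeze_zero (fun n => norm_nonneg _) (fun n => ?_)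
      tendsto_one_div_add_atTop_nhds_zero_nat
    rw [norm_sub_rev]
    exact (h n).le
  have hRy := htend hy1
  have hDy := htend hy2
  have hc : CauchySeq fun n => D (T t (y n)) := by
    refine Metric.cauchySeq_iff'.mpr fun ε hε => ?_
    obtain ⟨N, hN⟩ := Metric.cauchySeq_iff'.mp hDy.cauchySeq ε hε
    refine ⟨N, fun n hn => ?_⟩
    have h1 := hN n hn
    rw [dist_eq_norm, ← map_sub] at h1 ⊢
    rw [← map_sub]
    exact (norm_grad_resolvent_le hR hT hL hmem heq _ ht).trans_lt h1
  obtain ⟨g, hg⟩ := cauchySeq_tendsto_of_complete hc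
  refine ⟨g, ?_, le_of_tendsto_of_tendsto hg.norm hDy.norm (Eventually.of_forall fun n =>
    norm_grad_resolvent_le hR hT hL hmem heq _ ht)⟩
  have h1 : Tendsto (fun n => R (T t (y n))) atTop (𝓝 (T t q.1)) :=
    (((T t).continuous.tendsto _).comp hRy).congr fun n => hT.comm t ht (y n)
  exact isClosed_gradGraph.mem_of_tendsto (h1.prodMk_nhds hg)
    (Eventually.of_forall fun n => hmem _)

/-- The heat flow starting in `W^{1,2}` is a continuous curve in `W^{1,2}`, and it is continuously
differentiable for positive times. -/
theorem exists_heatPath [Γ.Covered] (hR : IsResolvent R) (hT : IsResolventSemigroup R T)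
    (hL : ∀ f k, IsKirchhoffLaplacian f k ↔ f = R (f - k))
    (hmem : ∀ y, (R y, D y) ∈ Γ.gradGraph)
    (heq : ∀ y, ∀ p ∈ Γ.gradGraph, ⟪y - R y, p.1⟫_ℝ = ⟪D y, p.2⟫_ℝ) (q : Γ.gradGraph) :
    ∃ p : ℝ → Γ.gradGraph, IsHeatPath p ∧ p 0 = q ∧ ∀ t ≥ 0, (p t).1.1 = T t q.1.1 := by
  have hex : ∀ t, ∃ p : Γ.gradGraph, 0 ≤ t → p.1.1 = T t q.1.1 := fun t => by
    by_cases ht : 0 ≤ t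
    · obtain ⟨g, hg, -⟩ := exists_grad_semigroup hR hT hL hmem heq q.2 ht
      exact ⟨⟨_, hg⟩, fun _ => rfl⟩
    · exact ⟨0, fun h => absurd h ht⟩
  choose p hp using hex
  have hext : ∀ {a b : Γ.gradGraph}, a.1.1 = b.1.1 → a = b := fun {a b} h =>
    Subtype.ext (Prod.ext h (gradGraph_eq (f := a.1.1) a.2 (by rw [h]; exact b.2)))
  have hp0 : p 0 = q := hext (by rw [hp 0 le_rfl, hT.zero]; rfl)
  let J : Γ.L2 →L[ℝ] Γ.gradGraph := (R.prod D).codRestrict Γ.gradGraph hmem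
  have hJ1 : ∀ y, (J y).1.1 = R y := fun y => rfl
  have hJ2 : ∀ y, (J y).1.2 = D y := fun y => rfl
  have hdiff : ∀ ε > 0, ∃ v : ℝ → Γ.gradGraph, (∀ t > ε, HasDerivAt p (v t) t) ∧
      ContinuousOn v (Ioi ε) := by
    intro ε hε
    obtain ⟨z, z', hz, hz', h⟩ := hT.exists_eq_comp hR q.1.1 hε
    refine ⟨fun t => J (z' t), fun t ht => ?_, J.continuous.comp_continuousOn hz'⟩
    refine (J.hasFDerivAt.comp_hasDerivAt t (hz t ht)).congr_of_eventuallyEq ?_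
    filter_upwards [Ioi_mem_nhds ht] with s hs
    refine hext ?_
    rw [hp s (hε.le.trans (le_of_lt hs)), h s hs]
    rfl
  have hcd := contDiffOn_one_Ioi_of_hasDerivAt hdiff
  -- The flow contracts the graph norm, so the path stays uniformly close to one starting at `J y`,
  -- which is continuous at `0`.
  have hclose : ∀ t ≥ 0, ∀ y, ‖p t - J (T t y)‖ ≤ ‖q - J y‖ := by
    intro t ht y
    obtain ⟨g, hg, hle⟩ := exists_grad_semigroup hR hT hL hmem heq (q - J y).2 ht
    have h1 : p t - J (T t y) = ⟨_, hg⟩ := by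
      refine hext ?_
      change (p t).1.1 - R (T t y) = T t (q.1.1 - R y)
      rw [hp t ht, map_sub, hT.comm t ht]
    rw [h1]
    change max ‖T t (q - J y).1.1‖ ‖g‖ ≤ max ‖(q - J y).1.1‖ ‖(q - J y).1.2‖
    exact max_le_max (hT.norm_le t ht _) hle
  refine ⟨p, ⟨fun t ht => ?_, hcd, fun t ht r hr => ?_⟩, hp0, hp⟩
  · rcases (mem_Ici.mp ht).eq_or_lt with rfl | ht'
    · rw [Metric.continuousWithinAt_iff]
      intro ε hε
      obtain ⟨y, hy1, hy2⟩ := exists_resolvent_near hmem heq q.2 isClosed_gradGraph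
        (ε := ε / 3) (by positivity)
      have hy : ‖q - J y‖ < ε / 3 := max_lt hy1 hy2
      have hc : ContinuousWithinAt (fun t => J (T t y)) (Ici 0) 0 :=
        (J.continuous.comp_continuousOn (hT.continuousOn hR y)) 0 (mem_Ici.mpr le_rfl)
      obtain ⟨δ, hδ, h⟩ := Metric.continuousWithinAt_iff.mp hc (ε / 3) (by positivity)
      refine ⟨δ, hδ, fun s hs hsδ => ?_⟩
      have h1 := h hs hsδ
      have h2 := hclose s hs y
      rw [hT.zero, one_apply_eq_self] at h1
      rw [hp0]
      have h3 := dist_triangle4 (p s) (J (T s y)) (J y) q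
      rw [dist_eq_norm (p s) (J (T s y)), dist_comm (J y), dist_eq_norm q] at h3
      linarith
    · exact (hasDerivAt_of_contDiffOn_Ioi hcd ht').continuousAt.continuousWithinAt
  · have h1 := hasDerivAt_of_contDiffOn_Ioi hcd ht
    let π : Γ.gradGraph →L[ℝ] Γ.L2 :=
      (ContinuousLinearMap.fst ℝ Γ.L2 Γ.L2).comp Γ.gradGraph.subtypeL
    have h2 : HasDerivAt (fun s => T s q.1.1) (deriv p t).1.1 t := by
      refine (π.hasFDerivAt.comp_hasDerivAt t h1).congr_of_eventuallyEq ?_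
      filter_upwards [Ioi_mem_nhds ht] with s hs using (hp s (le_of_lt hs)).symm
    have h3 := (isHeatSolution_of_resolvent hR hT hL q.1.1).equation t ht
    rw [h2.deriv] at h3
    obtain ⟨g, hg, h4⟩ := isKirchhoffLaplacian_iff.mp h3
    rw [← hp t (le_of_lt ht)] at hg
    rw [gradGraph_eq (f := (p t).1.1) (p t).2 hg]
    exact h4 r hr

end Existence

/-! ### The minimum principle -/

section Positivity

variable [Γ.Covered]

theorem exp_apply (a : C(Γ.Space, ℝ)) (x : Γ.Space) : NormedSpace.exp a x = Real.exp (a x) := by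
  let _ := NormedAlgebra.restrictScalars ℚ ℝ C(Γ.Space, ℝ)
  rw [Real.exp_eq_exp_ℝ]
  exact NormedSpace.map_exp (ContinuousMap.evalAlgHom ℝ ℝ x)
    (ContinuousEvalConst.continuous_eval_const (F := C(Γ.Space, ℝ)) x) a

/-- Integration against `μ_Γ`, as a continuous linear functional on the continuous functions. -/
noncomputable def integralL : C(Γ.Space, ℝ) →L[ℝ] ℝ := (innerSL ℝ (toL2L 1)).comp toL2L

theorem integralL_apply (a : C(Γ.Space, ℝ)) : integralL a = ∫ x, a x ∂Γ.μ := by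
  change ⟪toL2L 1, toL2L a⟫_ℝ = _
  rw [inner_toL2L]
  simp

theorem integralL_mul (a b : C(Γ.Space, ℝ)) : integralL (a * b) = ⟪toL2L a, toL2L b⟫_ℝ := by
  rw [integralL_apply, inner_toL2L]
  rfl

theorem mem_gradGraph_of_isGradient {F : C(Γ.Space, ℝ)} {g : Γ.L2} (h : IsGradient F g) :
    (toL2L F, g) ∈ Γ.gradGraph := ⟨F, h, rfl⟩

theorem apply_mem_Icc_norm (a : C(Γ.Space, ℝ)) (x : Γ.Space) : a x ∈ Icc (-‖a‖) ‖a‖ :=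
  abs_le.mp (a.norm_coe_le_norm x)

theorem isGradient_exp {F : C(Γ.Space, ℝ)} {g : Γ.L2} (h : IsGradient F g) (c : ℝ) :
    IsGradient (NormedSpace.exp (c • F) : C(Γ.Space, ℝ))
      (c • mulL (NormedSpace.exp (c • F)) g) := by
  rw [← smul_apply, ← map_smul]
  refine h.comp (apply_mem_Icc_norm F) (φ := fun x => Real.exp (c * x))
    (φ' := fun x => c * Real.exp (c * x)) (fun x _ => ?_) (by fun_prop) (fun x => ?_) fun x => ?_
  · have := ((hasDerivAt_id x).const_mul c).exp
    rwa [id, mul_one, mul_comm] at this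
  · rw [exp_apply]
    rfl
  · rw [ContinuousMap.smul_apply, exp_apply]
    rfl

/-- The minimum principle for the heat equation. -/
theorem IsHeatPath.le_rep {p : ℝ → Γ.gradGraph} (hp : IsHeatPath p) {δ : ℝ}
    (h0 : ∀ x, δ ≤ rep (p 0) x) {t : ℝ} (ht : 0 ≤ t) (x : Γ.Space) : δ ≤ rep (p t) x := by
  -- Testing the heat equation with `e^{-cw}` shows that `∫ e^{-cw}` has derivative `-c² ∫ e^{-cw}
  -- |dw|² ≤ 0`.
  have hmono : ∀ c : ℝ, 0 ≤ c →
      AntitoneOn (fun s => integralL (NormedSpace.exp (-c • rep (p s)))) (Ici 0) := by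
    intro c hc
    refine antitoneOn_of_hasDerivWithinAt_nonpos (convex_Ici 0) ?_
      (f' := fun s => integralL (NormedSpace.exp (-c • rep (p s)) * (-c • rep (deriv p s))))
      (fun s hs => ?_) fun s hs => ?_
    · let _ := NormedAlgebra.restrictScalars ℚ ℝ C(Γ.Space, ℝ)
      exact integralL.continuous.comp_continuousOn (NormedSpace.exp_continuous.comp_continuousOn
        ((rep.continuous.comp_continuousOn hp.continuousOn).const_smul (-c)))
    · have hs' : 0 < s := by simpa using hs
      have h1 := rep.hasFDerivAt.comp_hasDerivAt s
        (hasDerivAt_of_contDiffOn_Ioi hp.contDiffOn hs')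
      have h2 := (hasFDerivAt_exp (𝕂 := ℝ)).comp_hasDerivAt s (h1.const_smul (-c))
      exact (integralL.hasFDerivAt.comp_hasDerivAt s h2).hasDerivWithinAt
    · have hs' : 0 < s := by simpa using hs
      have h1 := isGradient_exp (isGradient_rep (p s)) (-c)
      have h2 := hp.equation s hs' _ (mem_gradGraph_of_isGradient h1)
      have h3 := inner_mulL_self_nonneg (a := NormedSpace.exp (-c • rep (p s)))
        (fun x => by rw [exp_apply]; exact (Real.exp_pos _).le) (p s).1.2
      rw [mul_smul_comm, map_smul, integralL_mul, toL2L_rep, smul_eq_mul, real_inner_comm]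
      simp only [inner_smul_right] at h2
      rw [real_inner_comm] at h2
      have h4 : ⟪(deriv p s).1.1, toL2L (NormedSpace.exp (-c • rep (p s)))⟫_ℝ =
        c * ⟪mulL (NormedSpace.exp (-c • rep (p s))) (p s).1.2, (p s).1.2⟫_ℝ := by linarith
      rw [h4]
      nlinarith [mul_nonneg (mul_nonneg hc hc) h3]
  by_contra! hx
  -- A level strictly between the offending value and `δ`; the open set where `w` lies below it has
  -- positive measure `m`.
  set a := (rep (p t) x + δ) / 2 with ha
  set m := Γ.μ.real {y | rep (p t) y < a} with hm
  have hmpos : 0 < m := by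
    refine ENNReal.toReal_pos (IsOpen.measure_pos _ ?_ ⟨x, ?_⟩).ne' (measure_ne_top _ _)
    · exact isOpen_lt (rep (p t)).continuous continuous_const
    · change rep (p t) x < a
      linarith
  -- Markov's inequality with `c = n`: `e^{-na} m ≤ ∫ e^{-n w(t)} ≤ ∫ e^{-n w(0)} ≤ e^{-nδ} μ(X)`.
  -- Since `a < δ`, this forces `m = 0` as `n → ∞`.
  have hkey : ∀ n : ℕ, m ≤ Real.exp (-(δ - a)) ^ n * Γ.μ.real univ := by
    intro n
    have h1 := hmono n n.cast_nonneg (mem_Ici.mpr le_rfl) (mem_Ici.mpr ht) ht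
    simp only [integralL_apply, exp_apply] at h1
    have hint : ∀ s, Integrable (fun y => Real.exp ((-(n : ℝ) • rep (p s)) y)) Γ.μ := fun s =>
      (memLp_of_continuous (Real.continuous_exp.comp
        (-(n : ℝ) • rep (p s)).continuous)).integrable (by norm_num)
    have h2 : ∫ y, Real.exp ((-(n : ℝ) • rep (p 0)) y) ∂Γ.μ ≤ Real.exp (-n * δ) * Γ.μ.real univ := by
      rw [mul_comm, ← smul_eq_mul, ← integral_const]
      refine integral_mono (hint 0) (integrable_const _) fun y => Real.exp_le_exp.mpr ?_
      change -(n : ℝ) * rep (p 0) y ≤ _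
      nlinarith [h0 y, n.cast_nonneg (α := ℝ)]
    have h3 := mul_meas_ge_le_integral_of_nonneg
      (ae_of_all _ fun y => (Real.exp_pos ((-(n : ℝ) • rep (p t)) y)).le) (hint t)
      (Real.exp (-n * a))
    have h4 : m ≤ Γ.μ.real {y | Real.exp (-n * a) ≤ Real.exp ((-(n : ℝ) • rep (p t)) y)} := by
      refine measureReal_mono (fun y hy => Real.exp_le_exp.mpr ?_)
      change _ ≤ -(n : ℝ) * rep (p t) y
      have : rep (p t) y < a := hy
      nlinarith [n.cast_nonneg (α := ℝ)]
    have h5 : Real.exp (-n * a) * m ≤ Real.exp (-n * δ) * Γ.μ.real univ :=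
      (mul_le_mul_of_nonneg_left h4 (Real.exp_pos _).le).trans (h3.trans (h1.trans h2))
    rw [← Real.exp_nat_mul]
    have h6 : Real.exp (-n * δ) = Real.exp (-n * a) * Real.exp (n * -(δ - a)) := by
      rw [← Real.exp_add]
      congr 1
      ring
    rw [h6, mul_assoc] at h5
    exact le_of_mul_le_mul_left h5 (Real.exp_pos _)
  have hlim : Tendsto (fun n : ℕ => Real.exp (-(δ - a)) ^ n * Γ.μ.real univ) atTop (𝓝 0) := by
    have := (tendsto_pow_atTop_nhds_zero_of_lt_one (Real.exp_pos (-(δ - a))).le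
      (Real.exp_lt_one_iff.mpr (by linarith))).mul_const (Γ.μ.real univ)
    rwa [zero_mul] at this
  exact absurd (ge_of_tendsto' hlim hkey) (not_le.mpr hmpos)

end Positivity

end MetricGraph

/-! ### The Cole-Hopf transform and uniqueness for the Burgers equation -/

namespace MetricGraph

theorem isUnit_of_pos {X : Type*} [TopologicalSpace X] {a : C(X, ℝ)} (ha : ∀ x, 0 < a x) :
    IsUnit a :=
  (ContinuousMap.isUnit_iff_forall_ne_zero a).mpr fun x => (ha x).ne'

/-- Taking `1 / w` as a ring inverse in the Banach algebra of continuous functions makes its smooth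
dependence on `w` available. -/
theorem ringInverse_apply {X : Type*} [TopologicalSpace X] {a : C(X, ℝ)} (ha : ∀ x, 0 < a x)
    (x : X) :
    Ring.inverse a x = (a x)⁻¹ := by
  have h := DFunLike.congr_fun (Ring.mul_inverse_cancel a (isUnit_of_pos ha)) x
  rw [ContinuousMap.mul_apply, ContinuousMap.one_apply] at h
  exact eq_inv_of_mul_eq_one_right h

/-- The arithmetic of the uniqueness estimate, applied with `k = ‖d^* N z‖`, `ψ = ‖z - N z‖`, `v =
‖N z‖` and `A` a bound for `|d^* N z|`. Young's inequality splits `A z M`; the weight `1 / (4 (M² +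
1))` leaves `ψ²` with a total coefficient below that of the dissipation. -/
theorem energy_bound {k ψ v z A M C P : ℝ} (hC : 0 ≤ C)
    (hA : A ^ 2 = C * k ^ 2 + 1 / (4 * (M ^ 2 + 1)) * ψ ^ 2) (hz0 : 0 ≤ z) (hz : z ≤ v + ψ)
    (hP : -P ≤ A * z * M) :
    -(k ^ 2 + ψ ^ 2) - 1 / 2 * P ≤ (M ^ 2 * C + 1) * (v ^ 2 + k ^ 2) := by
  have hz2 : z ^ 2 ≤ 2 * v ^ 2 + 2 * ψ ^ 2 := by
    have := pow_le_pow_left₀ hz0 hz 2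
    linarith [sq_nonneg (v - ψ), add_sq v ψ, sub_sq v ψ]
  have hyoung : A * z * M ≤ M ^ 2 * A ^ 2 + 1 / 4 * z ^ 2 := by
    linarith [sq_nonneg (M * A - 1 / 2 * z), sub_sq (M * A) (1 / 2 * z), mul_pow M A 2,
      mul_pow (1 / 2) z 2, mul_comm (M * A) z, mul_left_comm z M A, mul_assoc A z M,
      mul_left_comm A z M, mul_comm A M]
  have hε : M ^ 2 * (1 / (4 * (M ^ 2 + 1))) ≤ 1 / 4 := by
    rw [mul_one_div, div_le_div_iff₀ (by positivity) (by norm_num)]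
    linarith
  have hMA : M ^ 2 * A ^ 2 ≤ M ^ 2 * C * k ^ 2 + 1 / 4 * ψ ^ 2 := by
    have h := mul_le_mul_of_nonneg_right hε (sq_nonneg ψ)
    calc M ^ 2 * A ^ 2 = M ^ 2 * C * k ^ 2 + M ^ 2 * (1 / (4 * (M ^ 2 + 1))) * ψ ^ 2 := by
          rw [hA]; ring
      _ ≤ _ := by linarith
  have hMC : 0 ≤ M ^ 2 * C := mul_nonneg (sq_nonneg M) hC
  have e : (M ^ 2 * C + 1) * (v ^ 2 + k ^ 2) =
      M ^ 2 * C * v ^ 2 + M ^ 2 * C * k ^ 2 + v ^ 2 + k ^ 2 := by ring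
  rw [e]
  linarith [sq_nonneg k, sq_nonneg v, sq_nonneg ψ, mul_nonneg hMC (sq_nonneg k),
    mul_nonneg hMC (sq_nonneg v)]

variable {V E : Type*} [Fintype E] {Γ : MetricGraph V E}

section Burgers

variable [Γ.Covered]

/-- The weak form of the Burgers equation, in terms of the graphs of `d` and `d^*`. -/
theorem burgers_equation_iff {u u' : Γ.L2} :
    (∀ v : Γ.VecDomain, ⟪u', ((v : Γ.dStar.domain) : Γ.L2)⟫_ℝ =
      vecLaplacianDist u v - 1 / 2 * dDist (fun x => u x ^ 2) v) ↔
    ∀ (q : Γ.gradGraph) (v : Γ.L2), (∀ p ∈ Γ.gradGraph, ⟪v, p.2⟫_ℝ = ⟪q.1.1, p.1⟫_ℝ) →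
      ⟪u', v⟫_ℝ = -⟪u, q.1.2⟫_ℝ - 1 / 2 * ⟪mulL (rep q) u, u⟫_ℝ := by
  have hint : ∀ q : Γ.gradGraph, ⟪mulL (rep q) u, u⟫_ℝ = ∫ x, q.1.1 x * u x ^ 2 ∂Γ.μ := fun q => by
    rw [inner_toL2L_mulL, toL2L_rep]
    simp only [sq]
  constructor
  · intro h q v hv
    obtain ⟨v', h1, h2, h3⟩ := exists_vecDomain (f := q.1.1) (g := q.1.2) q.2 hv
    have h4 := h v'
    rw [vecLaplacianDist, dStarDist, dDist, h1, h2, h3] at h4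
    rw [h4, hint]
  · intro h v
    rw [h ⟨_, mem_gradGraph_d (dStarVec v)⟩ _ (mem_vecDomain_spec v), hint]
    rfl

theorem exists_pos_le {a : C(Γ.Space, ℝ)} (ha : ∀ x, 0 < a x) : ∃ δ > 0, ∀ x, δ ≤ a x := by
  rcases isEmpty_or_nonempty Γ.Space with h | h
  · exact ⟨1, one_pos, fun x => h.elim x⟩
  · obtain ⟨x, -, hx⟩ := isCompact_univ.exists_isMinOn univ_nonempty a.continuous.continuousOn
    exact ⟨a x, ha x, fun y => hx (mem_univ y)⟩

theorem isGradient_ringInverse {F : C(Γ.Space, ℝ)} {g : Γ.L2} (h : IsGradient F g)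
    (hF : ∀ x, 0 < F x) :
    IsGradient (Ring.inverse F : C(Γ.Space, ℝ)) (mulL (-(Ring.inverse F * Ring.inverse F)) g) := by
  obtain ⟨δ, hδ, hle⟩ := exists_pos_le hF
  have hne : ∀ x ∈ Icc δ ‖F‖, x ≠ 0 := fun x hx => (hδ.trans_le hx.1).ne'
  refine h.comp (fun x => ⟨hle x, (apply_mem_Icc_norm F x).2⟩) (φ := fun x => x⁻¹)
    (φ' := fun x => -(x ^ 2)⁻¹) (fun x hx => hasDerivAt_inv (hne x hx)) ?_
    (ringInverse_apply hF) fun x => ?_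
  · exact ((continuousOn_id.pow 2).inv₀ fun x hx => pow_ne_zero 2 (hne x hx)).neg
  · rw [ContinuousMap.neg_apply, ContinuousMap.mul_apply, ringInverse_apply hF, sq, mul_inv]

theorem isGradient_log {F : C(Γ.Space, ℝ)} {g : Γ.L2} (h : IsGradient F g) (hF : ∀ x, 0 < F x) :
    IsGradient (fun x => -2 * Real.log (F x)) ((-2 : ℝ) • mulL (Ring.inverse F) g) := by
  obtain ⟨δ, hδ, hle⟩ := exists_pos_le hF
  have hne : ∀ x ∈ Icc δ ‖F‖, x ≠ 0 := fun x hx => (hδ.trans_le hx.1).ne'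
  let G : C(Γ.Space, ℝ) := ⟨fun x => Real.log (F x), F.continuous.log fun x => (hF x).ne'⟩
  have h1 : IsGradient G (mulL (Ring.inverse F) g) :=
    h.comp (fun x => ⟨hle x, (apply_mem_Icc_norm F x).2⟩) (φ := Real.log) (φ' := fun x => x⁻¹)
      (fun x hx => Real.hasDerivAt_log (hne x hx)) (continuousOn_id.inv₀ hne) (fun _ => rfl)
      (ringInverse_apply hF)
  exact h1.smul (-2)

theorem hasDerivAt_ringInverse {p : ℝ → C(Γ.Space, ℝ)} {p' : C(Γ.Space, ℝ)} {t : ℝ}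
    (hp : HasDerivAt p p' t) (hpos : ∀ x, 0 < p t x) :
    HasDerivAt (fun s => Ring.inverse (p s)) (-(Ring.inverse (p t) * p' * Ring.inverse (p t))) t := by
  obtain ⟨x, hx⟩ := isUnit_of_pos hpos
  have h1 := hasFDerivAt_ringInverse (𝕜 := ℝ) x
  have h3 : (↑x⁻¹ : C(Γ.Space, ℝ)) = Ring.inverse (p t) := by rw [← hx, Ring.inverse_unit]
  rw [hx, h3] at h1
  exact h1.comp_hasDerivAt t hp

theorem hasDerivAt_coleHopf {p : ℝ → Γ.gradGraph} {p' : Γ.gradGraph} {t : ℝ}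
    (hp : HasDerivAt p p' t) (hpos : ∀ x, 0 < rep (p t) x) :
    HasDerivAt (fun s => (-2 : ℝ) • mulL (Ring.inverse (rep (p s))) (p s).1.2)
      ((-2 : ℝ) • (mulL (-(Ring.inverse (rep (p t)) * rep p' * Ring.inverse (rep (p t)))) (p t).1.2 +
        mulL (Ring.inverse (rep (p t))) p'.1.2)) t := by
  let π : Γ.gradGraph →L[ℝ] Γ.L2 :=
    (ContinuousLinearMap.snd ℝ Γ.L2 Γ.L2).comp Γ.gradGraph.subtypeL
  have h1 : HasDerivAt (fun s => mulL (Ring.inverse (rep (p s))))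
      (mulL (-(Ring.inverse (rep (p t)) * rep p' * Ring.inverse (rep (p t))))) t :=
    mulL.hasFDerivAt.comp_hasDerivAt t
      (hasDerivAt_ringInverse (rep.hasFDerivAt.comp_hasDerivAt t hp) hpos)
  have h2 : HasDerivAt (fun s => (p s).1.2) p'.1.2 t := π.hasFDerivAt.comp_hasDerivAt t hp
  exact (h1.clm_apply h2).const_smul (-2 : ℝ)

/-- The algebraic identity behind the Cole-Hopf transform. -/
theorem coleHopf_identity {w w' q : Γ.gradGraph} (hpos : ∀ x, 0 < rep w x)
    (heat : ∀ r ∈ Γ.gradGraph, ⟪w.1.2, r.2⟫_ℝ = -⟪w'.1.1, r.1⟫_ℝ) {v : Γ.L2}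
    (hv : ∀ r ∈ Γ.gradGraph, ⟪v, r.2⟫_ℝ = ⟪q.1.1, r.1⟫_ℝ) :
    ⟪(-2 : ℝ) • (mulL (-(Ring.inverse (rep w) * rep w' * Ring.inverse (rep w))) w.1.2 +
        mulL (Ring.inverse (rep w)) w'.1.2), v⟫_ℝ =
      -⟪(-2 : ℝ) • mulL (Ring.inverse (rep w)) w.1.2, q.1.2⟫_ℝ -
        1 / 2 * ⟪mulL (rep q) ((-2 : ℝ) • mulL (Ring.inverse (rep w)) w.1.2),
          (-2 : ℝ) • mulL (Ring.inverse (rep w)) w.1.2⟫_ℝ := by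
  have hgU := isGradient_ringInverse (isGradient_rep w) hpos
  generalize Ring.inverse (rep w) = U at hgU ⊢
  generalize w.1.2 = g at hgU heat ⊢
  -- With `U = 1 / w` and `dU = -U² dw`, the time derivative is `-2 d(w' U)`. The adjoint relation
  -- is tested with `w' U`, the heat equation with `q U`; both produce `∫ q w' U`, and `d(q U)`
  -- splits into the linear and the quadratic term.
  have h1 := hv _ (mem_gradGraph_of_isGradient ((isGradient_rep w').mul hgU))
  have h2 := heat _ (mem_gradGraph_of_isGradient ((isGradient_rep q).mul hgU))
  have e1 : mulL (-(U * rep w' * U)) g = mulL (rep w') (mulL (-(U * U)) g) := by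
    rw [← mulL_mul]
    congr 2
    ring
  have e2 : ⟪q.1.1, toL2L (rep w' * U)⟫_ℝ = ⟪w'.1.1, toL2L (rep q * U)⟫_ℝ := by
    rw [← toL2L_rep q, ← toL2L_rep w', inner_toL2L, inner_toL2L]
    refine integral_congr_ae (ae_of_all _ fun x => ?_)
    simp only [ContinuousMap.mul_apply]
    ring
  have e3 : ⟪mulL (rep q) ((-2 : ℝ) • mulL U g), (-2 : ℝ) • mulL U g⟫_ℝ =
      -4 * ⟪g, mulL (rep q) (mulL (-(U * U)) g)⟫_ℝ := by
    have e4 : mulL U (mulL (rep q) (mulL U g)) = -mulL (rep q) (mulL (-(U * U)) g) := by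
      rw [← mulL_mul, ← mulL_mul, ← mulL_mul, ← neg_apply, ← map_neg]
      congr 2
      ring
    rw [map_smul, real_inner_smul_left, real_inner_smul_right, real_inner_comm, inner_mulL_comm U,
      e4, inner_neg_right]
    ring
  rw [inner_add_right] at h2
  rw [real_inner_smul_left, e1, real_inner_comm, h1, e2, e3, real_inner_smul_left,
    inner_mulL_comm U]
  linarith

/-- The Cole-Hopf transform of a positive solution of the heat equation solves the Burgers
equation. -/
theorem IsHeatPath.isBurgersSolution {p : ℝ → Γ.gradGraph} (hp : IsHeatPath p)
    (hpos : ∀ t ≥ 0, ∀ x, 0 < rep (p t) x) :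
    IsBurgersSolution ((-2 : ℝ) • mulL (Ring.inverse (rep (p 0))) (p 0).1.2)
      (fun t => (-2 : ℝ) • mulL (Ring.inverse (rep (p t))) (p t).1.2) := by
  let π : Γ.gradGraph →L[ℝ] Γ.L2 :=
    (ContinuousLinearMap.snd ℝ Γ.L2 Γ.L2).comp Γ.gradGraph.subtypeL
  refine ⟨?_, ?_, fun t ht => burgers_equation_iff.mpr fun q v hv => ?_, rfl⟩
  · have h1 : ContinuousOn (fun t => Ring.inverse (rep (p t))) (Ici 0) := fun t ht => by
      obtain ⟨x, hx⟩ := isUnit_of_pos (hpos t ht)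
      have h2 : ContinuousAt Ring.inverse (rep (p t)) := hx ▸ NormedRing.inverse_continuousAt x
      exact h2.comp_continuousWithinAt
        (f := fun t => rep (p t)) ((rep.continuous.comp_continuousOn hp.continuousOn) t ht)
    exact ((mulL.continuous.comp_continuousOn h1).clm_apply
      (π.continuous.comp_continuousOn hp.continuousOn)).const_smul (-2 : ℝ)
  · have h1 : ContDiffOn ℝ 1 (fun t => Ring.inverse (rep (p t))) (Ioi 0) := fun t ht => by
      obtain ⟨x, hx⟩ := isUnit_of_pos (hpos t (le_of_lt ht))
      have h2 : ContDiffAt ℝ 1 Ring.inverse (rep (p t)) := hx ▸ contDiffAt_ringInverse ℝ x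
      exact h2.comp_contDiffWithinAt t
        ((rep.contDiff.comp_contDiffOn hp.contDiffOn) t ht)
    exact ((mulL.contDiff.comp_contDiffOn h1).clm_apply
      (π.contDiff.comp_contDiffOn hp.contDiffOn)).const_smul (-2 : ℝ)
  · rw [(hasDerivAt_coleHopf (hasDerivAt_of_contDiffOn_Ioi hp.contDiffOn ht)
      (hpos t (le_of_lt ht))).deriv]
    exact coleHopf_identity (hpos t (le_of_lt ht)) (hp.equation t ht) hv

/-- The energy estimate for the difference of two solutions of the Burgers equation. -/
theorem exists_burgers_estimate {N F : Γ.L2 →L[ℝ] Γ.L2}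
    (hmem : ∀ z, (F z, z - N z) ∈ Γ.gradGraph)
    (hadj : ∀ z, ∀ p ∈ Γ.gradGraph, ⟪N z, p.2⟫_ℝ = ⟪F z, p.1⟫_ℝ) (M : ℝ) :
    ∃ C : ℝ, ∀ u₁ u₂ u₁' u₂' : Γ.L2, ‖u₁ + u₂‖ ≤ M →
      (∀ v : Γ.VecDomain, ⟪u₁', ((v : Γ.dStar.domain) : Γ.L2)⟫_ℝ =
        vecLaplacianDist u₁ v - 1 / 2 * dDist (fun x => u₁ x ^ 2) v) →
      (∀ v : Γ.VecDomain, ⟪u₂', ((v : Γ.dStar.domain) : Γ.L2)⟫_ℝ =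
        vecLaplacianDist u₂ v - 1 / 2 * dDist (fun x => u₂ x ^ 2) v) →
      ⟪u₁' - u₂', N (u₁ - u₂)⟫_ℝ ≤ C * (‖N (u₁ - u₂)‖ ^ 2 + ‖F (u₁ - u₂)‖ ^ 2) := by
  -- The gradient constant is fixed by `M`, so that after multiplication by `M²` it is at most `1 /
  -- 4`.
  obtain ⟨C, hC, hsob⟩ := exists_sobolev (Γ := Γ) (ε := 1 / (4 * (M ^ 2 + 1))) (by positivity)
  refine ⟨M ^ 2 * C + 1, fun u₁ u₂ u₁' u₂' hM h₁ h₂ => ?_⟩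
  set z := u₁ - u₂ with hz
  set v := N z with hv
  set k := F z with hk
  set ψ := z - v with hψ
  -- The equations are tested with `v = N z`, for which `d^* v = k` and `d d^* v = ψ`; thus `⟨z, d
  -- d^* v⟩ = ‖k‖² + ‖ψ‖²` is the dissipation.
  let q : Γ.gradGraph := ⟨(k, ψ), hmem z⟩
  have e₁ := burgers_equation_iff.mp h₁ q v (hadj z)
  have e₂ := burgers_equation_iff.mp h₂ q v (hadj z)
  have hvψ : ⟪v, ψ⟫_ℝ = ‖k‖ ^ 2 := by
    rw [← real_inner_self_eq_norm_sq]
    exact hadj z _ (hmem z)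
  have hzψ : ⟪z, ψ⟫_ℝ = ‖k‖ ^ 2 + ‖ψ‖ ^ 2 := by
    have : z = v + ψ := by rw [hψ]; abel
    rw [this, inner_add_left, hvψ, real_inner_self_eq_norm_sq]
  -- The factorization `u₁² - u₂² = z (u₁ + u₂)`, weighted by `d^* v`.
  have hdiff : ⟪mulL (rep q) u₁, u₁⟫_ℝ - ⟪mulL (rep q) u₂, u₂⟫_ℝ =
      ⟪mulL (rep q) z, u₁ + u₂⟫_ℝ := by
    rw [hz, map_sub, inner_sub_left, inner_add_right, inner_add_right,
      inner_mulL_comm _ u₂ u₁, real_inner_comm (mulL (rep q) u₁) u₂]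
    ring
  have heq : ⟪u₁' - u₂', v⟫_ℝ =
      -(‖k‖ ^ 2 + ‖ψ‖ ^ 2) - 1 / 2 * ⟪mulL (rep q) z, u₁ + u₂⟫_ℝ := by
    rw [inner_sub_left, e₁, e₂, ← hzψ, ← hdiff, hz, inner_sub_left]
    ring
  set A := √(C * ‖k‖ ^ 2 + 1 / (4 * (M ^ 2 + 1)) * ‖ψ‖ ^ 2) with hA
  have hA2 : A ^ 2 = C * ‖k‖ ^ 2 + 1 / (4 * (M ^ 2 + 1)) * ‖ψ‖ ^ 2 := Real.sq_sqrt (by positivity)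
  have hA0 : 0 ≤ A := Real.sqrt_nonneg _
  have hmul : ‖mulL (rep q) z‖ ≤ A * ‖z‖ := by
    refine norm_mulL_le hA0 (fun x => ?_) z
    have h := hsob _ _ (isGradient_rep q) x
    rw [← toL2L_apply, toL2L_rep] at h
    rw [hA2]
    exact h
  have hM0 : 0 ≤ M := (norm_nonneg _).trans hM
  have hcs : -⟪mulL (rep q) z, u₁ + u₂⟫_ℝ ≤ A * ‖z‖ * M := by
    refine (neg_le_abs _).trans ((abs_real_inner_le_norm _ _).trans ?_)
    exact mul_le_mul hmul hM (norm_nonneg _) (mul_nonneg hA0 (norm_nonneg _))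
  have hznorm : ‖z‖ ≤ ‖v‖ + ‖ψ‖ := by
    have : z = v + ψ := by rw [hψ]; abel
    rw [this]
    exact norm_add_le _ _
  rw [heq]
  exact energy_bound hC.le hA2 (norm_nonneg z) hznorm hcs

/-- Solutions of the Burgers equation are unique. -/
theorem IsBurgersSolution.eq {u₀ : Γ.L2} {u₁ u₂ : ℝ → Γ.L2} (h₁ : IsBurgersSolution u₀ u₁)
    (h₂ : IsBurgersSolution u₀ u₂) {t : ℝ} (ht : 0 ≤ t) : u₁ t = u₂ t := by
  obtain ⟨N, F, hmem, hadj, hNF⟩ := exists_vecResolvent (Γ := Γ)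
  have hsub : Icc 0 t ⊆ Ici 0 := Icc_subset_Ici_self
  obtain ⟨M, hM⟩ := isCompact_Icc.exists_bound_of_continuousOn
    ((h₁.continuousOn.add h₂.continuousOn).mono hsub)
  obtain ⟨C, hC⟩ := exists_burgers_estimate hmem hadj M
  -- The form of `N` is a negative-order norm, weak enough to be estimated from the equation tested
  -- on `D(L⃗)`.
  have hQ : ∀ z, ⟪N z, z⟫_ℝ = ‖N z‖ ^ 2 + ‖F z‖ ^ 2 := fun z => by
    rw [hNF, real_inner_self_eq_norm_sq, real_inner_self_eq_norm_sq]
  have hsymm : ∀ x y, ⟪N x, y⟫_ℝ = ⟪N y, x⟫_ℝ := fun x y => by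
    rw [hNF x y, hNF y x, real_inner_comm (N x), real_inner_comm (F x)]
  -- Grönwall with an integrating factor: by symmetry of `N` the form has derivative `2 ⟨z', N z⟩ ≤
  -- 2 C Q(z)`.
  have hanti : AntitoneOn (fun s => Real.exp (-(2 * C) * s) *
      ⟪N (u₁ s - u₂ s), u₁ s - u₂ s⟫_ℝ) (Icc 0 t) := by
    refine antitoneOn_of_hasDerivWithinAt_nonpos (convex_Icc 0 t) ?_
      (f' := fun s => Real.exp (-(2 * C) * s) * (2 * ⟪deriv u₁ s - deriv u₂ s, N (u₁ s - u₂ s)⟫_ℝ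
        - 2 * C * ⟪N (u₁ s - u₂ s), u₁ s - u₂ s⟫_ℝ)) (fun s hs => ?_) fun s hs => ?_
    · have hc := (h₁.continuousOn.sub h₂.continuousOn).mono hsub
      exact (Continuous.continuousOn (by fun_prop)).mul
        ((N.continuous.comp_continuousOn hc).inner hc)
    · rw [interior_Icc] at hs
      have hd := (hasDerivAt_of_contDiffOn_Ioi h₁.contDiffOn hs.1).sub
        (hasDerivAt_of_contDiffOn_Ioi h₂.contDiffOn hs.1)
      have hdN := N.hasFDerivAt.comp_hasDerivAt s hd
      have hde := ((hasDerivAt_id s).const_mul (-(2 * C))).exp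
      refine ((hde.mul (hdN.inner ℝ hd)).congr_deriv ?_).hasDerivWithinAt
      simp only [Function.comp_apply, Pi.sub_apply, id, mul_one]
      rw [hsymm (deriv u₁ s - deriv u₂ s), real_inner_comm (deriv u₁ s - deriv u₂ s)]
      ring
    · rw [interior_Icc] at hs
      have h := hC _ _ _ _ (hM s (Ioo_subset_Icc_self hs)) (h₁.equation s hs.1)
        (h₂.equation s hs.1)
      rw [hQ]
      exact mul_nonpos_of_nonneg_of_nonpos (Real.exp_pos _).le (by linarith)
  have h0 := hanti ⟨le_rfl, ht⟩ ⟨ht, le_rfl⟩ ht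
  simp only [h₁.initial, h₂.initial, sub_self, map_zero, inner_zero_left, mul_zero] at h0
  have h3 : ‖N (u₁ t - u₂ t)‖ ^ 2 + ‖F (u₁ t - u₂ t)‖ ^ 2 ≤ 0 := by
    rw [← hQ]
    exact nonpos_of_mul_nonpos_right h0 (Real.exp_pos _)
  have h4 : ‖N (u₁ t - u₂ t)‖ ^ 2 = 0 :=
    le_antisymm (by linarith [sq_nonneg ‖F (u₁ t - u₂ t)‖]) (sq_nonneg _)
  have h5 : ‖F (u₁ t - u₂ t)‖ ^ 2 = 0 :=
    le_antisymm (by linarith [sq_nonneg ‖N (u₁ t - u₂ t)‖]) (sq_nonneg _)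
  rw [pow_eq_zero_iff two_ne_zero, norm_eq_zero] at h4 h5
  -- `F z = 0` and `N z = 0` put `(0, z)` in the graph of `d`, hence `z = 0`.
  have h6 := Γ.gradGraph_single_valued _ (hmem (u₁ t - u₂ t)) h5
  rw [h4, sub_zero] at h6
  exact sub_eq_zero.mp h6

end Burgers

end MetricGraph

/-! ### Graphs without edges and the final assembly -/

namespace MetricGraph

variable {V E : Type*} [Fintype E] {Γ : MetricGraph V E}

theorem IsHeatSolution.congr {w₀ : Γ.L2} {w w' : ℝ → Γ.L2} (h : IsHeatSolution w₀ w)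
    (heq : ∀ t ≥ 0, w' t = w t) : IsHeatSolution w₀ w' := by
  refine ⟨h.continuousOn.congr heq, h.contDiffOn.congr fun t ht => heq t (le_of_lt ht),
    fun t ht => ?_, (heq 0 le_rfl).trans h.initial⟩
  have h1 : w' =ᶠ[𝓝 t] w := by
    filter_upwards [Ioi_mem_nhds ht] with s hs using heq s (le_of_lt hs)
  rw [h1.deriv_eq, heq t (le_of_lt ht)]
  exact h.equation t ht

section NoEdges

variable [IsEmpty E]

theorem subsingleton_L2 : Subsingleton Γ.L2 :=
  ⟨fun _ _ => Lp.ext (ae_iff_map.mpr fun e => isEmptyElim e)⟩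

theorem isKirchhoffLaplacian_of_isEmpty (f k : Γ.L2) : IsKirchhoffLaplacian f k := by
  have := subsingleton_L2 (Γ := Γ)
  have hf : f ∈ Γ.d.domain := by
    rw [Subsingleton.elim f 0]
    exact zero_mem _
  refine ⟨hf, fun φ => ?_⟩
  rw [energy, Subsingleton.elim (Γ.d ⟨f, hf⟩) 0, Subsingleton.elim k 0, inner_zero_left,
    inner_zero_left, neg_zero]

theorem isHeatSemigroup_of_isEmpty (T : ℝ → Γ.L2 →L[ℝ] Γ.L2) : Γ.IsHeatSemigroup T := by
  have := subsingleton_L2 (Γ := Γ)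
  refine ⟨Subsingleton.elim _ _, fun _ _ _ _ => Subsingleton.elim _ _, fun f => ?_, fun f k => ?_⟩
  · exact tendsto_const_nhds.congr fun t => Subsingleton.elim f _
  · exact iff_of_true (isKirchhoffLaplacian_of_isEmpty f k)
      (tendsto_const_nhds.congr fun t => Subsingleton.elim k _)

theorem isHeatSolution_of_isEmpty (w₀ : Γ.L2) (w : ℝ → Γ.L2) : IsHeatSolution w₀ w := by
  have := subsingleton_L2 (Γ := Γ)
  have h : w = fun _ => 0 := Subsingleton.elim _ _
  subst h
  exact ⟨continuousOn_const, contDiffOn_const, fun t _ => isKirchhoffLaplacian_of_isEmpty _ _,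
    Subsingleton.elim _ _⟩

theorem isBurgersSolution_of_isEmpty (u₀ : Γ.L2) (u : ℝ → Γ.L2) : IsBurgersSolution u₀ u := by
  have := subsingleton_L2 (Γ := Γ)
  have h : u = fun _ => 0 := Subsingleton.elim _ _
  subst h
  refine ⟨continuousOn_const, contDiffOn_const, fun t _ v => ?_, Subsingleton.elim _ _⟩
  rw [vecLaplacianDist, dStarDist, dDist,
    integral_eq_zero_of_ae (ae_iff_map.mpr fun e => isEmptyElim e), inner_zero_left,
    Subsingleton.elim (deriv _ t) 0, inner_zero_left, neg_zero, mul_zero, sub_zero]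

end NoEdges

/-- The solution of the heat equation starting at `e^{-h₀/2}` and its Cole-Hopf transform. -/
theorem exists_coleHopf_solution [Γ.Covered] {R D : Γ.L2 →L[ℝ] Γ.L2} {T : ℝ → Γ.L2 →L[ℝ] Γ.L2}
    (hR : IsResolvent R) (hT : IsResolventSemigroup R T)
    (hL : ∀ f k, IsKirchhoffLaplacian f k ↔ f = R (f - k))
    (hmem : ∀ y, (R y, D y) ∈ Γ.gradGraph)
    (heq : ∀ y, ∀ p ∈ Γ.gradGraph, ⟪y - R y, p.1⟫_ℝ = ⟪D y, p.2⟫_ℝ)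
    {h₀ : C(Γ.Space, ℝ)} {u₀ : Γ.L2} (h : IsGradient h₀ u₀) :
    ∃ w : ℝ → C(Γ.Space, ℝ),
      (∀ t ≥ 0, toL2 (w t) (w t).continuous =
        T t (toL2 (fun x => Real.exp (-h₀ x / 2)) (by fun_prop))) ∧
      (∀ t ≥ 0, ∀ x, 0 < w t x) ∧
      ∃ u : ℝ → Γ.L2,
        (∀ t ≥ 0, IsGradient (fun x => -2 * Real.log (w t x)) (u t)) ∧
        IsBurgersSolution u₀ u := by
  let W : C(Γ.Space, ℝ) := ⟨fun x => Real.exp (-h₀ x / 2), by fun_prop⟩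
  have hW : NormedSpace.exp ((-1 / 2 : ℝ) • h₀) = W := ContinuousMap.ext fun x => by
    rw [exp_apply, ContinuousMap.smul_apply, smul_eq_mul]
    exact congrArg Real.exp (by ring)
  have hWpos : ∀ x, 0 < W x := fun x => Real.exp_pos _
  have hg := isGradient_exp h (-1 / 2)
  rw [hW] at hg
  obtain ⟨p, hp, hp0, hpT⟩ :=
    exists_heatPath hR hT hL hmem heq ⟨_, mem_gradGraph_of_isGradient hg⟩
  have hrep : rep (p 0) = W := by
    rw [hp0]
    exact rep_eq hg rfl
  have hpos : ∀ t ≥ 0, ∀ x, 0 < rep (p t) x := fun t ht x => by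
    obtain ⟨δ, hδ, hle⟩ := exists_pos_le hWpos
    exact hδ.trans_le (hp.le_rep (by rwa [hrep]) ht x)
  have hlog : ∀ t ≥ 0, IsGradient (fun x => -2 * Real.log (rep (p t) x))
      ((-2 : ℝ) • mulL (Ring.inverse (rep (p t))) (p t).1.2) := fun t ht => isGradient_log (isGradient_rep (p t)) (hpos t ht)
  refine ⟨fun t => rep (p t), fun t ht => (toL2L_rep (p t)).trans (hpT t ht), hpos,
    fun t => (-2 : ℝ) • mulL (Ring.inverse (rep (p t))) (p t).1.2, hlog, ?_⟩
  -- At time zero `-2 log w = h₀`, and a function has only one gradient.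
  have hu₀ : (-2 : ℝ) • mulL (Ring.inverse (rep (p 0))) (p 0).1.2 = u₀ := by
    have h1 := hlog 0 le_rfl
    have h2 : (fun x => -2 * Real.log (rep (p 0) x)) = h₀ := funext fun x => by
      rw [hrep]
      change -2 * Real.log (Real.exp (-h₀ x / 2)) = h₀ x
      rw [Real.log_exp]
      ring
    rw [h2] at h1
    exact (h1.eq_of_toL2_eq h rfl).2
  rw [← hu₀]
  exact hp.isBurgersSolution hpos

end MetricGraph

theorem theoremT {V E : Type*} [Fintype E] (Γ : MetricGraph V E) (hconn : Γ.Connected)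
    (hloops : Γ.NoLoops) (hmult : Γ.NoMultipleEdges) :
    (∃ T, Γ.IsHeatSemigroup T) ∧
    ∀ T, Γ.IsHeatSemigroup T →
    ∀ (h₀ : C(Γ.Space, ℝ)) (u₀ : Γ.L2), MetricGraph.IsGradient h₀ u₀ →
    ∀ w₀ : Γ.L2, w₀ = MetricGraph.toL2 (fun x => Real.exp (-h₀ x / 2)) (by fun_prop) →
      -- `T t w₀` is the unique solution of the heat equation
      MetricGraph.IsHeatSolution w₀ (fun t => T t w₀) ∧
      (∀ w', MetricGraph.IsHeatSolution w₀ w' → ∀ t ≥ 0, w' t = T t w₀) ∧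
      -- it is represented by strictly positive continuous functions `w t`
      ∃ w : ℝ → C(Γ.Space, ℝ),
        (∀ t ≥ 0, MetricGraph.toL2 (w t) (w t).continuous = T t w₀) ∧
        (∀ t ≥ 0, ∀ x, 0 < w t x) ∧
        -- and `u t = -2 d log (w t)` is the unique solution of the Burgers equation
        ∃ u : ℝ → Γ.L2,
          (∀ t ≥ 0, MetricGraph.IsGradient (fun x => -2 * Real.log (w t x)) (u t)) ∧
          MetricGraph.IsBurgersSolution u₀ u ∧
          ∀ u', MetricGraph.IsBurgersSolution u₀ u' → ∀ t ≥ 0, u' t = u t := by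
  -- Without edges the space may still have a vertex, which lies on no edge, so `Covered` can fail;
  -- but then `L²` is trivial.
  rcases isEmpty_or_nonempty E with hE | hE
  · have := MetricGraph.subsingleton_L2 (Γ := Γ)
    refine ⟨⟨1, MetricGraph.isHeatSemigroup_of_isEmpty 1⟩, fun T _ h₀ u₀ _ w₀ _ =>
      ⟨MetricGraph.isHeatSolution_of_isEmpty _ _, fun _ _ _ _ => Subsingleton.elim _ _,
        fun _ => 1, fun _ _ => Subsingleton.elim _ _, fun _ _ _ => one_pos, fun _ => 0,
        fun _ _ => MetricGraph.isGradient_const (-2 * Real.log 1), MetricGraph.isBurgersSolution_of_isEmpty _ _,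
        fun _ _ _ _ => Subsingleton.elim _ _⟩⟩
  · have := hconn.covered
    obtain ⟨R, D, hR, hmem, heq, hL⟩ := MetricGraph.exists_resolvent (Γ := Γ)
    obtain ⟨S, hS⟩ := hR.exists_semigroup
    refine ⟨⟨S, MetricGraph.isHeatSemigroup_of_resolvent hR hS hL⟩, fun T hT h₀ u₀ hu₀ w₀ hw₀ => ?_⟩
    have hTS : ∀ t ≥ 0, T t = S t := fun t ht => hT.eq_of_resolvent hR hS hL ht
    have hsol : MetricGraph.IsHeatSolution w₀ (fun t => T t w₀) :=
      (MetricGraph.isHeatSolution_of_resolvent hR hS hL w₀).congr fun t ht => by rw [hTS t ht]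
    obtain ⟨w, hw, hpos, u, hu, hB⟩ :=
      MetricGraph.exists_coleHopf_solution hR hS hL hmem heq hu₀
    refine ⟨hsol, fun w' hw' t ht => hw'.eq hsol ht, w, fun t ht => ?_, hpos, u, hu, hB,
      fun u' hu' t ht => hu'.eq hB ht⟩
    rw [hw t ht, hTS t ht, hw₀]
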